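/- Let $\Omega=\{(x,y)\in\mathbb R^2: x^2+y^2>1,\ y>0\}$ and $\mathcal E=\{x\in\mathbb R: |x|>1\}$. All functions are complex valued, and $\|v\|_{W^{1,2}(\mathcal E)}^2=\|v\|_{L^2(\mathcal E)}^2+\|v'\|_{L^2(\mathcal E)}^2$. For $v\in W^{1,2}(\mathcal E)$ (identified with its continuous representative on $\overline{\mathcal E}$) define the Dirichlet operator $D_\Omega$ on $\overline\Omega$ by $$(D_\Omega v)(x,y)=\frac1\pi\int_{\mathcal E}\left[\frac{y}{(x-\tilde x)^2+y^2}+\frac{y}{(x\tilde x-1)^2+y^2\tilde x^2}\right]v(\tilde x)\,\mathrm d\tilde x\quad(y>0),\qquad (D_\Omega v)(x,0)=v(x)\quad(x\in\overline{\mathcal E}),$$ and the Dirichlet-to-Neumann operator $\Lambda_\Omega$ by $$(\Lambda_\Omega v)(x)=(\mathcal H g)(x)+\frac1{x^2}(\mathcal H g)\!\left(\frac1x\right)+\frac{v(1)-v(-1)}{\pi x}\qquad(\text{a.e. }x\in\mathcal E),$$ where $g\in L^2(\mathbb R)$ is the extension of $v'$ by zero outside $\mathcal E$ and $\mathcal H$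 is the Hilbert transform $(\mathcal Hf)(x)=\frac1\pi\lim_{\varepsilon\to0+}\int_{|x-\tilde x|\ge\varepsilon}\frac{f(\tilde x)}{x-\tilde x}\,\mathrm d\tilde x$. Let $\dot W^{1,2}(\Omega)=\{\varphi\in L^1_{\rm loc}(\Omega):\nabla\varphi\in L^2(\Omega)\}$ be the Beppo-Levi space. Then: 1. There is a constant $C>0$ such that, for every $v\in W^{1,2}(\mathcal E)$, $D_\Omega v\in\dot W^{1,2}(\Omega)$ and $\|\nabla(D_\Omega v)\|_{L^2(\Omega)}\le C\|v\|_{W^{1,2}(\mathcal E)}$. 2. For every $v\in W^{1,2}(\mathcal E)$ the principal values in the formula for $\Lambda_\Omega v$ exist for almost every $x\in\mathcal E$, and $\Lambda_\Omega v\in L^2(\mathcal E)$. For all $v,u\in W^{1,2}(\mathcal E)$, $$\int_\Omega\nabla(D_\Omega v)\cdot\overline{\nabla(D_\Omega u)}\,\mathrm dx\,\mathrm dy=\int_{\mathcal E}(\Lambda_\Omega v)\,\overline u\,\mathrm dx.$$ 3. Consequently $\Lambda_\Omega:W^{1,2}(\mathcal E)\to L^2(\mathcal E)$ is symmetric on $L^2(\mathcal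 E)$: $\int_{\mathcal E}(\Lambda_\Omega v)\,\overline u\,\mathrm dx=\int_{\mathcal E}v\,\overline{\Lambda_\Omega u}\,\mathrm dx$ for all $v,u\in W^{1,2}(\mathcal E)$. -/

import Mathlib

open MeasureTheory Set Filter Topology
open scoped ComplexConjugate

namespace HalfPlaneDisk

noncomputable section

/-- `w` is the weak derivative of `u` in the direction `e` on the open set `U`. -/
def HasWeakDeriv {V : Type*} [NormedAddCommGroup V] [NormedSpace ℝ V] [MeasureSpace V]
    (U : Set V) (u : V → ℂ) (e : V) (w : V → ℂ) : Prop :=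
  LocallyIntegrableOn u U ∧ LocallyIntegrableOn w U ∧
    ∀ φ : V → ℝ, ContDiff ℝ (⊤ : ℕ∞) φ → HasCompactSupport φ → tsupport φ ⊆ U →
      ∫ x in U, (fderiv ℝ φ x e) • u x = -∫ x in U, φ x • w x

open Classical in
/-- The weak derivative of `u` in the direction `e` on `U`; it is determined almost everywhere
on `U`, and has the value `0` if there is none. -/
def weakDeriv {V : Type*} [NormedAddCommGroup V] [NormedSpace ℝ V] [MeasureSpace V]
    (U : Set V) (u : V → ℂ) (e : V) : V → ℂ :=
  if h : ∃ w, HasWeakDeriv U u e w then h.choose else 0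

/-- The fluid domain: points `(x, y)` of the upper half-plane outside the closed unit disk. -/
def fluidDomain : Set (ℝ × ℝ) := {p | 1 < p.1 ^ 2 + p.2 ^ 2 ∧ 0 < p.2}

/-- The free surface `{x ∈ ℝ : |x| > 1}`. -/
def freeSurface : Set ℝ := {x | 1 < |x|}

/-- Membership in the Sobolev space `W^{1,2}` of the free surface (complex-valued functions, only
their values almost everywhere on the free surface matter). -/
def MemW12 (v : ℝ → ℂ) : Prop :=
  MemLp v 2 (volume.restrict freeSurface) ∧
    ∃ w, HasWeakDeriv freeSurface v 1 w ∧ MemLp w 2 (volume.restrict freeSurface)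

/-- The norm of `W^{1,2}` of the free surface. -/
def normW12 (v : ℝ → ℂ) : ℝ :=
  Real.sqrt ((∫ x in freeSurface, ‖v x‖ ^ 2) +
    ∫ x in freeSurface, ‖weakDeriv freeSurface v 1 x‖ ^ 2)

open Classical in
/-- The continuous representative, on the closure of the free surface, of a `W^{1,2}` function.
Its values on that closure (in particular at `1` and `-1`) are uniquely determined. -/
def contRep (v : ℝ → ℂ) : ℝ → ℂ :=
  if h : ∃ w : ℝ → ℂ, ContinuousOn w (closure freeSurface) ∧
      w =ᵐ[volume.restrict freeSurface] v
  then h.choose else 0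

/-- The Dirichlet operator of the fluid domain, by its Poisson-type formula. -/
def dirichletOp (v : ℝ → ℂ) (p : ℝ × ℝ) : ℂ :=
  if 0 < p.2 then
    (1 / Real.pi : ℝ) * ∫ t in freeSurface,
      ((p.2 / ((p.1 - t) ^ 2 + p.2 ^ 2) +
        p.2 / ((p.1 * t - 1) ^ 2 + p.2 ^ 2 * t ^ 2) : ℝ) : ℂ) * v t
  else contRep v p.1

/-- The weak gradient on an open set of the plane. -/
def weakGrad (U : Set (ℝ × ℝ)) (u : ℝ × ℝ → ℂ) (p : ℝ × ℝ) : EuclideanSpace ℂ (Fin 2) :=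
  !₂[weakDeriv U u (1, 0) p, weakDeriv U u (0, 1) p]

/-- Membership in the Beppo-Levi space of the open set `U`: locally integrable functions
whose weak gradient is square integrable on `U`. -/
def MemBeppoLevi (U : Set (ℝ × ℝ)) (u : ℝ × ℝ → ℂ) : Prop :=
  LocallyIntegrableOn u U ∧
    ∃ a b : ℝ × ℝ → ℂ, HasWeakDeriv U u (1, 0) a ∧ HasWeakDeriv U u (0, 1) b ∧
      MemLp a 2 (volume.restrict U) ∧ MemLp b 2 (volume.restrict U)

/-- The truncated Hilbert transform `(1/π) ∫_{|x - t| ≥ ε} f(t) / (x - t) dt`. -/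
def truncHilbert (f : ℝ → ℂ) (x ε : ℝ) : ℂ :=
  (1 / Real.pi : ℝ) * ∫ t in {t : ℝ | ε ≤ |x - t|}, f t / ((x - t : ℝ) : ℂ)

/-- The principal value defining the Hilbert transform of `f` exists at `x`. -/
def HilbertExistsAt (f : ℝ → ℂ) (x : ℝ) : Prop :=
  ∃ l : ℂ, Tendsto (truncHilbert f x) (𝓝[>] 0) (𝓝 l)

/-- The Hilbert transform, as the pointwise limit of the truncated ones. -/
def hilbertTransform (f : ℝ → ℂ) (x : ℝ) : ℂ :=
  limUnder (𝓝[>] (0 : ℝ)) (truncHilbert f x)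

/-- The extension by zero to `ℝ` of the weak derivative of `v` on the free surface. -/
def zeroExtDeriv (v : ℝ → ℂ) : ℝ → ℂ :=
  freeSurface.indicator (weakDeriv freeSurface v 1)

/-- The Dirichlet-to-Neumann operator of the fluid domain, by its explicit formula through
the Hilbert transform. -/
def dirichletNeumann (v : ℝ → ℂ) (x : ℝ) : ℂ :=
  hilbertTransform (zeroExtDeriv v) x + (1 / (x : ℂ) ^ 2) * hilbertTransform (zeroExtDeriv v) (1 / x) +
    (contRep v 1 - contRep v (-1)) / (Real.pi * x)

end

end HalfPlaneDisk

open HalfPlaneDisk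

open scoped ENNReal
open HalfPlaneDisk

/-! The inversion `z ↦ 1 / conj z` exchanges the two pieces, outside and inside the unit disk, of
the upper half-plane. Extend `v` to a function `V` on the line that is invariant under `s ↦ 1 / s`
(`inversionExt 1 v`). Substituting `t ↦ 1 / t` on `[-1, 1]` turns the Poisson integral of `V` into
the formula for `dirichletOp v` (`dirichletOp_eq_poissonExt`). The derivative of `V` is `f s = g s -
g (1 / s) / s ^ 2`, and partial fractions show that the Hilbert transform of `f` on the free surface
is the Dirichlet-to-Neumann expression; the term with `v 1 - v (-1)` is what remains of the integral
of `g` (`W12Data.hilbertTransform_inversionExtDeriv`).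

In Fourier space the Dirichlet energy of the Poisson extension in the half-plane is the integral of
`2π|ξ| |V̂|²`. Since the Hilbert transform has symbol `-i sgn ξ` and `f` has Fourier transform `2πiξ
V̂`, this is the pairing of the Hilbert transform of `f` with `V` (`DerivPair.energy`). By conformal
invariance of the Dirichlet integral the fluid domain carries half of the energy
(`lintegral_energyDensity_upper_of_inv_invariant`). The boundary pairing splits into two equal
halves as well, because `Hf x = Hf (1 / x) / x ^ 2`; this symmetry follows from the orthogonality,
for the energy form, of functions even and odd under the inversion
(`W12Data.hilbertTransform_inversionExtDeriv_inv`).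

The derivative `f` need not be square integrable at `0` unless `g` decays, so all this is done for
`v` of bounded support. There the identity and Cauchy-Schwarz bound the energy by the `W^{1,2}`
norm. Cutoffs and Fatou's lemma extend the bound to every `v` (`W12Data.eLpNorm_poissonGrad_le`);
applied to differences, the bound gives convergence of gradients and hence the identity on the
diagonal. Polarization gives the full identity (`W12Data.inner_gradLp_eq`), and the Hermitian
symmetry of the Dirichlet form gives the symmetry of the operator.

Almost everywhere existence of the principal values comes from comparing the truncated kernel with
the conjugate Poisson kernel at Lebesgue points: the difference is odd and dominated by the Poisson
kernel (`exists_hilbertTransform`). -/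

/-! ### Poisson averages at Lebesgue points. -/

lemma lintegral_Ici_poisson_layer {u ε : ℝ} (hε : 0 < ε) (hu : 0 ≤ u) :
    ∫⁻ r in Ici (u / ε), ENNReal.ofReal (2 * r / (1 + r ^ 2) ^ 2 / ε) =
      ENNReal.ofReal (ε / (u ^ 2 + ε ^ 2)) := by
  have hd : ∀ r ∈ Ici (u / ε), HasDerivAt (fun r : ℝ => -(1 + r ^ 2)⁻¹ / ε)
      (2 * r / (1 + r ^ 2) ^ 2 / ε) r := by
    intro r _
    have h1 : HasDerivAt (fun r : ℝ => 1 + r ^ 2) (2 * r) r := by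
      simpa using (hasDerivAt_pow 2 r).const_add 1
    have h2 := ((h1.inv (by positivity)).neg).div_const ε
    refine h2.congr_deriv ?_
    ring
  have hp : ∀ r ∈ Ioi (u / ε), 0 ≤ 2 * r / (1 + r ^ 2) ^ 2 / ε := by
    intro r hr
    have : 0 < r := lt_of_le_of_lt (by positivity) hr
    positivity
  have hl : Tendsto (fun r : ℝ => -(1 + r ^ 2)⁻¹ / ε) atTop (𝓝 0) := by
    have : Tendsto (fun r : ℝ => 1 + r ^ 2) atTop atTop :=
      tendsto_atTop_add_const_left _ _ (tendsto_pow_atTop two_ne_zero)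
    simpa using (this.inv_tendsto_atTop.neg).div_const ε
  have h := integral_Ioi_of_hasDerivAt_of_nonneg' hd hp hl
  rw [setLIntegral_congr Ioi_ae_eq_Ici.symm, ← ofReal_integral_eq_lintegral_ofReal
    (integrableOn_Ioi_deriv_of_nonneg' hd hp hl), h]
  · congr 1
    field_simp
    ring
  · filter_upwards [ae_restrict_mem measurableSet_Ioi] with r hr using hp r hr

/-- Layer-cake decomposition: the Poisson kernel is a superposition of indicators of the balls of
radius `ε * r`, so by Tonelli its averages are mixtures of ball integrals, which the Lebesgue
differentiation theorem controls. -/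
lemma lintegral_mul_poisson_eq (g : ℝ → ℝ≥0∞) (hg : AEMeasurable g) (x : ℝ) {ε : ℝ} (hε : 0 < ε) :
    ∫⁻ t, g t * ENNReal.ofReal (ε / ((x - t) ^ 2 + ε ^ 2)) =
      ∫⁻ r in Ioi (0 : ℝ), ENNReal.ofReal (2 * r / (1 + r ^ 2) ^ 2 / ε) *
        ∫⁻ t in Metric.closedBall x (ε * r), g t := by
  let k : ℝ → ℝ≥0∞ := fun r => ENNReal.ofReal (2 * r / (1 + r ^ 2) ^ 2 / ε)
  have hk : Measurable k := by fun_prop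
  have hS : MeasurableSet {p : ℝ × ℝ | |x - p.1| ≤ ε * p.2} :=
    measurableSet_le (by fun_prop) (by fun_prop)
  have h1 : ∀ t, g t * ENNReal.ofReal (ε / ((x - t) ^ 2 + ε ^ 2)) =
      ∫⁻ r in Ioi (0 : ℝ), {p : ℝ × ℝ | |x - p.1| ≤ ε * p.2}.indicator
        (fun p => g p.1 * k p.2) (t, r) := by
    intro t
    have h2 : ∀ r, {p : ℝ × ℝ | |x - p.1| ≤ ε * p.2}.indicator
        (fun p => g p.1 * k p.2) (t, r) = (Ici (|x - t| / ε)).indicator (fun r => g t * k r) r := by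
      intro r
      simp only [indicator, mem_ofPred_eq, mem_Ici, div_le_iff₀ hε, mul_comm r]
    simp_rw [h2]
    rw [setLIntegral_congr Ioi_ae_eq_Ici, lintegral_indicator measurableSet_Ici,
      Measure.restrict_restrict measurableSet_Ici, Set.inter_eq_left.2, lintegral_const_mul _ hk,
      lintegral_Ici_poisson_layer hε (abs_nonneg _), sq_abs]
    exact Ici_subset_Ici.2 (by positivity)
  simp_rw [h1]
  rw [lintegral_lintegral_swap]
  · refine lintegral_congr fun r => ?_
    have h2 : ∀ t, {p : ℝ × ℝ | |x - p.1| ≤ ε * p.2}.indicator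
        (fun p => g p.1 * k p.2) (t, r) =
        (Metric.closedBall x (ε * r)).indicator (fun t => k r * g t) t := by
      intro t
      simp only [indicator, mem_ofPred_eq, Metric.mem_closedBall, Real.dist_eq, abs_sub_comm t x,
        mul_comm]
    simp_rw [h2]
    rw [lintegral_indicator measurableSet_closedBall, lintegral_const_mul'']
    exact hg.restrict
  · refine AEMeasurable.indicator ?_ hS
    exact (hg.comp_quasiMeasurePreserving Measure.quasiMeasurePreserving_fst).mul
      (hk.comp measurable_snd).aemeasurable

lemma tendsto_lintegral_mul_poisson (g : ℝ → ℝ≥0∞) (hg : AEMeasurable g) (x : ℝ) {M : ℝ≥0∞}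
    (hM : M ≠ ∞) (hb : ∀ r > 0, ∫⁻ t in Metric.closedBall x r, g t ≤ M * ENNReal.ofReal r)
    (h0 : Tendsto (fun r => (∫⁻ t in Metric.closedBall x r, g t) / volume (Metric.closedBall x r))
      (𝓝[>] 0) (𝓝 0)) :
    Tendsto (fun ε => ∫⁻ t, g t * ENNReal.ofReal (ε / ((x - t) ^ 2 + ε ^ 2))) (𝓝[>] 0) (𝓝 0) := by
  have hmono : Monotone fun r => ∫⁻ t in Metric.closedBall x r, g t := fun a b hab =>
    lintegral_mono_set (Metric.closedBall_subset_closedBall hab)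
  -- Dominated convergence in the layer variable `r`. The linear bound `hb` at radius `ε * r`
  -- cancels the factor `1 / ε` of the weight and leaves a majorant `2 M / (1 + r ^ 2)` that does
  -- not depend on `ε`; this is why `hb` is needed at all radii and not only at small ones.
  have key := tendsto_lintegral_filter_of_dominated_convergence
    (μ := volume.restrict (Ioi (0 : ℝ))) (l := 𝓝[>] (0 : ℝ))
    (F := fun ε r => ENNReal.ofReal (2 * r / (1 + r ^ 2) ^ 2 / ε) *
        ∫⁻ t in Metric.closedBall x (ε * r), g t) (f := fun _ => 0)
    (fun r => ENNReal.ofReal (2 * (1 + r ^ 2)⁻¹) * M) ?_ ?_ ?_ ?_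
  · rw [lintegral_zero] at key
    refine key.congr' ?_
    filter_upwards [self_mem_nhdsWithin] with ε hε
    exact (lintegral_mul_poisson_eq g hg x hε).symm
  · filter_upwards [self_mem_nhdsWithin] with ε hε
    exact (by fun_prop : Measurable fun r => ENNReal.ofReal (2 * r / (1 + r ^ 2) ^ 2 / ε)).mul
      (hmono.measurable.comp (measurable_const_mul ε))
  · filter_upwards [self_mem_nhdsWithin] with ε hε
    filter_upwards [ae_restrict_mem measurableSet_Ioi] with r hr
    have hε' : 0 < ε := hε
    have hr' : 0 < r := hr
    calc _ ≤ ENNReal.ofReal (2 * r / (1 + r ^ 2) ^ 2 / ε) * (M * ENNReal.ofReal (ε * r)) := by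
          gcongr
          exact hb _ (by positivity)
      _ = ENNReal.ofReal (2 * r / (1 + r ^ 2) ^ 2 / ε * (ε * r)) * M := by
          rw [ENNReal.ofReal_mul (p := 2 * r / (1 + r ^ 2) ^ 2 / ε) (by positivity)]
          ring
      _ ≤ _ := by
          have : 2 * r / (1 + r ^ 2) ^ 2 / ε * (ε * r) = 2 * (r ^ 2 / (1 + r ^ 2) ^ 2) := by
            field_simp
          rw [this]
          gcongr ENNReal.ofReal (2 * ?_) * M
          rw [div_le_iff₀ (by positivity)]
          have : (1 + r ^ 2)⁻¹ * (1 + r ^ 2) ^ 2 = 1 + r ^ 2 := by field_simp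
          rw [this]; linarith
  · rw [lintegral_mul_const _ (by fun_prop)]
    refine ENNReal.mul_ne_top ?_ hM
    exact ((integrable_inv_one_add_sq.const_mul 2).restrict).lintegral_lt_top.ne
  · filter_upwards [ae_restrict_mem measurableSet_Ioi] with r hr
    have hr' : 0 < r := hr
    have h1 : Tendsto (fun ε : ℝ => ε * r) (𝓝[>] 0) (𝓝[>] 0) := by
      refine tendsto_nhdsWithin_iff.2 ⟨?_, ?_⟩
      · have : Tendsto (fun ε : ℝ => ε * r) (𝓝 0) (𝓝 (0 * r)) := by
          exact (continuous_mul_const r).tendsto 0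
        rw [zero_mul] at this
        exact this.mono_left nhdsWithin_le_nhds
      · filter_upwards [self_mem_nhdsWithin] with ε hε
        exact mul_pos hε hr'
    have h2 := ENNReal.Tendsto.const_mul (a := ENNReal.ofReal (4 * r ^ 2 / (1 + r ^ 2) ^ 2))
      (h0.comp h1) (Or.inr ENNReal.ofReal_ne_top)
    rw [mul_zero] at h2
    refine h2.congr' ?_
    filter_upwards [self_mem_nhdsWithin] with ε hε
    have hε' : 0 < ε := hε
    simp only [Function.comp, Real.volume_closedBall]
    rw [ENNReal.div_eq_inv_mul, ← mul_assoc, ← ENNReal.ofReal_inv_of_pos (by positivity),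
      ← ENNReal.ofReal_mul (by positivity)]
    congr 2
    field_simp
    ring

lemma MeasureTheory.MemLp.lintegral_enorm_sq_ne_top {α : Type*} [MeasurableSpace α] {μ : Measure α}
    {F : Type*} [NormedAddCommGroup F] {f : α → F} (hf : MemLp f 2 μ) :
    ∫⁻ t, ‖f t‖ₑ ^ 2 ∂μ ≠ ∞ := by
  have := (lintegral_rpow_enorm_lt_top_of_eLpNorm_lt_top (by norm_num) (by norm_num) hf.2).ne
  simpa using this

lemma MeasureTheory.MemLp.setLIntegral_closedBall_enorm_sub_le {f : ℝ → ℂ} (hf : MemLp f 2) {x : ℝ} {c : ℂ}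
    (h0 : Tendsto (fun r => (∫⁻ t in Metric.closedBall x r, ‖f t - c‖ₑ) /
      volume (Metric.closedBall x r)) (𝓝[>] 0) (𝓝 0)) :
    ∃ M : ℝ≥0∞, M ≠ ∞ ∧
      ∀ r > 0, ∫⁻ t in Metric.closedBall x r, ‖f t - c‖ₑ ≤ M * ENNReal.ofReal r := by
  have h1 := h0.eventually (gt_mem_nhds (zero_lt_one (α := ℝ≥0∞)))
  obtain ⟨δ, hδ, hδ'⟩ := (mem_nhdsGT_iff_exists_Ioo_subset).1 h1
  have hδ0 : 0 < δ := hδ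
  set I := ∫⁻ t, ‖f t‖ₑ ^ 2
  have hI : I ≠ ∞ := hf.lintegral_enorm_sq_ne_top
  -- The summand `2` serves radii below `δ`, where the average is less than `1` and the ball has
  -- length `2 * r`. The rest serves radii at least `δ`: there `‖f‖ ≤ 1 + ‖f‖ ^ 2`, and the fixed
  -- amount `I` is at most `I / δ * r`.
  refine ⟨2 + (2 * (1 + ‖c‖ₑ) + I / ENNReal.ofReal δ), ?_, fun r hr => ?_⟩
  · have : I / ENNReal.ofReal δ ≠ ∞ := ENNReal.div_ne_top hI (by simpa using hδ0)
    finiteness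
  have hr0 : 0 < r := hr
  have hr1 : ENNReal.ofReal r ≠ 0 := by simpa using hr0
  rcases lt_or_ge r δ with h | h
  · have h2 : (∫⁻ t in Metric.closedBall x r, ‖f t - c‖ₑ) / volume (Metric.closedBall x r) < 1 :=
      hδ' ⟨hr, h⟩
    rw [Real.volume_closedBall, ENNReal.ofReal_mul (by norm_num)] at h2
    rw [ENNReal.div_lt_iff (Or.inl (by simpa using hr0)) (Or.inl (by finiteness)), one_mul] at h2
    refine h2.le.trans ?_
    gcongr
    simp
  · calc ∫⁻ t in Metric.closedBall x r, ‖f t - c‖ₑ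
        ≤ ∫⁻ t in Metric.closedBall x r, ((1 + ‖c‖ₑ) + ‖f t‖ₑ ^ 2) := by
          refine lintegral_mono fun t => ?_
          have h3 : ‖f t‖ₑ ≤ 1 + ‖f t‖ₑ ^ 2 := by
            rcases le_total ‖f t‖ₑ 1 with h | h
            · exact h.trans le_self_add
            · exact (le_self_pow₀ h two_ne_zero).trans le_add_self
          calc ‖f t - c‖ₑ ≤ ‖f t‖ₑ + ‖c‖ₑ := enorm_sub_le
            _ ≤ (1 + ‖f t‖ₑ ^ 2) + ‖c‖ₑ := by gcongr
            _ = _ := by ring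
      _ = (1 + ‖c‖ₑ) * ENNReal.ofReal (2 * r) +
          ∫⁻ t in Metric.closedBall x r, ‖f t‖ₑ ^ 2 := by
          rw [lintegral_add_left measurable_const, setLIntegral_const, Real.volume_closedBall]
      _ ≤ (1 + ‖c‖ₑ) * ENNReal.ofReal (2 * r) + I := by
          gcongr
          exact setLIntegral_le_lintegral _ _
      _ ≤ (1 + ‖c‖ₑ) * ENNReal.ofReal (2 * r) + I / ENNReal.ofReal δ * ENNReal.ofReal r := by
          gcongr
          calc I = I / ENNReal.ofReal δ * ENNReal.ofReal δ := by
                rw [ENNReal.div_mul_cancel (by simpa using hδ0) (by finiteness)]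
            _ ≤ _ := by gcongr
      _ = (2 * (1 + ‖c‖ₑ) + I / ENNReal.ofReal δ) * ENNReal.ofReal r := by
          rw [ENNReal.ofReal_mul (by norm_num)]
          simp
          ring
      _ ≤ _ := by
          exact mul_le_mul_left le_add_self _

lemma MeasureTheory.MemLp.tendsto_lintegral_enorm_sub_mul_poisson {f : ℝ → ℂ} (hf : MemLp f 2) {x : ℝ} {c : ℂ}
    (h0 : Tendsto (fun r => (∫⁻ t in Metric.closedBall x r, ‖f t - c‖ₑ) /
      volume (Metric.closedBall x r)) (𝓝[>] 0) (𝓝 0)) :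
    Tendsto (fun ε => ∫⁻ t, ‖f t - c‖ₑ * ENNReal.ofReal (ε / ((x - t) ^ 2 + ε ^ 2)))
      (𝓝[>] 0) (𝓝 0) := by
  obtain ⟨M, hM, hb⟩ := hf.setLIntegral_closedBall_enorm_sub_le h0
  refine tendsto_lintegral_mul_poisson _ ?_ x hM hb h0
  exact (hf.1.aemeasurable.sub_const c).enorm

lemma MeasureTheory.MemLp.ae_lebesgue_point {f : ℝ → ℂ} (hf : MemLp f 2) :
    ∀ᵐ x, Tendsto (fun r => (∫⁻ t in Metric.closedBall x r, ‖f t - f x‖ₑ) /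
      volume (Metric.closedBall x r)) (𝓝[>] 0) (𝓝 0) := by
  filter_upwards [(Besicovitch.vitaliFamily (volume : Measure ℝ)).ae_tendsto_lintegral_enorm_sub_div
    (hf.locallyIntegrable (by norm_num))] with x hx
  exact hx.comp (Besicovitch.tendsto_filterAt volume x)

/-! ### Poisson, conjugate Poisson and truncated kernels. -/

lemma integrable_inv_sq_add_sq (x : ℝ) {y : ℝ} (hy : y ≠ 0) :
    Integrable fun t : ℝ => ((x - t) ^ 2 + y ^ 2)⁻¹ := by
  have h := ((integrable_inv_one_add_sq.comp_div hy).comp_sub_left x).const_mul (y ^ 2)⁻¹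
  refine h.congr (Eventually.of_forall fun t => ?_)
  simp only
  rw [← mul_inv]
  congr 1
  field_simp
  ring

lemma integral_poisson (x : ℝ) {ε : ℝ} (hε : 0 < ε) :
    ∫ t : ℝ, ε / ((x - t) ^ 2 + ε ^ 2) = Real.pi := by
  have h1 : ∀ t : ℝ, ε / ((x - t) ^ 2 + ε ^ 2) = ε⁻¹ * (1 + ((x - t) / ε) ^ 2)⁻¹ := by
    intro t
    field_simp
    ring
  simp_rw [h1]
  rw [integral_const_mul, integral_sub_left_eq_self (fun t : ℝ => (1 + (t / ε) ^ 2)⁻¹) volume x,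
    Measure.integral_comp_div (fun t : ℝ => (1 + t ^ 2)⁻¹), integral_univ_inv_one_add_sq,
    abs_of_pos hε, smul_eq_mul]
  field_simp

lemma sub_ofReal_ne_zero {z : ℂ} (hz : z.im ≠ 0) (t : ℝ) : z - t ≠ 0 := by
  intro h
  apply hz
  simpa using congrArg Complex.im h

lemma Complex.sq_norm_sub_ofReal (z : ℂ) (t : ℝ) : ‖z - t‖ ^ 2 = (z.re - t) ^ 2 + z.im ^ 2 := by
  rw [← Complex.normSq_eq_norm_sq, Complex.normSq_apply]
  simp
  ring

lemma memLp_resolvent {z : ℂ} (hz : z.im ≠ 0) : MemLp (fun t : ℝ => (z - t)⁻¹) 2 := by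
  have hc : Continuous fun t : ℝ => (z - t)⁻¹ :=
    Continuous.inv₀ (by fun_prop) (sub_ofReal_ne_zero hz)
  rw [memLp_two_iff_integrable_sq_norm hc.aestronglyMeasurable]
  refine (integrable_inv_sq_add_sq z.re hz).congr (Eventually.of_forall fun t => ?_)
  simp only
  rw [norm_inv, inv_pow, Complex.sq_norm_sub_ofReal]

lemma memLp_real_resolvent_im (x : ℝ) {ε : ℝ} (hε : 0 < ε) :
    MemLp (fun t : ℝ => ε / ((x - t) ^ 2 + ε ^ 2)) 2 := by
  have hz : (⟨x, ε⟩ : ℂ).im ≠ 0 := hε.ne'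
  refine (memLp_resolvent hz).of_le (Measurable.aestronglyMeasurable (by fun_prop)) (Eventually.of_forall fun t => ?_)
  refine le_trans (le_of_eq ?_) (Complex.abs_im_le_norm _)
  rw [Complex.inv_im, Complex.normSq_eq_norm_sq, Complex.sq_norm_sub_ofReal]
  simp [abs_div, abs_of_pos hε]

lemma memLp_real_resolvent_re (x : ℝ) {ε : ℝ} (hε : 0 < ε) :
    MemLp (fun t : ℝ => (x - t) / ((x - t) ^ 2 + ε ^ 2)) 2 := by
  have hz : (⟨x, ε⟩ : ℂ).im ≠ 0 := hε.ne'
  refine (memLp_resolvent hz).of_le (Measurable.aestronglyMeasurable (by fun_prop)) (Eventually.of_forall fun t => ?_)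
  refine le_trans (le_of_eq ?_) (Complex.abs_re_le_norm _)
  rw [Complex.inv_re, Complex.normSq_eq_norm_sq, Complex.sq_norm_sub_ofReal]
  simp [abs_div]

lemma MeasureTheory.MemLp.integrable_smul_two {α : Type*} [MeasurableSpace α] {μ : Measure α}
    {k : α → ℝ} {f : α → ℂ} (hk : MemLp k 2 μ) (hf : MemLp f 2 μ) :
    Integrable (fun t => k t • f t) μ :=
  memLp_one_iff_integrable.1 (hf.smul (r := 1) hk)

lemma MeasureTheory.MemLp.tendsto_poisson {f : ℝ → ℂ} (hf : MemLp f 2) {x : ℝ}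
    (h0 : Tendsto (fun r => (∫⁻ t in Metric.closedBall x r, ‖f t - f x‖ₑ) /
      volume (Metric.closedBall x r)) (𝓝[>] 0) (𝓝 0)) :
    Tendsto (fun ε => Real.pi⁻¹ • ∫ t, (ε / ((x - t) ^ 2 + ε ^ 2)) • f t) (𝓝[>] 0) (𝓝 (f x)) := by
  have hD : Tendsto (fun ε : ℝ => ∫ t, (ε / ((x - t) ^ 2 + ε ^ 2)) • (f t - f x)) (𝓝[>] 0)
      (𝓝 0) := by
    rw [tendsto_zero_iff_enorm_tendsto_zero]
    refine tendsto_of_tendsto_of_tendsto_of_le_of_le' tendsto_const_nhds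
      (hf.tendsto_lintegral_enorm_sub_mul_poisson h0) (Eventually.of_forall fun _ => zero_le) ?_
    filter_upwards [self_mem_nhdsWithin] with ε hε
    have hε' : 0 < ε := hε
    refine (enorm_integral_le_lintegral_enorm _).trans (lintegral_mono fun t => le_of_eq ?_)
    rw [enorm_smul, mul_comm, Real.enorm_of_nonneg (by positivity)]
  have h1 : Tendsto (fun ε : ℝ => Real.pi⁻¹ • (∫ t, (ε / ((x - t) ^ 2 + ε ^ 2)) • (f t - f x)) + f x)
      (𝓝[>] 0) (𝓝 (f x)) := by
    simpa using (hD.const_smul Real.pi⁻¹).add_const (f x)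
  refine h1.congr' ?_
  filter_upwards [self_mem_nhdsWithin] with ε hε
  have hε' : 0 < ε := hε
  have hi : Integrable fun t : ℝ => ε / ((x - t) ^ 2 + ε ^ 2) := by
    simpa [div_eq_mul_inv] using (integrable_inv_sq_add_sq x hε'.ne').const_mul ε
  simp_rw [smul_sub]
  rw [integral_sub ((memLp_real_resolvent_im x hε').integrable_smul_two hf) (hi.smul_const _),
    integral_smul_const, integral_poisson x hε', smul_sub, smul_smul,
    inv_mul_cancel₀ Real.pi_ne_zero, one_smul, sub_add_cancel]

/-- The difference of the truncated and the conjugate Poisson kernel. -/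
noncomputable def truncDiff (x ε t : ℝ) : ℝ :=
  {t : ℝ | ε ≤ |x - t|}.indicator (fun t => (x - t)⁻¹) t - (x - t) / ((x - t) ^ 2 + ε ^ 2)

/-- Outside the truncation interval the difference is `ε / (x - t)` times the Poisson kernel, a
factor of modulus at most `1`; inside only the conjugate kernel is left, and `|x - t| < ε`. Thus
limits of Poisson averages also control the truncation error. -/
lemma abs_truncDiff_le (x t : ℝ) {ε : ℝ} (hε : 0 < ε) :
    |truncDiff x ε t| ≤ ε / ((x - t) ^ 2 + ε ^ 2) := by
  unfold truncDiff
  simp only [indicator, mem_ofPred_eq]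
  split_ifs with h
  · have h0 : x - t ≠ 0 := by
      intro h'
      rw [h', abs_zero] at h
      linarith
    have h1 : (x - t)⁻¹ - (x - t) / ((x - t) ^ 2 + ε ^ 2) =
        (ε / (x - t)) * (ε / ((x - t) ^ 2 + ε ^ 2)) := by
      field_simp
      ring
    rw [h1, abs_mul, abs_of_nonneg (a := ε / ((x - t) ^ 2 + ε ^ 2)) (by positivity)]
    refine mul_le_of_le_one_left (by positivity) ?_
    rw [abs_div, abs_of_pos hε]
    exact div_le_one_of_le₀ h (abs_nonneg _)
  · rw [zero_sub, abs_neg, abs_div, abs_of_pos (a := (x - t) ^ 2 + ε ^ 2) (by positivity)]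
    push Not at h
    gcongr

lemma measurableSet_trunc (x ε : ℝ) : MeasurableSet {t : ℝ | ε ≤ |x - t|} :=
  measurableSet_le (by fun_prop) (by fun_prop)

lemma measurable_truncDiff (x ε : ℝ) : Measurable (truncDiff x ε) := by
  unfold truncDiff
  exact (Measurable.indicator (by fun_prop) (measurableSet_trunc x ε)).sub (by fun_prop)

/-- The kernel is odd under the reflection `t ↦ 2 * x - t`. Hence a constant may be subtracted from
the function that it is integrated against. -/
lemma integral_truncDiff (x ε : ℝ) : ∫ t, truncDiff x ε t = 0 := by
  have h1 : ∀ t, truncDiff x ε (2 * x - t) = - truncDiff x ε t := by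
    intro t
    have h2 : x - (2 * x - t) = -(x - t) := by ring
    simp only [truncDiff, indicator, mem_ofPred_eq, h2, abs_neg, neg_sq, inv_neg, neg_div]
    split_ifs <;> ring
  have h2 := integral_sub_left_eq_self (truncDiff x ε) volume (2 * x)
  simp_rw [h1, integral_neg] at h2
  linarith

lemma memLp_trunc (x : ℝ) {ε : ℝ} (hε : 0 < ε) :
    MemLp ({t : ℝ | ε ≤ |x - t|}.indicator (fun t => (x - t)⁻¹)) 2 := by
  have h1 : MemLp (truncDiff x ε) 2 :=
    (memLp_real_resolvent_im x hε).of_le (measurable_truncDiff x ε).aestronglyMeasurable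
      (Eventually.of_forall fun t => (abs_truncDiff_le x t hε).trans (le_abs_self _))
  have h2 := h1.add (memLp_real_resolvent_re x hε)
  refine h2.congr_norm ((Measurable.indicator (by fun_prop)
    (measurableSet_trunc x ε)).aestronglyMeasurable) (Eventually.of_forall fun t => ?_)
  simp [truncDiff]

lemma truncHilbert_eq (f : ℝ → ℂ) (x ε : ℝ) :
    truncHilbert f x ε =
      Real.pi⁻¹ • ∫ t, {t : ℝ | ε ≤ |x - t|}.indicator (fun t => (x - t)⁻¹) t • f t := by
  rw [truncHilbert, ← integral_indicator (measurableSet_trunc x ε), Complex.real_smul]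
  congr 1
  · push_cast; simp
  · refine integral_congr_ae (Eventually.of_forall fun t => ?_)
    simp only [indicator]
    split_ifs
    · rw [Complex.real_smul]
      push_cast
      rw [div_eq_inv_mul]
    · simp

/-- As the kernel difference has mean zero, `f t` may be replaced by `f t - f x`, and the Poisson
majorant then forces the limit `0` at a Lebesgue point. So the principal value exists as soon as the
conjugate Poisson integrals converge. -/
lemma MeasureTheory.MemLp.tendsto_truncHilbert_sub {f : ℝ → ℂ} (hf : MemLp f 2) {x : ℝ}
    (h0 : Tendsto (fun r => (∫⁻ t in Metric.closedBall x r, ‖f t - f x‖ₑ) /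
      volume (Metric.closedBall x r)) (𝓝[>] 0) (𝓝 0)) :
    Tendsto (fun ε => truncHilbert f x ε -
      Real.pi⁻¹ • ∫ t, ((x - t) / ((x - t) ^ 2 + ε ^ 2)) • f t) (𝓝[>] 0) (𝓝 0) := by
  have hD : Tendsto (fun ε : ℝ => ∫ t, truncDiff x ε t • (f t - f x)) (𝓝[>] 0) (𝓝 0) := by
    rw [tendsto_zero_iff_enorm_tendsto_zero]
    refine tendsto_of_tendsto_of_tendsto_of_le_of_le' tendsto_const_nhds
      (hf.tendsto_lintegral_enorm_sub_mul_poisson h0) (Eventually.of_forall fun _ => zero_le) ?_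
    filter_upwards [self_mem_nhdsWithin] with ε hε
    refine (enorm_integral_le_lintegral_enorm _).trans (lintegral_mono fun t => ?_)
    rw [enorm_smul, mul_comm]
    gcongr
    rw [Real.enorm_eq_ofReal_abs]
    exact ENNReal.ofReal_le_ofReal (abs_truncDiff_le x t hε)
  have h1 := hD.const_smul Real.pi⁻¹
  rw [smul_zero] at h1
  refine h1.congr' ?_
  filter_upwards [self_mem_nhdsWithin] with ε hε
  have hε' : 0 < ε := hε
  have hK : Integrable fun t : ℝ => ε / ((x - t) ^ 2 + ε ^ 2) := by
    simpa [div_eq_mul_inv] using (integrable_inv_sq_add_sq x hε'.ne').const_mul ε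
  have hi : Integrable (truncDiff x ε) :=
    hK.mono' (measurable_truncDiff x ε).aestronglyMeasurable
      (Eventually.of_forall fun t => abs_truncDiff_le x t hε')
  have h2 := (memLp_trunc x hε').integrable_smul_two hf
  have h3 := (memLp_real_resolvent_re x hε').integrable_smul_two hf
  have h4 : Integrable fun t => truncDiff x ε t • f t := by
    simp_rw [truncDiff, sub_smul]
    exact h2.sub h3
  simp_rw [smul_sub]
  rw [integral_sub h4 (hi.smul_const _), integral_smul_const, integral_truncDiff, zero_smul,
    sub_zero, truncHilbert_eq, ← smul_sub, ← integral_sub h2 h3]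
  simp_rw [truncDiff, sub_smul]

/-! ### The Fourier transform on `L²`. -/

section

open scoped FourierTransform

/-- Both transforms are the same tempered distribution: tested against a smooth compactly supported
function, each moves the Fourier transform onto the test function. -/
lemma fourier_toLp_ae_eq {b : ℝ → ℂ} (h1 : Integrable b) (h2 : MemLp b 2) :
    ((𝓕 (h2.toLp b) : Lp ℂ 2 (volume : Measure ℝ)) : ℝ → ℂ) =ᵐ[volume] 𝓕 b := by
  have hc : Continuous (𝓕 b) := VectorFourier.fourierIntegral_continuous
    Real.continuous_fourierChar (innerSL ℝ).continuous₂ h1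
  refine ae_eq_of_integral_contDiff_smul_eq
    ((Lp.memLp _).locallyIntegrable (by norm_num)) hc.locallyIntegrable fun g hg hgs => ?_
  have hg' : HasCompactSupport (fun x => (g x : ℂ)) := hgs.comp_left Complex.ofReal_zero
  set φ : SchwartzMap ℝ ℂ := hg'.toSchwartzMap (Complex.ofRealCLM.contDiff.comp hg) with hφ
  have hφx : ∀ x, φ x = (g x : ℂ) := fun x => rfl
  have e1 := DFunLike.congr_fun (Lp.fourier_toTemperedDistribution_eq (h2.toLp b)) φ
  rw [TemperedDistribution.fourier_apply, Lp.toTemperedDistribution_apply,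
    Lp.toTemperedDistribution_apply] at e1
  have e2 : ∫ x, (𝓕 φ) x • (h2.toLp b : Lp ℂ 2 (volume : Measure ℝ)) x = ∫ x, (𝓕 (φ : ℝ → ℂ)) x • b x := by
    rw [SchwartzMap.fourier_coe]
    refine integral_congr_ae ?_
    filter_upwards [h2.coeFn_toLp] with x hx
    rw [hx]
  have e3 : ∫ x, (𝓕 (φ : ℝ → ℂ)) x • b x = ∫ x, φ x • (𝓕 b) x := by
    simpa using! VectorFourier.integral_fourierIntegral_smul_eq_flip (L := innerₗ ℝ)
      Real.continuous_fourierChar continuous_inner φ.integrable h1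
  have e4 := (e1.symm.trans e2).trans e3
  simpa only [hφx, Complex.coe_smul] using e4

/-- Rewriting the bilinear pairing as an inner product with `star` makes both sides continuous in
`b`, so Schwartz functions suffice; for those it is the definition of the distributional Fourier
transform of `f`. -/
lemma Lp.integral_mul_fourier (f b : Lp ℂ 2 (volume : Measure ℝ)) :
    ∫ t, f t * (𝓕 b : Lp ℂ 2 (volume : Measure ℝ)) t =
      ∫ t, (𝓕 f : Lp ℂ 2 (volume : Measure ℝ)) t * b t := by
  have hI : ∀ u v : Lp ℂ 2 (volume : Measure ℝ), ∫ t, u t * v t = inner ℂ (star u) v := by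
    intro u v
    rw [L2.inner_def]
    refine integral_congr_ae ?_
    filter_upwards [Lp.coeFn_star u] with t ht
    rw [ht]
    simp [mul_comm]
  rw [hI, hI]
  revert b
  refine fun b => DenseRange.induction_on
    (SchwartzMap.denseRange_toLpCLM (E := ℝ) (F := ℂ) (μ := volume) (p := 2)
      ENNReal.ofNat_ne_top) b ?_ ?_
  · refine isClosed_eq ?_ ?_
    · exact continuous_const.inner (Lp.fourierTransformₗᵢ ℝ ℂ).continuous
    · exact continuous_const.inner continuous_id
  · intro φ
    rw [← hI, ← hI]
    have e1 := DFunLike.congr_fun (Lp.fourier_toTemperedDistribution_eq f) φ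
    rw [TemperedDistribution.fourier_apply, Lp.toTemperedDistribution_apply,
      Lp.toTemperedDistribution_apply] at e1
    have e2 : (𝓕 (SchwartzMap.toLpCLM ℝ ℂ 2 volume φ) : Lp ℂ 2 (volume : Measure ℝ)) =
      (𝓕 φ).toLp 2 := SchwartzMap.toLp_fourier_eq φ
    rw [e2]
    calc _ = ∫ t, (𝓕 φ) t • f t := by
          refine integral_congr_ae ?_
          filter_upwards [(𝓕 φ).coeFn_toLp 2 volume] with t ht
          rw [ht, smul_eq_mul, mul_comm]
      _ = ∫ t, φ t • (𝓕 f : Lp ℂ 2 (volume : Measure ℝ)) t := e1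
      _ = _ := by
          refine integral_congr_ae ?_
          filter_upwards [φ.coeFn_toLp 2 volume] with t ht
          change _ = _ * (φ.toLp 2 volume) t
          rw [ht, smul_eq_mul, mul_comm]

/-- The Fourier transform on `L²` of a function, as an almost everywhere defined function. -/
noncomputable def fourierL2 (f : ℝ → ℂ) (hf : MemLp f 2) : ℝ → ℂ :=
  (𝓕 (hf.toLp f) : Lp ℂ 2 (volume : Measure ℝ))

lemma memLp_fourierL2 {f : ℝ → ℂ} (hf : MemLp f 2) : MemLp (fourierL2 f hf) 2 := Lp.memLp _

lemma eLpNorm_fourierL2 {f : ℝ → ℂ} (hf : MemLp f 2) :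
    eLpNorm (fourierL2 f hf) 2 volume = eLpNorm f 2 volume := by
  have h1 : ‖(𝓕 (hf.toLp f) : Lp ℂ 2 (volume : Measure ℝ))‖ₑ = ‖hf.toLp f‖ₑ := by
    rw [← ofReal_norm, ← ofReal_norm, Lp.norm_fourier_eq]
  rw [fourierL2, ← Lp.enorm_def, h1, Lp.enorm_toLp]

lemma eLpNorm_fourier {b : ℝ → ℂ} (h1 : Integrable b) (h2 : MemLp b 2) :
    eLpNorm (𝓕 b) 2 volume = eLpNorm b 2 volume := by
  rw [← eLpNorm_congr_ae (fourier_toLp_ae_eq h1 h2)]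
  exact eLpNorm_fourierL2 h2

lemma integral_mul_fourier {f b : ℝ → ℂ} (hf : MemLp f 2) (h1 : Integrable b) (h2 : MemLp b 2) :
    ∫ t, f t * 𝓕 b t = ∫ t, fourierL2 f hf t * b t := by
  have := Lp.integral_mul_fourier (hf.toLp f) (h2.toLp b)
  convert this using 1
  · refine integral_congr_ae ?_
    filter_upwards [hf.coeFn_toLp, fourier_toLp_ae_eq h1 h2] with t e1 e2
    rw [e1, e2]
  · refine integral_congr_ae ?_
    filter_upwards [h2.coeFn_toLp] with t e1
    rw [e1, fourierL2]

lemma integral_mul_conj_fourierL2 {f g : ℝ → ℂ} (hf : MemLp f 2) (hg : MemLp g 2) :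
    ∫ t, fourierL2 f hf t * conj (fourierL2 g hg t) = ∫ t, f t * conj (g t) := by
  have := Lp.inner_fourier_eq (hg.toLp g) (hf.toLp f)
  rw [L2.inner_def, L2.inner_def] at this
  refine this.trans (integral_congr_ae ?_)
  filter_upwards [hf.coeFn_toLp, hg.coeFn_toLp] with t e1 e2
  rw [e1, e2]
  rfl

lemma fourierL2_surjective {m : ℝ → ℂ} (hm : MemLp m 2) :
    ∃ (h : ℝ → ℂ) (hh : MemLp h 2), fourierL2 h hh =ᵐ[volume] m := by
  refine ⟨(𝓕⁻ (hm.toLp m) : Lp ℂ 2 (volume : Measure ℝ)), Lp.memLp _, ?_⟩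
  rw [fourierL2, Lp.toLp_coeFn, FourierTransform.fourier_fourierInv_eq]
  exact hm.coeFn_toLp

/-! ### Cauchy-type integrals in Fourier space. -/

/-- The one-sided kernel `|ξ|^k e^{-2πy|ξ|}` on the half-line `σ ξ > 0`. -/
noncomputable def expKer (σ : ℝ) (k : ℕ) (y ξ : ℝ) : ℝ :=
  {ξ : ℝ | 0 < σ * ξ}.indicator (fun ξ => |ξ| ^ k * Real.exp (-(2 * Real.pi * y) * |ξ|)) ξ

lemma measurable_expKer (σ : ℝ) (k : ℕ) (y : ℝ) : Measurable (expKer σ k y) :=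
  Measurable.indicator (by fun_prop) (measurableSet_lt (by fun_prop) (by fun_prop))

lemma expKer_nonneg (σ : ℝ) (k : ℕ) (y ξ : ℝ) : 0 ≤ expKer σ k y ξ :=
  indicator_nonneg (fun _ _ => by positivity) _

lemma exists_expKer_le (σ : ℝ) {k : ℕ} (hk : k ≤ 1) {y : ℝ} (hy : 0 < y) :
    ∃ C : ℝ, ∀ ξ, expKer σ k y ξ ≤ C * (1 + ξ ^ 2)⁻¹ := by
  set a : ℝ := 2 * Real.pi * y with ha
  have ha0 : 0 < a := by positivity
  -- The coefficients are `n! / a ^ n` for `n ≤ 3`: they turn the Taylor terms `(a * u) ^ n / n!`,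
  -- each at most `exp (a * u)`, into the monomials of `(1 + u) * (1 + u ^ 2)`.
  refine ⟨1 + 1 / a + 2 / a ^ 2 + 6 / a ^ 3, fun ξ => ?_⟩
  have h0 : expKer σ k y ξ ≤ |ξ| ^ k * Real.exp (-a * |ξ|) :=
    indicator_le_self' (fun _ _ => by positivity) ξ
  refine h0.trans ?_
  set u := |ξ|
  have hu : 0 ≤ u := abs_nonneg ξ
  have e0 := Real.one_le_exp (x := a * u) (by positivity)
  have e1 := Real.pow_div_factorial_le_exp (a * u) (by positivity) 1
  have e2 := Real.pow_div_factorial_le_exp (a * u) (by positivity) 2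
  have e3 := Real.pow_div_factorial_le_exp (a * u) (by positivity) 3
  have hk' : u ^ k ≤ 1 + u := by
    interval_cases k <;> simp [hu]
  have hus : ξ ^ 2 = u ^ 2 := (sq_abs ξ).symm
  rw [hus, ← div_eq_mul_inv, le_div_iff₀ (by positivity), neg_mul, Real.exp_neg]
  rw [mul_assoc, mul_comm (Real.exp _)⁻¹, ← mul_assoc, ← div_eq_mul_inv,
    div_le_iff₀ (Real.exp_pos _)]
  calc u ^ k * (1 + u ^ 2) ≤ (1 + u) * (1 + u ^ 2) := by gcongr
    _ = 1 + 1 / a * ((a * u) ^ 1 / (Nat.factorial 1)) + 2 / a ^ 2 * ((a * u) ^ 2 / (Nat.factorial 2))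
        + 6 / a ^ 3 * ((a * u) ^ 3 / (Nat.factorial 3)) := by
        simp [Nat.factorial]
        field_simp
        ring
    _ ≤ Real.exp (a * u) + 1 / a * Real.exp (a * u) + 2 / a ^ 2 * Real.exp (a * u)
        + 6 / a ^ 3 * Real.exp (a * u) := by gcongr
    _ = _ := by ring

lemma integrable_expKer (σ : ℝ) {k : ℕ} (hk : k ≤ 1) {y : ℝ} (hy : 0 < y) :
    Integrable (expKer σ k y) := by
  obtain ⟨C, hC⟩ := exists_expKer_le σ hk hy
  refine (integrable_inv_one_add_sq.const_mul C).mono' (measurable_expKer _ _ _).aestronglyMeasurable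
    (Eventually.of_forall fun ξ => ?_)
  rw [Real.norm_of_nonneg (expKer_nonneg _ _ _ _)]
  exact hC ξ

lemma memLp_top_expKer (σ : ℝ) {k : ℕ} (hk : k ≤ 1) {y : ℝ} (hy : 0 < y) :
    MemLp (expKer σ k y) ∞ := by
  obtain ⟨C, hC⟩ := exists_expKer_le σ hk hy
  refine memLp_top_of_bound (measurable_expKer _ _ _).aestronglyMeasurable |C|
    (Eventually.of_forall fun ξ => ?_)
  rw [Real.norm_of_nonneg (expKer_nonneg _ _ _ _)]
  refine (hC ξ).trans ?_
  calc C * (1 + ξ ^ 2)⁻¹ ≤ |C| * 1 := by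
        gcongr
        · exact le_abs_self C
        · exact inv_le_one_of_one_le₀ (by nlinarith [sq_nonneg ξ])
    _ = |C| := mul_one _

lemma memLp_two_expKer (σ : ℝ) {k : ℕ} (hk : k ≤ 1) {y : ℝ} (hy : 0 < y) :
    MemLp (expKer σ k y) 2 := by
  rw [memLp_two_iff_integrable_sq (measurable_expKer _ _ _).aestronglyMeasurable]
  have := (integrable_expKer σ hk hy).mul_of_top_left (memLp_top_expKer σ hk hy)
  simp_rw [sq]
  exact this

/-- The phase `e^{2πixξ}`. -/
noncomputable def phase (x ξ : ℝ) : ℂ := Complex.exp (2 * Real.pi * x * ξ * Complex.I)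

lemma norm_phase (x ξ : ℝ) : ‖phase x ξ‖ = 1 := by
  rw [phase]
  have := Complex.norm_exp_ofReal_mul_I (2 * Real.pi * x * ξ)
  push_cast at this
  exact this

lemma continuous_phase (x : ℝ) : Continuous (phase x) := by
  unfold phase
  fun_prop

lemma integrable_expKer_mul_phase (σ : ℝ) {k : ℕ} (hk : k ≤ 1) {y : ℝ} (hy : 0 < y) (x : ℝ) :
    Integrable fun ξ => (expKer σ k y ξ : ℂ) * phase x ξ := by
  refine (integrable_expKer σ hk hy).mono
    ((Complex.measurable_ofReal.comp (measurable_expKer _ _ _)).mul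
      (continuous_phase x).measurable).aestronglyMeasurable (Eventually.of_forall fun ξ => ?_)
  simp [norm_phase]

lemma memLp_expKer_mul_phase (σ : ℝ) {k : ℕ} (hk : k ≤ 1) {y : ℝ} (hy : 0 < y) (x : ℝ) :
    MemLp (fun ξ => (expKer σ k y ξ : ℂ) * phase x ξ) 2 := by
  refine (memLp_two_expKer σ hk hy).of_le
    ((Complex.measurable_ofReal.comp (measurable_expKer _ _ _)).mul
      (continuous_phase x).measurable).aestronglyMeasurable (Eventually.of_forall fun ξ => ?_)
  simp [norm_phase]

lemma integral_pow_mul_cexp_neg_Ioi {c : ℂ} (hc : 0 < c.re) {k : ℕ} (hk : k ≤ 1)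
    (hi : IntegrableOn (fun ξ : ℝ => (ξ : ℂ) ^ k * Complex.exp (-c * ξ)) (Ioi 0)) :
    ∫ ξ in Ioi (0 : ℝ), (ξ : ℂ) ^ k * Complex.exp (-c * ξ) = (k.factorial : ℂ) / c ^ (k + 1) := by
  have hc0 : c ≠ 0 := by
    intro h
    simp [h] at hc
  have hexp : ∀ ξ : ℝ, HasDerivAt (fun ξ : ℝ => Complex.exp (-c * ξ)) (Complex.exp (-c * ξ) * (-c)) ξ := by
    intro ξ
    have h1 : HasDerivAt (fun ξ : ℝ => -c * (ξ : ℂ)) (-c) ξ := by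
      simpa using (Complex.ofRealCLM.hasDerivAt (x := ξ)).const_mul (-c)
    exact h1.cexp
  have hn : ∀ ξ : ℝ, ‖Complex.exp (-c * ξ)‖ = Real.exp (-c.re * ξ) := by
    intro ξ
    simp [Complex.norm_exp]
  have hl : ∀ n : ℕ, Tendsto (fun ξ : ℝ => (ξ : ℂ) ^ n * Complex.exp (-c * ξ)) atTop (𝓝 0) := by
    intro n
    rw [tendsto_zero_iff_norm_tendsto_zero]
    have h1 := Real.tendsto_pow_mul_exp_neg_atTop_nhds_zero n
    have h2 := (h1.comp (tendsto_id.const_mul_atTop hc)).const_mul ((c.re ^ n)⁻¹)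
    rw [mul_zero] at h2
    refine h2.congr' ?_
    filter_upwards [eventually_ge_atTop 0] with ξ hξ
    rw [norm_mul, hn, norm_pow, Complex.norm_real, Real.norm_of_nonneg hξ]
    simp only [Function.comp, id, neg_mul, mul_pow]
    field_simp
  interval_cases k
  · have h := integral_Ioi_of_hasDerivAt_of_tendsto (a := 0) (m := 0)
      (f := fun ξ : ℝ => -(Complex.exp (-c * ξ)) / c)
      (f' := fun ξ : ℝ => (ξ : ℂ) ^ 0 * Complex.exp (-c * ξ)) ?_ ?_ hi ?_
    · rw [h]; simp [neg_div]
    · exact (((hexp 0).neg).div_const c).continuousAt.continuousWithinAt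
    · intro ξ _
      refine (((hexp ξ).neg).div_const c).congr_deriv ?_
      field_simp
    · simpa using ((hl 0).neg).div_const c
  · have h := integral_Ioi_of_hasDerivAt_of_tendsto (a := 0) (m := 0)
      (f := fun ξ : ℝ => -((ξ : ℂ) * Complex.exp (-c * ξ)) / c - Complex.exp (-c * ξ) / c ^ 2)
      (f' := fun ξ : ℝ => (ξ : ℂ) ^ 1 * Complex.exp (-c * ξ)) ?_ ?_ hi ?_
    · rw [h]; simp
    · exact Continuous.continuousWithinAt (by fun_prop)
    · intro ξ _
      refine (((((Complex.ofRealCLM.hasDerivAt (x := ξ)).mul (hexp ξ)).neg).div_const c).sub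
        ((hexp ξ).div_const (c ^ 2))).congr_deriv ?_
      simp
      field_simp
      ring
    · simpa using (((hl 1).neg).div_const c).sub ((hl 0).div_const (c ^ 2))

/-- The substitution `ξ ↦ σ * ξ` reduces to a Laplace transform on the positive half-line. Up to a
constant the value is the kernel `1 / (z - t) ^ (k + 1)` at `z = x + iσy`, so powers of the
resolvent are Fourier transforms of one-sided exponentials. -/
lemma fourier_expKer_mul_phase {σ : ℝ} (hσ : σ = 1 ∨ σ = -1) {k : ℕ} (hk : k ≤ 1) {y : ℝ}
    (hy : 0 < y) (x t : ℝ) :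
    𝓕 (fun ξ => (expKer σ k y ξ : ℂ) * phase x ξ) t =
      (k.factorial : ℂ) / (2 * Real.pi * (y - Complex.I * σ * (x - t))) ^ (k + 1) := by
  set c : ℂ := 2 * Real.pi * (y - Complex.I * σ * (x - t)) with hc
  have hcre : 0 < c.re := by
    have : c.re = 2 * Real.pi * y := by simp [hc]
    rw [this]; positivity
  have hint : Integrable fun ξ : ℝ => Complex.exp (↑(-2 * Real.pi * ξ * t) * Complex.I) •
      ((expKer σ k y ξ : ℂ) * phase x ξ) := by
    refine (integrable_expKer_mul_phase σ hk hy x).mono ?_ (Eventually.of_forall fun ξ => ?_)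
    · have hcc : Continuous fun ξ : ℝ => Complex.exp (↑(-2 * Real.pi * ξ * t) * Complex.I) := by
        fun_prop
      exact hcc.aestronglyMeasurable.smul (integrable_expKer_mul_phase σ hk hy x).1
    · rw [norm_smul, Complex.norm_exp_ofReal_mul_I, one_mul]
  have key : ∀ ξ ∈ Ioi (0 : ℝ), Complex.exp (↑(-2 * Real.pi * (σ * ξ) * t) * Complex.I) •
      ((expKer σ k y (σ * ξ) : ℂ) * phase x (σ * ξ)) = (ξ : ℂ) ^ k * Complex.exp (-c * ξ) := by
    intro ξ hξ
    have hξ' : 0 < ξ := hξ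
    have hσ2 : σ * (σ * ξ) = ξ := by rcases hσ with rfl | rfl <;> ring
    have habs : |σ * ξ| = ξ := by
      rcases hσ with rfl | rfl <;> simp [abs_of_pos hξ']
    have : expKer σ k y (σ * ξ) = ξ ^ k * Real.exp (-(2 * Real.pi * y) * ξ) := by
      simp only [expKer, indicator, mem_ofPred_eq, hσ2, hξ', if_true, habs]
    rw [this, phase, smul_eq_mul]
    push_cast
    rw [mul_assoc, mul_left_comm, ← Complex.exp_add, mul_assoc, ← Complex.exp_add, hc]
    congr 2
    ring
  have hout : ∀ ξ ∈ Iic (0 : ℝ), Complex.exp (↑(-2 * Real.pi * (σ * ξ) * t) * Complex.I) •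
      ((expKer σ k y (σ * ξ) : ℂ) * phase x (σ * ξ)) = 0 := by
    intro ξ hξ
    have hσ2 : σ * (σ * ξ) = ξ := by rcases hσ with rfl | rfl <;> ring
    have : expKer σ k y (σ * ξ) = 0 := by
      simp only [expKer, indicator, mem_ofPred_eq, hσ2, not_lt.2 (mem_Iic.1 hξ), if_false]
    rw [this]
    simp
  have hsub : ∀ F : ℝ → ℂ, ∫ ξ, F ξ = ∫ ξ, F (σ * ξ) := by
    intro F
    rcases hσ with rfl | rfl
    · simp
    · simpa using (integral_neg_eq_self F volume).symm
  have hint2 : Integrable fun ξ : ℝ => Complex.exp (↑(-2 * Real.pi * (σ * ξ) * t) * Complex.I) •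
      ((expKer σ k y (σ * ξ) : ℂ) * phase x (σ * ξ)) := by
    have hσ0 : σ ≠ 0 := by rcases hσ with rfl | rfl <;> norm_num
    exact hint.comp_mul_left' hσ0
  rw [Real.fourier_real_eq_integral_exp_smul, hsub,
    ← integral_add_compl (measurableSet_Ioi (a := (0 : ℝ))) hint2, compl_Ioi,
    setIntegral_congr_fun measurableSet_Iic hout, setIntegral_congr_fun measurableSet_Ioi key,
    integral_zero, add_zero]
  exact integral_pow_mul_cexp_neg_Ioi hcre hk
    ((hint2.integrableOn (s := Ioi 0)).congr_fun key measurableSet_Ioi)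

/-- The Cauchy-type integral `∫ f(t) / (z - t)^n dt`. -/
noncomputable def cauchyInt (f : ℝ → ℂ) (n : ℕ) (z : ℂ) : ℂ := ∫ t : ℝ, f t * ((z - t) ^ n)⁻¹

/-- The Fourier transform is moved from the kernel onto `f`. In the half-plane selected by `σ` only
the frequencies with `σ * ξ > 0` contribute; on them a multiplier depending on `sgn ξ` acts as a
scalar. -/
lemma cauchyInt_eq_fourier {f : ℝ → ℂ} (hf : MemLp f 2) {σ : ℝ} (hσ : σ = 1 ∨ σ = -1) {k : ℕ}
    (hk : k ≤ 1) {y : ℝ} (hy : 0 < y) (x : ℝ) :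
    cauchyInt f (k + 1) (x + Complex.I * (σ * y)) = (-2 * Real.pi * Complex.I * σ) ^ (k + 1) *
      ∫ ξ, fourierL2 f hf ξ * ((expKer σ k y ξ : ℂ) * phase x ξ) := by
  have hfac : (k.factorial : ℂ) = 1 := by interval_cases k <;> simp
  have hσ2 : (σ : ℂ) * σ = 1 := by rcases hσ with rfl | rfl <;> norm_num
  have hσ0 : (σ : ℂ) ≠ 0 := fun h => by simp [h] at hσ2
  have hpi : (Real.pi : ℂ) ≠ 0 := by exact_mod_cast Real.pi_ne_zero
  rw [← integral_mul_fourier hf (integrable_expKer_mul_phase σ hk hy x)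
    (memLp_expKer_mul_phase σ hk hy x), ← integral_const_mul, cauchyInt]
  refine integral_congr_ae (Eventually.of_forall fun t => ?_)
  simp only
  rw [fourier_expKer_mul_phase hσ hk hy, hfac, mul_left_comm (_ ^ (k + 1))]
  congr 1
  have e : (2 * Real.pi * (y - Complex.I * σ * (x - t)) : ℂ) =
      (-2 * Real.pi * Complex.I * σ) * (x + Complex.I * (σ * y) - t) := by
    linear_combination (2 * Real.pi * y * Complex.I ^ 2 : ℂ) * hσ2 +
      (2 * Real.pi * y : ℂ) * Complex.I_sq
  have h0 : (-2 * Real.pi * Complex.I * σ : ℂ) ^ (k + 1) ≠ 0 := by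
    refine pow_ne_zero _ ?_
    simp [hpi, hσ0]
  rw [e, mul_pow _ (_ - _), one_div, mul_inv, mul_inv_cancel_left₀ h0]

/-! ### Existence and symbol of the Hilbert transform. -/

lemma integrable_mul_resolvent {f : ℝ → ℂ} (hf : MemLp f 2) {z : ℂ} (hz : z.im ≠ 0) :
    Integrable fun t : ℝ => f t * ((z - t) ^ 1)⁻¹ := by
  simp_rw [pow_one]
  exact hf.integrable_mul (memLp_resolvent hz)

/-- Partial fractions over the resolvents at `x ± iε`: their difference gives the Poisson kernel,
and half their sum gives the conjugate one. Both averages are therefore read off from the Cauchy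
integral in the two half-planes. -/
lemma integral_poisson_smul {f : ℝ → ℂ} (hf : MemLp f 2) (x : ℝ) {ε : ℝ} (hε : 0 < ε) :
    ∫ t, (ε / ((x - t) ^ 2 + ε ^ 2)) • f t = Complex.I / 2 *
      (cauchyInt f 1 (x + Complex.I * ε) - cauchyInt f 1 (x - Complex.I * ε)) := by
  have h1 : (x + Complex.I * ε : ℂ).im ≠ 0 := by simpa using hε.ne'
  have h2 : (x - Complex.I * ε : ℂ).im ≠ 0 := by simpa using hε.ne'
  unfold cauchyInt
  rw [← integral_sub (integrable_mul_resolvent hf h1) (integrable_mul_resolvent hf h2),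
    ← integral_const_mul]
  refine integral_congr_ae (Eventually.of_forall fun t => ?_)
  have e1 := sub_ofReal_ne_zero h1 t
  have e2 := sub_ofReal_ne_zero h2 t
  have e3 : ((x - t) ^ 2 + ε ^ 2 : ℂ) = (x + Complex.I * ε - t) * (x - Complex.I * ε - t) := by
    linear_combination ((ε : ℂ) ^ 2) * Complex.I_sq
  simp only [Complex.real_smul, pow_one]
  push_cast
  rw [e3, ← mul_sub, inv_sub_inv e1 e2, mul_comm (f t), ← mul_assoc, mul_div_assoc']
  congr 2
  linear_combination (ε : ℂ) * Complex.I_sq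

lemma integral_conj_poisson_smul {f : ℝ → ℂ} (hf : MemLp f 2) (x : ℝ) {ε : ℝ} (hε : 0 < ε) :
    ∫ t, ((x - t) / ((x - t) ^ 2 + ε ^ 2)) • f t = 1 / 2 *
      (cauchyInt f 1 (x + Complex.I * ε) + cauchyInt f 1 (x - Complex.I * ε)) := by
  have h1 : (x + Complex.I * ε : ℂ).im ≠ 0 := by simpa using hε.ne'
  have h2 : (x - Complex.I * ε : ℂ).im ≠ 0 := by simpa using hε.ne'
  unfold cauchyInt
  rw [← integral_add (integrable_mul_resolvent hf h1) (integrable_mul_resolvent hf h2),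
    ← integral_const_mul]
  refine integral_congr_ae (Eventually.of_forall fun t => ?_)
  have e1 := sub_ofReal_ne_zero h1 t
  have e2 := sub_ofReal_ne_zero h2 t
  have e3 : ((x - t) ^ 2 + ε ^ 2 : ℂ) = (x + Complex.I * ε - t) * (x - Complex.I * ε - t) := by
    linear_combination ((ε : ℂ) ^ 2) * Complex.I_sq
  simp only [Complex.real_smul, pow_one]
  push_cast
  rw [e3]
  field_simp
  ring

/-- Existence almost everywhere, and description in Fourier space, of the Hilbert transform
of a square integrable function. -/
theorem exists_hilbertTransform {f : ℝ → ℂ} (hf : MemLp f 2) :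
    ∃ (h : ℝ → ℂ) (hh : MemLp h 2), (∀ᵐ x, Tendsto (truncHilbert f x) (𝓝[>] 0) (𝓝 (h x))) ∧
      eLpNorm h 2 volume ≤ eLpNorm f 2 volume ∧
      fourierL2 h hh =ᵐ[volume]
        fun ξ => -Complex.I * (SignType.sign ξ : ℝ) * fourierL2 f hf ξ := by
  have hle : ∀ ξ : ℝ, ‖-Complex.I * ((SignType.sign ξ : ℝ) : ℂ) * fourierL2 f hf ξ‖ ≤
      ‖fourierL2 f hf ξ‖ := by
    intro ξ
    rw [norm_mul, norm_mul, norm_neg, Complex.norm_I, one_mul, Complex.norm_real]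
    refine mul_le_of_le_one_left (norm_nonneg _) ?_
    rcases lt_trichotomy ξ 0 with h | h | h <;> simp [h]
  have hsm : Measurable fun ξ : ℝ => ((SignType.sign ξ : ℝ) : ℂ) := by
    have : (fun ξ : ℝ => ((SignType.sign ξ : ℝ) : ℂ)) =
        fun ξ => if 0 < ξ then (1 : ℂ) else if ξ < 0 then -1 else 0 := by
      funext ξ
      rcases lt_trichotomy ξ 0 with h | h | h <;> simp [h, not_lt_of_gt]
    rw [this]
    exact Measurable.ite measurableSet_Ioi measurable_const
      (Measurable.ite measurableSet_Iio measurable_const measurable_const)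
  have hm : MemLp (fun ξ : ℝ => -Complex.I * (SignType.sign ξ : ℝ) * fourierL2 f hf ξ) 2 :=
    (memLp_fourierL2 hf).of_le (((hsm.const_mul (-Complex.I)).aestronglyMeasurable).mul
      (memLp_fourierL2 hf).1) (Eventually.of_forall hle)
  obtain ⟨h, hh, hfh⟩ := fourierL2_surjective hm
  -- Each half-plane sees only one sign of `ξ`, so the multiplier `-i sgn ξ` that defines `h`
  -- becomes the constant `-iσ`.
  have hG : ∀ (σ : ℝ), (σ = 1 ∨ σ = -1) → ∀ (x ε : ℝ), 0 < ε →
      cauchyInt h 1 (x + Complex.I * (σ * ε)) =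
        -Complex.I * σ * cauchyInt f 1 (x + Complex.I * (σ * ε)) := by
    intro σ hσ x ε hε
    have e1 := cauchyInt_eq_fourier hh hσ (Nat.zero_le 1) hε x
    have e2 := cauchyInt_eq_fourier hf hσ (Nat.zero_le 1) hε x
    rw [zero_add] at e1 e2
    rw [e1, e2, mul_left_comm]
    congr 1
    rw [← integral_const_mul]
    refine integral_congr_ae ?_
    filter_upwards [hfh] with ξ hξ
    rw [hξ]
    by_cases hs : 0 < σ * ξ
    · have : ((SignType.sign ξ : ℝ)) = σ := by
        rcases hσ with rfl | rfl
        · have : 0 < ξ := by linarith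
          simp [this]
        · have : ξ < 0 := by linarith
          simp [this]
      rw [this]
      ring
    · have : expKer σ 0 ε ξ = 0 := by simp [expKer, hs]
      rw [this]
      simp
  refine ⟨h, hh, ?_, ?_, hfh⟩
  -- By `hG` the conjugate Poisson integral of `f` is the Poisson integral of `h`. At a common
  -- Lebesgue point of `f` and `h` the latter tends to `h x`, and the former differs from the
  -- truncated transform by a null quantity.
  · filter_upwards [hf.ae_lebesgue_point, hh.ae_lebesgue_point] with x hx1 hx2
    have t1 := hh.tendsto_poisson hx2
    have t2 := (hf.tendsto_truncHilbert_sub hx1).add t1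
    rw [zero_add] at t2
    refine t2.congr' ?_
    filter_upwards [self_mem_nhdsWithin] with ε hε
    rw [integral_poisson_smul hh x hε, integral_conj_poisson_smul hf x hε]
    have g1 := hG 1 (Or.inl rfl) x ε hε
    have g2 := hG (-1) (Or.inr rfl) x ε hε
    push_cast at g1 g2
    rw [one_mul] at g1
    rw [show (x : ℂ) + Complex.I * (-1 * ε) = x - Complex.I * ε by ring] at g2
    rw [g1, g2, sub_add_eq_add_sub, add_sub_assoc, ← smul_sub, add_eq_left]
    rw [smul_eq_zero]
    right
    linear_combination (-1 / 2 * cauchyInt f 1 (x + Complex.I * ε) -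
      1 / 2 * cauchyInt f 1 (x - Complex.I * ε)) * Complex.I_sq
  · rw [← eLpNorm_fourierL2 hh, ← eLpNorm_fourierL2 hf, eLpNorm_congr_ae hfh]
    exact eLpNorm_mono hle

/-! ### Energy of the Poisson extension in the half-plane. -/

lemma eLpNorm_two_sq_eq_lintegral {α F : Type*} [MeasurableSpace α] [NormedAddCommGroup F]
    {μ : Measure α} (f : α → F) : eLpNorm f 2 μ ^ 2 = ∫⁻ x, ‖f x‖ₑ ^ 2 ∂μ := by
  have := eLpNorm_nnreal_pow_eq_lintegral (μ := μ) (f := f) (p := 2) two_ne_zero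
  simpa using this

lemma cauchyInt_congr_ae {f g : ℝ → ℂ} (h : f =ᵐ[volume] g) (n : ℕ) (z : ℂ) :
    cauchyInt f n z = cauchyInt g n z := by
  refine integral_congr_ae ?_
  filter_upwards [h] with t ht
  rw [ht]

lemma measurable_cauchyInt {f : ℝ → ℂ} (hf : AEStronglyMeasurable f volume) (n : ℕ) :
    Measurable (cauchyInt f n) := by
  have h1 : cauchyInt f n = cauchyInt (hf.mk f) n :=
    funext fun z => cauchyInt_congr_ae hf.ae_eq_mk n z
  rw [h1]
  refine (StronglyMeasurable.integral_prod_right'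
    (f := fun p : ℂ × ℝ => hf.mk f p.2 * ((p.1 - p.2) ^ n)⁻¹) ?_).measurable
  refine Measurable.stronglyMeasurable ?_
  exact (hf.stronglyMeasurable_mk.measurable.comp measurable_snd).mul (by fun_prop)

/-- The energy density `|∇U|²` of the Poisson extension `U` of `V`, as a function on `ℂ`. -/
noncomputable def energyDensity (V : ℝ → ℂ) (z : ℂ) : ℝ≥0∞ :=
  ENNReal.ofReal (1 / (2 * Real.pi ^ 2)) *
    (‖cauchyInt V 2 z‖ₑ ^ 2 + ‖cauchyInt V 2 (conj z)‖ₑ ^ 2)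

lemma energyDensity_congr_ae {f g : ℝ → ℂ} (h : f =ᵐ[volume] g) :
    energyDensity f = energyDensity g := by
  funext z
  simp only [energyDensity, cauchyInt_congr_ae h]

lemma energyDensity_conj (V : ℝ → ℂ) (z : ℂ) : energyDensity V (conj z) = energyDensity V z := by
  rw [energyDensity, energyDensity, Complex.conj_conj, add_comm]

lemma measurable_energyDensity {V : ℝ → ℂ} (hV : AEStronglyMeasurable V volume) :
    Measurable (energyDensity V) := by
  have h := measurable_cauchyInt hV 2
  have hc : Measurable fun z : ℂ => conj z := Complex.continuous_conj.measurable
  exact (((h.enorm).pow_const 2).add (((h.comp hc).enorm).pow_const 2)).const_mul _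

/-- Plancherel on a horizontal line: at fixed height the Cauchy integral is a Fourier transform,
evaluated at `-x`, of a damped copy of the transform of `V`. The factor `16π⁴` is the squared
modulus of `(-2πiσ)²`. -/
lemma lintegral_cauchyInt_two_line {V : ℝ → ℂ} (hV : MemLp V 2) {σ : ℝ} (hσ : σ = 1 ∨ σ = -1)
    {y : ℝ} (hy : 0 < y) :
    ∫⁻ x : ℝ, ‖cauchyInt V 2 (x + Complex.I * (σ * y))‖ₑ ^ 2 =
      ∫⁻ ξ, ENNReal.ofReal (16 * Real.pi ^ 4 * expKer σ 1 y ξ ^ 2) * ‖fourierL2 V hV ξ‖ₑ ^ 2 := by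
  set a : ℝ → ℂ := fun ξ => (expKer σ 1 y ξ : ℂ) * fourierL2 V hV ξ with ha
  have hk : (1 : ℕ) ≤ 1 := le_rfl
  have hc2 : MemLp (fun ξ => (expKer σ 1 y ξ : ℂ)) 2 := (memLp_two_expKer σ hk hy).ofReal
  have hct : MemLp (fun ξ => (expKer σ 1 y ξ : ℂ)) ∞ := (memLp_top_expKer σ hk hy).ofReal
  have ha1 : Integrable a := hc2.integrable_mul (memLp_fourierL2 hV)
  have ha2 : MemLp a 2 := (memLp_fourierL2 hV).mul hct
  have e1 : ∀ x : ℝ, cauchyInt V 2 (x + Complex.I * (σ * y)) =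
      (-2 * Real.pi * Complex.I * σ) ^ 2 * 𝓕 a (-x) := by
    intro x
    rw [cauchyInt_eq_fourier hV hσ hk hy x, Real.fourier_real_eq_integral_exp_smul]
    congr 1
    refine integral_congr_ae (Eventually.of_forall fun ξ => ?_)
    simp only [ha, smul_eq_mul, phase]
    push_cast
    rw [show (-2 * Real.pi * ξ * -x * Complex.I : ℂ) = 2 * Real.pi * x * ξ * Complex.I by ring]
    ring
  have hn : ‖(-2 * Real.pi * Complex.I * σ : ℂ) ^ 2‖ₑ ^ 2 = ENNReal.ofReal (16 * Real.pi ^ 4) := by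
    rw [← ofReal_norm, ← ENNReal.ofReal_pow (norm_nonneg _)]
    congr 1
    rcases hσ with rfl | rfl <;> simp [abs_of_pos Real.pi_pos] <;> ring
  have e3 : ∀ x : ℝ, ‖cauchyInt V 2 (x + Complex.I * (σ * y))‖ₑ ^ 2 =
      ENNReal.ofReal (16 * Real.pi ^ 4) * ‖𝓕 a (-x)‖ₑ ^ 2 := by
    intro x
    rw [e1, enorm_mul, mul_pow (‖_‖ₑ) (‖_‖ₑ), hn]
  simp_rw [e3]
  rw [lintegral_const_mul' _ _ ENNReal.ofReal_ne_top,
    lintegral_neg_eq_self (fun x => ‖𝓕 a x‖ₑ ^ 2), ← eLpNorm_two_sq_eq_lintegral,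
    eLpNorm_fourier ha1 ha2, eLpNorm_two_sq_eq_lintegral,
    ← lintegral_const_mul' _ _ ENNReal.ofReal_ne_top]
  refine lintegral_congr fun ξ => ?_
  rw [ENNReal.ofReal_mul (p := 16 * Real.pi ^ 4) (by positivity), ha, enorm_mul, mul_pow, mul_assoc,
    ENNReal.ofReal_pow (expKer_nonneg _ _ _ _), ← ofReal_norm (expKer σ 1 y ξ : ℂ), Complex.norm_real,
    Real.norm_of_nonneg (expKer_nonneg _ _ _ _)]

lemma lintegral_upperHalfPlane_eq {F : ℂ → ℝ≥0∞} (hF : Measurable F) :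
    ∫⁻ z in {z : ℂ | 0 < z.im}, F z =
      ∫⁻ y in Ioi (0 : ℝ), ∫⁻ x : ℝ, F (x + Complex.I * y) := by
  have hpre : Complex.measurableEquivRealProd.symm ⁻¹' {z : ℂ | 0 < z.im} = univ ×ˢ Ioi (0 : ℝ) := by
    ext p
    simp [Complex.measurableEquivRealProd_symm_apply]
  have hmk : ∀ p : ℝ × ℝ, Complex.measurableEquivRealProd.symm p = p.1 + Complex.I * p.2 := by
    intro p
    rw [Complex.measurableEquivRealProd_symm_apply, Complex.mk_eq_add_mul_I, mul_comm]
  rw [← (Complex.volume_preserving_equiv_real_prod.symm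
    Complex.measurableEquivRealProd).setLIntegral_comp_preimage_emb
    Complex.measurableEquivRealProd.symm.measurableEmbedding, hpre, Measure.volume_eq_prod,
    ← Measure.prod_restrict, Measure.restrict_univ, lintegral_prod_symm
    (fun p => F (Complex.measurableEquivRealProd.symm p))
    (hF.comp Complex.measurableEquivRealProd.symm.measurable).aemeasurable]
  simp_rw [hmk]

/-- For `ξ ≠ 0` exactly one sign `σ` contributes, and `ξ² exp (-4π|ξ|y)` integrates over heights to
`|ξ| / (4π)`. The factor `8π²` is `16π⁴` from Plancherel times `1 / (2π²)` from the energy density.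
-/
lemma lintegral_Ioi_mul_exp (ξ : ℝ) :
    ∫⁻ y in Ioi (0 : ℝ), ENNReal.ofReal (8 * Real.pi ^ 2 *
      (expKer 1 1 y ξ ^ 2 + expKer (-1) 1 y ξ ^ 2)) = ENNReal.ofReal (2 * Real.pi * |ξ|) := by
  have h1 : ∀ y, expKer 1 1 y ξ ^ 2 + expKer (-1) 1 y ξ ^ 2 =
      ξ ^ 2 * Real.exp (-(4 * Real.pi * |ξ|) * y) := by
    intro y
    have e : Real.exp (-(4 * Real.pi * |ξ|) * y) = Real.exp (-(2 * Real.pi * y) * |ξ|) ^ 2 := by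
      rw [← Real.exp_nat_mul]
      congr 1
      push_cast
      ring
    rw [e]
    rcases lt_trichotomy ξ 0 with h | h | h
    · simp [expKer, h, h.le, mul_pow]
    · simp [expKer, h]
    · simp [expKer, h, h.le, mul_pow]
  simp_rw [h1]
  by_cases h0 : ξ = 0
  · simp [h0]
  have hpos : 0 < 4 * Real.pi * |ξ| := by positivity
  have hi : IntegrableOn (fun y => Real.exp (-(4 * Real.pi * |ξ|) * y)) (Ioi 0) :=
    exp_neg_integrableOn_Ioi 0 hpos
  rw [← ofReal_integral_eq_lintegral_ofReal ((hi.const_mul _).const_mul _)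
    (Eventually.of_forall fun y => by positivity), integral_const_mul, integral_const_mul,
    integral_exp_mul_Ioi (by linarith)]
  congr 1
  rw [mul_zero, Real.exp_zero, ← sq_abs ξ]
  have : |ξ| ≠ 0 := abs_ne_zero.2 h0
  field_simp
  ring

lemma lintegral_energyDensity_line {V : ℝ → ℂ} (hV : MemLp V 2) {y : ℝ} (hy : 0 < y) :
    ∫⁻ x : ℝ, energyDensity V (x + Complex.I * y) =
      ∫⁻ ξ, ENNReal.ofReal (8 * Real.pi ^ 2 *
      (expKer 1 1 y ξ ^ 2 + expKer (-1) 1 y ξ ^ 2)) * ‖fourierL2 V hV ξ‖ₑ ^ 2 := by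
  have hFm : AEMeasurable (fun ξ => ‖fourierL2 V hV ξ‖ₑ ^ 2) :=
    ((memLp_fourierL2 hV).1.enorm).pow_const 2
  have e1 := lintegral_cauchyInt_two_line hV (Or.inl rfl) hy
  have e2 := lintegral_cauchyInt_two_line hV (Or.inr rfl) hy
  have hconj : ∀ x : ℝ, conj (x + Complex.I * y : ℂ) = x + Complex.I * ((-1 : ℝ) * y) := by
    intro x
    simp
  unfold energyDensity
  have hm : Measurable fun x : ℝ => ‖cauchyInt V 2 (x + Complex.I * ((1 : ℝ) * y))‖ₑ ^ 2 :=
    ((measurable_cauchyInt hV.1 2).comp (by fun_prop)).enorm.pow_const 2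
  simp_rw [hconj]
  rw [lintegral_const_mul' _ _ ENNReal.ofReal_ne_top]
  have h1y : ((1 : ℝ) : ℂ) * y = y := by simp
  rw [h1y] at e1 hm
  rw [lintegral_add_left hm, e1, e2, ← lintegral_add_left', ← lintegral_const_mul' _ _
    ENNReal.ofReal_ne_top]
  · refine lintegral_congr fun ξ => ?_
    rw [← add_mul, ← mul_assoc, ← ENNReal.ofReal_add (by positivity) (by positivity),
      ← ENNReal.ofReal_mul (by positivity)]
    congr 2
    field_simp
    ring
  · exact ((((measurable_expKer 1 1 y).pow_const 2).const_mul _).ennreal_ofReal).aemeasurable.mul hFm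


lemma lintegral_lintegral_mul_right_swap (μ : Measure ℝ) [SFinite μ] {K : ℝ × ℝ → ℝ≥0∞}
    (hK : Measurable K) {F : ℝ → ℝ≥0∞} (hF : AEMeasurable F) :
    ∫⁻ y, (∫⁻ ξ, K (y, ξ) * F ξ) ∂μ = ∫⁻ ξ, (∫⁻ y, K (y, ξ) ∂μ) * F ξ := by
  refine (lintegral_lintegral_swap (f := fun y ξ => K (y, ξ) * F ξ) ?_).trans
    (lintegral_congr fun ξ => ?_)
  · exact hK.aemeasurable.mul
      (hF.comp_quasiMeasurePreserving Measure.quasiMeasurePreserving_snd)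
  · exact lintegral_mul_const _ (hK.comp (measurable_id.prodMk measurable_const))

/-- The energy of the Poisson extension in the upper half-plane in Fourier space. -/
theorem lintegral_energyDensity_upperHalfPlane {V : ℝ → ℂ} (hV : MemLp V 2) :
    ∫⁻ z in {z : ℂ | 0 < z.im}, energyDensity V z =
      ∫⁻ ξ, ENNReal.ofReal (2 * Real.pi * |ξ|) * ‖fourierL2 V hV ξ‖ₑ ^ 2 := by
  rw [lintegral_upperHalfPlane_eq (measurable_energyDensity hV.1)]
  have hFm : AEMeasurable (fun ξ => ‖fourierL2 V hV ξ‖ₑ ^ 2) :=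
    ((memLp_fourierL2 hV).1.enorm).pow_const 2
  have hexpm : Measurable fun p : ℝ × ℝ => ENNReal.ofReal (8 * Real.pi ^ 2 *
      (expKer 1 1 p.1 p.2 ^ 2 + expKer (-1) 1 p.1 p.2 ^ 2)) := by
    have : ∀ σ : ℝ, Measurable fun p : ℝ × ℝ => expKer σ 1 p.1 p.2 := by
      intro σ
      have : (fun p : ℝ × ℝ => expKer σ 1 p.1 p.2) = {p : ℝ × ℝ | 0 < σ * p.2}.indicator
          fun p => |p.2| ^ 1 * Real.exp (-(2 * Real.pi * p.1) * |p.2|) := by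
        funext p
        simp [expKer, indicator]
      rw [this]
      exact Measurable.indicator (by fun_prop) (measurableSet_lt (by fun_prop) (by fun_prop))
    exact ((((this 1).pow_const 2).add ((this (-1)).pow_const 2)).const_mul _).ennreal_ofReal
  rw [setLIntegral_congr_fun measurableSet_Ioi
    fun y hy => lintegral_energyDensity_line hV hy]
  refine (lintegral_lintegral_mul_right_swap _ hexpm hFm).trans (lintegral_congr fun ξ => ?_)
  rw [lintegral_Ioi_mul_exp]

/-! ### Conformal invariance of the energy under inversion. -/

lemma integral_comp_inv (g : ℝ → ℂ) : ∫ t : ℝ, g t = ∫ t : ℝ, (t ^ 2)⁻¹ • g t⁻¹ := by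
  have himg : (fun t : ℝ => t⁻¹) '' {0}ᶜ = {0}ᶜ := by
    ext t
    simp only [mem_image, mem_compl_iff, mem_singleton_iff]
    exact ⟨fun ⟨s, hs, hst⟩ => hst ▸ inv_ne_zero hs, fun h => ⟨t⁻¹, inv_ne_zero h, inv_inv t⟩⟩
  have h := integral_image_eq_integral_abs_deriv_smul (s := {0}ᶜ) (f := fun t : ℝ => t⁻¹)
    (f' := fun t => -(t ^ 2)⁻¹) (measurableSet_singleton 0).compl
    (fun t ht => (hasDerivAt_inv ht).hasDerivWithinAt) inv_injective.injOn g
  have hr : volume.restrict ({0}ᶜ : Set ℝ) = volume := by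
    rw [restrict_compl_singleton]
  rw [himg, hr] at h
  rw [h]
  refine integral_congr_ae (Eventually.of_forall fun t => ?_)
  simp only [abs_neg, abs_inv, abs_sq]

/-- The Jacobian `1 / t ^ 2` of the inversion matches the second power of the resolvent exactly: `t
^ 2 * (z - 1 / t) ^ 2 = z ^ 2 * (1 / z - t) ^ 2`. -/
lemma cauchyInt_two_comp_inv (V : ℝ → ℂ) {z : ℂ} (hz : z ≠ 0) :
    cauchyInt (fun t => V t⁻¹) 2 z = (z ^ 2)⁻¹ * cauchyInt V 2 z⁻¹ := by
  unfold cauchyInt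
  rw [integral_comp_inv, ← integral_const_mul]
  refine integral_congr_ae ?_
  filter_upwards [Measure.ae_ne volume 0] with t ht
  have ht' : (t : ℂ) ≠ 0 := by exact_mod_cast ht
  rw [Complex.real_smul, inv_inv]
  push_cast
  have e : (t : ℂ) ^ 2 * (z - (t : ℂ)⁻¹) ^ 2 = z ^ 2 * (z⁻¹ - t) ^ 2 := by
    field_simp
    ring
  rw [mul_left_comm, mul_left_comm _ (V t), ← mul_inv, ← mul_inv, e]

lemma energyDensity_comp_inv (V : ℝ → ℂ) {z : ℂ} (hz : z ≠ 0) :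
    energyDensity (fun t => V t⁻¹) z = ‖(z ^ 2)⁻¹‖ₑ ^ 2 * energyDensity V z⁻¹ := by
  have hz' : conj z ≠ 0 := by simpa using hz
  have h2 : ‖((conj z) ^ 2)⁻¹‖ₑ = ‖(z ^ 2)⁻¹‖ₑ := by
    rw [← map_pow, ← map_inv₀, RCLike.enorm_conj]
  rw [energyDensity, energyDensity, cauchyInt_two_comp_inv V hz, cauchyInt_two_comp_inv V hz',
    map_inv₀, enorm_mul, enorm_mul, h2]
  ring

/-- Conformal invariance of the Dirichlet integral: the density picks up the factor `|z|⁻⁴`, which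
is the absolute Jacobian determinant of `z ↦ conj z⁻¹`. The conjugation keeps the upper half-plane
in place and does not change the density. -/
lemma lintegral_energyDensity_image_inv (V : ℝ → ℂ) {S : Set ℂ} (hS : MeasurableSet S)
    (h0 : (0 : ℂ) ∉ S) :
    ∫⁻ z in (fun z : ℂ => conj z⁻¹) '' S, energyDensity V z =
      ∫⁻ z in S, energyDensity (fun t => V t⁻¹) z := by
  have hne : ∀ z ∈ S, z ≠ 0 := fun z hz h => h0 (h ▸ hz)
  have hinj : InjOn (fun z : ℂ => conj z⁻¹) S := fun a _ b _ hab =>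
    inv_injective (star_injective hab)
  rw [lintegral_image_eq_lintegral_abs_det_fderiv_mul volume hS (f' := fun z =>
    (Complex.conjCLE : ℂ →L[ℝ] ℂ) ∘L ((-(z ^ 2)⁻¹ : ℂ) • (1 : ℂ →L[ℝ] ℂ))) ?_ hinj]
  · refine setLIntegral_congr_fun hS fun z hz => ?_
    rw [energyDensity_conj, energyDensity_comp_inv V (hne z hz)]
    congr 1
    have hdet : ((Complex.conjCLE : ℂ →L[ℝ] ℂ) ∘L ((-(z ^ 2)⁻¹ : ℂ) • (1 : ℂ →L[ℝ] ℂ))).det =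
        -Complex.normSq (-(z ^ 2)⁻¹) := by
      have h1 : (((-(z ^ 2)⁻¹ : ℂ) • (1 : ℂ →L[ℝ] ℂ) : ℂ →L[ℝ] ℂ) : ℂ →ₗ[ℝ] ℂ) =
          LinearMap.mul ℝ ℂ (-(z ^ 2)⁻¹) := by
        ext
        simp
      rw [ContinuousLinearMap.det, ContinuousLinearMap.toLinearMap_comp, LinearMap.det_comp, h1]
      have h2 : LinearMap.det (LinearMap.mul ℝ ℂ (-(z ^ 2)⁻¹)) = Complex.normSq (-(z ^ 2)⁻¹) := by
        rw [← Algebra.norm_complex_apply, Algebra.norm_apply]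
        rfl
      rw [h2]
      have h3 : LinearMap.det ((Complex.conjCLE : ℂ →L[ℝ] ℂ) : ℂ →ₗ[ℝ] ℂ) = -1 :=
        Complex.det_conjLIE
      rw [h3]
      ring
    rw [hdet, abs_neg, Complex.normSq_eq_norm_sq, norm_neg, abs_sq,
      ENNReal.ofReal_pow (norm_nonneg _), ofReal_norm]
  · intro z hz
    refine HasFDerivAt.hasFDerivWithinAt ?_
    exact (Complex.conjCLE : ℂ →L[ℝ] ℂ).hasFDerivAt.comp z
      (hasDerivAt_inv (hne z hz)).complexToReal_fderiv

lemma measurableSet_upper : MeasurableSet {z : ℂ | 0 < z.im} :=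
  measurableSet_lt measurable_const Complex.measurable_im

lemma image_conj_inv_upper :
    (fun z : ℂ => conj z⁻¹) '' {z : ℂ | 0 < z.im} = {z : ℂ | 0 < z.im} := by
  have h : ∀ z : ℂ, 0 < z.im → 0 < (conj z⁻¹).im := by
    intro z hz
    have h0 : z ≠ 0 := by rintro rfl; simp at hz
    have := Complex.normSq_pos.2 h0
    rw [Complex.conj_im, Complex.inv_im, neg_div, neg_neg]
    positivity
  ext z
  refine ⟨fun ⟨w, hw, hwz⟩ => hwz ▸ h w hw, fun hz => ⟨conj z⁻¹, h z hz, ?_⟩⟩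
  simp

lemma image_conj_inv_exterior :
    (fun z : ℂ => conj z⁻¹) '' {z : ℂ | 1 < ‖z‖ ∧ 0 < z.im} = {z : ℂ | ‖z‖ < 1 ∧ 0 < z.im} := by
  have h : ∀ z : ℂ, 0 < z.im → 0 < (conj z⁻¹).im := by
    intro z hz
    have := mem_image_of_mem (fun z : ℂ => conj z⁻¹) (show z ∈ {z : ℂ | 0 < z.im} from hz)
    rwa [image_conj_inv_upper] at this
  have hn : ∀ z : ℂ, ‖conj z⁻¹‖ = ‖z‖⁻¹ := fun z => by rw [RCLike.norm_conj, norm_inv]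
  have h0 : ∀ z : ℂ, 0 < z.im → 0 < ‖z‖ := fun z hz => by
    rw [norm_pos_iff]; rintro rfl; simp at hz
  ext z
  constructor
  · rintro ⟨w, ⟨hw1, hw2⟩, rfl⟩
    refine ⟨?_, h w hw2⟩
    rw [hn]
    exact inv_lt_one_of_one_lt₀ hw1
  · rintro ⟨hz1, hz2⟩
    refine ⟨conj z⁻¹, ⟨?_, h z hz2⟩, by simp⟩
    rw [hn]
    exact (one_lt_inv₀ (h0 z hz2)).2 hz1

lemma lintegral_energyDensity_upper_comp_inv (V : ℝ → ℂ) :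
    ∫⁻ z in {z : ℂ | 0 < z.im}, energyDensity (fun t => V t⁻¹) z =
      ∫⁻ z in {z : ℂ | 0 < z.im}, energyDensity V z := by
  have := lintegral_energyDensity_image_inv V measurableSet_upper (by simp)
  rw [image_conj_inv_upper] at this
  exact this.symm

/-- The inversion carries the exterior half-disk to the interior one and preserves the energy; the
circle between them is a null set. -/
lemma lintegral_energyDensity_upper_of_inv_invariant {V : ℝ → ℂ}
    (hV : (fun t => V t⁻¹) =ᵐ[volume] V) :
    ∫⁻ z in {z : ℂ | 0 < z.im}, energyDensity V z =
      2 * ∫⁻ z in {z : ℂ | 1 < ‖z‖ ∧ 0 < z.im}, energyDensity V z := by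
  have hS : MeasurableSet {z : ℂ | 1 < ‖z‖ ∧ 0 < z.im} :=
    (measurableSet_lt measurable_const measurable_norm).inter measurableSet_upper
  have hS' : MeasurableSet {z : ℂ | ‖z‖ < 1 ∧ 0 < z.im} :=
    (measurableSet_lt measurable_norm measurable_const).inter measurableSet_upper
  have h1 := lintegral_energyDensity_image_inv V hS (by simp)
  rw [image_conj_inv_exterior, energyDensity_congr_ae hV] at h1
  have h2 : ({z : ℂ | 0 < z.im} : Set ℂ) =ᵐ[volume]
      ({z : ℂ | 1 < ‖z‖ ∧ 0 < z.im} ∪ {z : ℂ | ‖z‖ < 1 ∧ 0 < z.im} : Set ℂ) := by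
    have hs : ∀ᵐ z : ℂ, z ∉ Metric.sphere (0 : ℂ) 1 :=
      measure_eq_zero_iff_ae_notMem.1 (Measure.addHaar_sphere volume 0 1)
    filter_upwards [hs] with z hz
    have hz' : ‖z‖ ≠ 1 := by simpa using hz
    refine propext ?_
    change 0 < z.im ↔ (1 < ‖z‖ ∧ 0 < z.im) ∨ (‖z‖ < 1 ∧ 0 < z.im)
    rcases lt_or_gt_of_ne hz' with h | h <;> simp [h, h.not_gt]
  have hd : Disjoint {z : ℂ | 1 < ‖z‖ ∧ 0 < z.im} {z : ℂ | ‖z‖ < 1 ∧ 0 < z.im} :=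
    disjoint_left.2 fun z hz hz' => lt_asymm hz.1 hz'.1
  rw [setLIntegral_congr h2, lintegral_union hS' hd, h1, two_mul]

/-! ### The energy form through the Hilbert transform. -/

lemma ae_tendsto_hilbertTransform {f : ℝ → ℂ} (hf : MemLp f 2) :
    ∀ᵐ x, Tendsto (truncHilbert f x) (𝓝[>] 0) (𝓝 (hilbertTransform f x)) := by
  obtain ⟨h, _, hl, _⟩ := exists_hilbertTransform hf
  filter_upwards [hl] with x hx
  exact tendsto_nhds_limUnder ⟨_, hx⟩

lemma exists_hilbertTransform_ae_eq {f : ℝ → ℂ} (hf : MemLp f 2) :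
    ∃ (hh : MemLp (hilbertTransform f) 2),
      eLpNorm (hilbertTransform f) 2 volume ≤ eLpNorm f 2 volume ∧
      fourierL2 (hilbertTransform f) hh =ᵐ[volume]
        fun ξ => -Complex.I * (SignType.sign ξ : ℝ) * fourierL2 f hf ξ := by
  obtain ⟨h, hh, hl, hn, hF⟩ := exists_hilbertTransform hf
  have he : hilbertTransform f =ᵐ[volume] h := by
    filter_upwards [hl] with x hx
    exact hx.limUnder_eq
  have hm : MemLp (hilbertTransform f) 2 := hh.ae_eq he.symm
  refine ⟨hm, (eLpNorm_congr_ae he).trans_le hn, ?_⟩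
  have : fourierL2 (hilbertTransform f) hm = fourierL2 h hh := by
    unfold fourierL2
    rw [(MemLp.toLp_eq_toLp_iff hm hh).2 he]
  rw [this]
  exact hF

lemma memLp_hilbertTransform {f : ℝ → ℂ} (hf : MemLp f 2) : MemLp (hilbertTransform f) 2 :=
  (exists_hilbertTransform_ae_eq hf).1

lemma truncHilbert_add {f g : ℝ → ℂ} (hf : MemLp f 2) (hg : MemLp g 2) (x : ℝ) {ε : ℝ}
    (hε : 0 < ε) : truncHilbert (f + g) x ε = truncHilbert f x ε + truncHilbert g x ε := by
  simp_rw [truncHilbert_eq]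
  rw [← smul_add, ← integral_add ((memLp_trunc x hε).integrable_smul_two hf)
    ((memLp_trunc x hε).integrable_smul_two hg)]
  simp only [Pi.add_apply, smul_add]

lemma truncHilbert_const_smul (c : ℂ) (f : ℝ → ℂ) (x ε : ℝ) :
    truncHilbert (c • f) x ε = c • truncHilbert f x ε := by
  simp_rw [truncHilbert_eq]
  rw [smul_comm c, ← integral_smul c]
  simp only [Pi.smul_apply, smul_comm c]

lemma truncHilbert_congr_ae {f g : ℝ → ℂ} (h : f =ᵐ[volume] g) :
    truncHilbert f = truncHilbert g := by
  funext x ε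
  simp_rw [truncHilbert_eq]
  congr 1
  refine integral_congr_ae ?_
  filter_upwards [h] with t ht
  rw [ht]

lemma hilbertTransform_congr_ae {f g : ℝ → ℂ} (h : f =ᵐ[volume] g) :
    hilbertTransform f = hilbertTransform g := by
  funext x
  rw [hilbertTransform, hilbertTransform, truncHilbert_congr_ae h]

lemma hilbertTransform_add {f g : ℝ → ℂ} (hf : MemLp f 2) (hg : MemLp g 2) :
    hilbertTransform (f + g) =ᵐ[volume] hilbertTransform f + hilbertTransform g := by
  filter_upwards [ae_tendsto_hilbertTransform hf, ae_tendsto_hilbertTransform hg] with x h1 h2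
  refine (Tendsto.congr' ?_ (h1.add h2)).limUnder_eq
  filter_upwards [self_mem_nhdsWithin] with ε hε
  exact (truncHilbert_add hf hg x hε).symm

lemma hilbertTransform_const_smul (c : ℂ) {f : ℝ → ℂ} (hf : MemLp f 2) :
    hilbertTransform (c • f) =ᵐ[volume] c • hilbertTransform f := by
  filter_upwards [ae_tendsto_hilbertTransform hf] with x h1
  refine (Tendsto.congr (fun ε => ?_) (h1.const_smul c)).limUnder_eq
  exact (truncHilbert_const_smul c f x ε).symm

/-- `f` is the derivative of `V` on the line, both being integrable and square integrable;
the relation is expressed through the Fourier transform. -/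
structure DerivPair (V f : ℝ → ℂ) : Prop where
  integrable_fst : Integrable V
  memLp_fst : MemLp V 2
  integrable_snd : Integrable f
  memLp_snd : MemLp f 2
  fourier_eq : ∀ ξ : ℝ, 𝓕 f ξ = 2 * Real.pi * Complex.I * ξ * 𝓕 V ξ

lemma DerivPair.add_smul {V f W g : ℝ → ℂ} (h : DerivPair V f) (h' : DerivPair W g) (c : ℂ) :
    DerivPair (V + c • W) (f + c • g) where
  integrable_fst := h.integrable_fst.add (h'.integrable_fst.smul c)
  memLp_fst := h.memLp_fst.add (h'.memLp_fst.const_smul c)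
  integrable_snd := h.integrable_snd.add (h'.integrable_snd.smul c)
  memLp_snd := h.memLp_snd.add (h'.memLp_snd.const_smul c)
  fourier_eq ξ := by
    have hL : ∀ {a b : ℝ → ℂ}, Integrable a → Integrable b →
        𝓕 (a + c • b) ξ = 𝓕 a ξ + c * 𝓕 b ξ := by
      intro a b ha hb
      have hi : ∀ {u : ℝ → ℂ}, Integrable u → Integrable fun v : ℝ =>
          Complex.exp (↑(-2 * Real.pi * v * ξ) * Complex.I) • u v := by
        intro u hu
        have hcc : Continuous fun v : ℝ => Complex.exp (↑(-2 * Real.pi * v * ξ) * Complex.I) := by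
          fun_prop
        refine hu.mono (hcc.aestronglyMeasurable.smul hu.1) (Eventually.of_forall fun v => ?_)
        rw [norm_smul, Complex.norm_exp_ofReal_mul_I, one_mul]
      simp_rw [Real.fourier_real_eq_integral_exp_smul]
      rw [← integral_const_mul, ← integral_add (hi ha) ((hi hb).const_mul c)]
      refine integral_congr_ae (Eventually.of_forall fun v => ?_)
      simp only [Pi.add_apply, Pi.smul_apply, smul_eq_mul]
      ring
    rw [hL h.integrable_snd h'.integrable_snd, hL h.integrable_fst h'.integrable_fst,
      h.fourier_eq, h'.fourier_eq]
    ring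

/-- The energy of the Poisson extension, through the Hilbert transform of the derivative. -/
theorem DerivPair.energy {V f : ℝ → ℂ} (h : DerivPair V f) :
    (∫⁻ z in {z : ℂ | 0 < z.im}, energyDensity V z) ≠ ∞ ∧
    ∫ x, hilbertTransform f x * conj (V x) =
      ((∫⁻ z in {z : ℂ | 0 < z.im}, energyDensity V z).toReal : ℂ) := by
  obtain ⟨hm, -, hF⟩ := exists_hilbertTransform_ae_eq h.memLp_snd
  have hVf : fourierL2 f h.memLp_snd =ᵐ[volume]
      fun ξ : ℝ => 2 * Real.pi * Complex.I * ξ * fourierL2 V h.memLp_fst ξ := by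
    filter_upwards [fourier_toLp_ae_eq h.integrable_snd h.memLp_snd,
      fourier_toLp_ae_eq h.integrable_fst h.memLp_fst] with ξ e1 e2
    rw [fourierL2, fourierL2, e1, e2, h.fourier_eq]
  -- The symbols multiply: `-i sgn ξ` times `2πiξ` is `2π|ξ|`, the weight of the energy in Fourier
  -- space.
  have hH : fourierL2 _ hm =ᵐ[volume]
      fun ξ : ℝ => ((2 * Real.pi * |ξ| : ℝ) : ℂ) * fourierL2 V h.memLp_fst ξ := by
    filter_upwards [hF, hVf] with ξ e1 e2
    rw [e1, e2]
    have : (SignType.sign ξ : ℝ) * ξ = |ξ| := sign_mul_self ξ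
    rw [← this]
    push_cast
    linear_combination (-2 * Real.pi * (((SignType.sign ξ : ℝ) : ℂ)) * ξ *
      fourierL2 V h.memLp_fst ξ) * Complex.I_sq
  have hint : Integrable fun ξ => fourierL2 _ hm ξ * conj (fourierL2 V h.memLp_fst ξ) :=
    (memLp_fourierL2 hm).integrable_mul (memLp_fourierL2 h.memLp_fst).star
  have hre : (fun ξ => fourierL2 _ hm ξ * conj (fourierL2 V h.memLp_fst ξ)) =ᵐ[volume]
      fun ξ : ℝ => ((2 * Real.pi * |ξ| * ‖fourierL2 V h.memLp_fst ξ‖ ^ 2 : ℝ) : ℂ) := by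
    filter_upwards [hH] with ξ e1
    rw [e1, mul_assoc, Complex.mul_conj, Complex.normSq_eq_norm_sq]
    push_cast
    rfl
  have hint' : Integrable fun ξ : ℝ => 2 * Real.pi * |ξ| * ‖fourierL2 V h.memLp_fst ξ‖ ^ 2 := by
    have := (hint.congr hre).re
    simpa only [RCLike.re_eq_complex_re, Complex.ofReal_re] using this
  have hlin : ∫⁻ z in {z : ℂ | 0 < z.im}, energyDensity V z =
      ENNReal.ofReal (∫ ξ : ℝ, 2 * Real.pi * |ξ| * ‖fourierL2 V h.memLp_fst ξ‖ ^ 2) := by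
    rw [lintegral_energyDensity_upperHalfPlane h.memLp_fst, ofReal_integral_eq_lintegral_ofReal hint'
      (Eventually.of_forall fun ξ => by positivity)]
    refine lintegral_congr fun ξ => ?_
    rw [ENNReal.ofReal_mul (p := 2 * Real.pi * |ξ|) (by positivity),
      ENNReal.ofReal_pow (norm_nonneg _), ofReal_norm]
  rw [hlin]
  refine ⟨ENNReal.ofReal_ne_top, ?_⟩
  rw [ENNReal.toReal_ofReal (integral_nonneg fun ξ => by positivity),
    ← integral_mul_conj_fourierL2 hm h.memLp_fst, integral_congr_ae hre]
  exact integral_ofReal (𝕜 := ℂ)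

lemma integral_hilbertTransform_mul_conj_expand {f g V W : ℝ → ℂ} (hf : MemLp f 2) (hg : MemLp g 2)
    (hV : MemLp V 2) (hW : MemLp W 2) (c : ℂ) :
    ∫ x, hilbertTransform (f + c • g) x * conj ((V + c • W) x) =
      (∫ x, hilbertTransform f x * conj (V x)) + conj c * (∫ x, hilbertTransform f x * conj (W x)) +
      c * (∫ x, hilbertTransform g x * conj (V x)) +
      c * conj c * ∫ x, hilbertTransform g x * conj (W x) := by
  have hi : ∀ {a b : ℝ → ℂ}, MemLp a 2 → MemLp b 2 →
      Integrable fun x => hilbertTransform a x * conj (b x) := fun ha hb =>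
    (memLp_hilbertTransform ha).integrable_mul hb.star
  have i1 := hi hf hV
  have i2 := (hi hf hW).const_mul (conj c)
  have i3 := (hi hg hV).const_mul c
  have i4 := (hi hg hW).const_mul (c * conj c)
  have e : (fun x => hilbertTransform (f + c • g) x * conj ((V + c • W) x)) =ᵐ[volume]
      fun x => hilbertTransform f x * conj (V x) + conj c * (hilbertTransform f x * conj (W x)) +
        c * (hilbertTransform g x * conj (V x)) +
        c * conj c * (hilbertTransform g x * conj (W x)) := by
    filter_upwards [hilbertTransform_add hf (hg.const_smul c), hilbertTransform_const_smul c hg]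
      with x e1 e2
    rw [e1, Pi.add_apply, e2]
    simp only [Pi.add_apply, Pi.smul_apply, smul_eq_mul, map_add, map_mul]
    ring
  rw [integral_congr_ae e, ← integral_const_mul, ← integral_const_mul, ← integral_const_mul]
  refine (integral_add ((i1.add i2).add i3) i4).trans (congrArg₂ _ ?_ rfl)
  exact (integral_add (i1.add i2) i3).trans (congrArg₂ _ (integral_add i1 i2) rfl)

/-- Functions that are even and odd under the inversion are orthogonal for the energy. -/
lemma DerivPair.integral_hilbertTransform_mul_conj_eq_zero {V f W g : ℝ → ℂ} (h : DerivPair V f)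
    (h' : DerivPair W g) (hV : (fun t => V t⁻¹) =ᵐ[volume] V)
    (hW : (fun t => W t⁻¹) =ᵐ[volume] -W) :
    ∫ x, hilbertTransform f x * conj (W x) = 0 := by
  -- Composing `V + c W` with the inversion gives `V - c W`, and the energy in the half-plane does
  -- not change.
  have key : ∀ c : ℂ, ∫ x, hilbertTransform (f + c • g) x * conj ((V + c • W) x) =
      ∫ x, hilbertTransform (f + (-c) • g) x * conj ((V + (-c) • W) x) := by
    intro c
    rw [(h.add_smul h' c).energy.2, (h.add_smul h' (-c)).energy.2]
    congr 2
    rw [← lintegral_energyDensity_upper_comp_inv (V + c • W)]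
    have : (fun t => (V + c • W) t⁻¹) =ᵐ[volume] V + (-c) • W := by
      filter_upwards [hV, hW] with t e1 e2
      simp only [Pi.add_apply, Pi.smul_apply, smul_eq_mul, Pi.neg_apply] at e1 e2 ⊢
      rw [e1, e2]
      ring
    rw [energyDensity_congr_ae this]
  -- Comparing the expansions at `c` and `-c` leaves only cross terms; `c = 1` says that they are
  -- opposite, `c = i` that they are equal, so both vanish.
  have k1 := key 1
  have k2 := key Complex.I
  simp only [integral_hilbertTransform_mul_conj_expand h.memLp_snd h'.memLp_snd h.memLp_fst
    h'.memLp_fst, map_one, map_neg, Complex.conj_I] at k1 k2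
  linear_combination (1 / 4 : ℂ) * k1 + (1 / 4 : ℂ) * Complex.I * k2 + (1 / 2 : ℂ) *
    ((∫ x, hilbertTransform f x * conj (W x)) - ∫ x, hilbertTransform g x * conj (V x)) * Complex.I_sq

end

/-! ### Weak derivatives. -/

section WeakDeriv

set_option linter.unusedSectionVars false

variable {X : Type*} [NormedAddCommGroup X] [NormedSpace ℝ X] [FiniteDimensional ℝ X]
  [MeasureSpace X] [BorelSpace X]

lemma MeasureTheory.LocallyIntegrableOn.integrable_smul_of_tsupport_subset {U : Set X}
    {w : X → ℂ} (hw : LocallyIntegrableOn w U) {φ : X → ℝ} (hφ : Continuous φ)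
    (hc : HasCompactSupport φ) (hs : tsupport φ ⊆ U) : Integrable fun x => φ x • w x := by
  have h1 : IntegrableOn w (tsupport φ) := hw.integrableOn_compact_subset hs hc
  have h2 : IntegrableOn (fun x => φ x • w x) (tsupport φ) :=
    h1.continuousOn_smul hφ.continuousOn hc
  refine (integrableOn_iff_integrable_of_support_subset ?_).1 h2
  exact (Function.support_smul_subset_left φ w).trans (subset_tsupport φ)

lemma setIntegral_smul_of_tsupport_subset {U : Set X} {φ : X → ℝ} (hs : tsupport φ ⊆ U)
    (w : X → ℂ) : ∫ x in U, φ x • w x = ∫ x, φ x • w x := by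
  refine setIntegral_eq_integral_of_forall_compl_eq_zero fun x hx => ?_
  rw [image_eq_zero_of_notMem_tsupport fun h => hx (hs h), zero_smul]

lemma setIntegral_smul_eq_of_tsupport_subset {U U' : Set X} {φ : X → ℝ} (hs : tsupport φ ⊆ U')
    (hU : U' ⊆ U) (w : X → ℂ) : ∫ x in U, φ x • w x = ∫ x in U', φ x • w x := by
  rw [setIntegral_smul_of_tsupport_subset hs,
    setIntegral_smul_of_tsupport_subset (hs.trans hU)]

lemma tsupport_fderiv_apply_subset' (φ : X → ℝ) (e : X) :
    tsupport (fun x => fderiv ℝ φ x e) ⊆ tsupport φ :=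
  tsupport_fderiv_apply_subset ℝ e

lemma ContDiff.continuous_fderiv_apply_const {φ : X → ℝ} (hφ : ContDiff ℝ (⊤ : ℕ∞) φ) (e : X) :
    Continuous fun x => fderiv ℝ φ x e :=
  (hφ.continuous_fderiv (by simp)).clm_apply continuous_const

namespace HalfPlaneDisk.HasWeakDeriv

variable {U : Set X} {u u' w w' : X → ℂ} {e : X}

lemma ae_eq (hU : IsOpen U) (h : HasWeakDeriv U u e w) (h' : HasWeakDeriv U u e w') :
    w =ᵐ[volume.restrict U] w' := by
  have key := hU.ae_eq_zero_of_integral_contDiff_smul_eq_zero (μ := volume) (f := w - w')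
    (h.2.1.sub h'.2.1) fun φ h1 h2 h3 => ?_
  · rw [Filter.EventuallyEq, ae_restrict_iff' hU.measurableSet]
    filter_upwards [key] with x hx hxU
    exact sub_eq_zero.1 (hx hxU)
  · have e1 := (h.2.2 φ h1 h2 h3).symm.trans (h'.2.2 φ h1 h2 h3)
    rw [neg_inj, setIntegral_smul_of_tsupport_subset h3,
      setIntegral_smul_of_tsupport_subset h3] at e1
    simp only [Pi.sub_apply, smul_sub]
    rw [integral_sub (h.2.1.integrable_smul_of_tsupport_subset h1.continuous h2 h3)
      (h'.2.1.integrable_smul_of_tsupport_subset h1.continuous h2 h3), e1, sub_self]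

lemma add_const_smul (h : HasWeakDeriv U u e w) (h' : HasWeakDeriv U u' e w') (c : ℂ) :
    HasWeakDeriv U (u + c • u') e (w + c • w') := by
  refine ⟨h.1.add (h'.1.smul c), h.2.1.add (h'.2.1.smul c), fun φ h1 h2 h3 => ?_⟩
  have hd := ContDiff.continuous_fderiv_apply_const h1 e
  have hdc : HasCompactSupport fun x => fderiv ℝ φ x e := h2.fderiv_apply ℝ e
  have hds := (tsupport_fderiv_apply_subset' φ e).trans h3
  have e1 := h.2.2 φ h1 h2 h3
  have e2 := h'.2.2 φ h1 h2 h3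
  simp only [Pi.add_apply, Pi.smul_apply, smul_add, smul_comm _ c]
  refine (integral_add (h.1.integrable_smul_of_tsupport_subset hd hdc hds).restrict
    ((h'.1.integrable_smul_of_tsupport_subset hd hdc hds).smul c).restrict).trans ?_
  refine Eq.trans ?_ (congrArg Neg.neg
    (integral_add (h.2.1.integrable_smul_of_tsupport_subset h1.continuous h2 h3).restrict
    ((h'.2.1.integrable_smul_of_tsupport_subset h1.continuous h2 h3).smul c).restrict).symm)
  simp only [Pi.smul_apply]
  rw [integral_smul, integral_smul, e1, e2, smul_neg, neg_add]

lemma congr_ae (h : HasWeakDeriv U u e w) (hU : IsOpen U) (hu : u =ᵐ[volume.restrict U] u')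
    (hw : w =ᵐ[volume.restrict U] w') : HasWeakDeriv U u' e w' := by
  have hl : ∀ {a b : X → ℂ}, a =ᵐ[volume.restrict U] b → LocallyIntegrableOn a U →
      LocallyIntegrableOn b U := by
    intro a b hab ha
    rw [locallyIntegrableOn_iff hU.isLocallyClosed] at ha ⊢
    exact fun k hk hkc => (ha k hk hkc).congr (ae_restrict_of_ae_restrict_of_subset hk hab)
  refine ⟨hl hu h.1, hl hw h.2.1, fun φ h1 h2 h3 => ?_⟩
  have e1 : ∫ x in U, fderiv ℝ φ x e • u' x = ∫ x in U, fderiv ℝ φ x e • u x :=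
    integral_congr_ae (hu.mono fun x hx => by simp only [hx])
  have e2 : ∫ x in U, φ x • w' x = ∫ x in U, φ x • w x :=
    integral_congr_ae (hw.mono fun x hx => by simp only [hx])
  rw [e1, e2]
  exact h.2.2 φ h1 h2 h3

lemma mono {U' : Set X} (h : HasWeakDeriv U u e w) (hU : U' ⊆ U) : HasWeakDeriv U' u e w :=
  ⟨h.1.mono_set hU, h.2.1.mono_set hU, fun φ h1 h2 h3 => by
    rw [← setIntegral_smul_eq_of_tsupport_subset h3 hU,
      ← setIntegral_smul_eq_of_tsupport_subset ((tsupport_fderiv_apply_subset' φ e).trans h3) hU]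
    exact h.2.2 φ h1 h2 (h3.trans hU)⟩

lemma hasWeakDeriv_weakDeriv (h : HasWeakDeriv U u e w) : HasWeakDeriv U u e (weakDeriv U u e) := by
  have hex : ∃ w, HasWeakDeriv U u e w := ⟨w, h⟩
  rw [HalfPlaneDisk.weakDeriv, dif_pos hex]
  exact hex.choose_spec

lemma weakDeriv_ae_eq (h : HasWeakDeriv U u e w) (hU : IsOpen U) :
    HalfPlaneDisk.weakDeriv U u e =ᵐ[volume.restrict U] w :=
  h.hasWeakDeriv_weakDeriv.ae_eq hU h

end HalfPlaneDisk.HasWeakDeriv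

end WeakDeriv

/-! ### `W^{1,2}` on the free surface: continuous representatives and integration by parts. -/

lemma isOpen_freeSurface : IsOpen freeSurface := isOpen_lt continuous_const continuous_abs

lemma measurableSet_freeSurface : MeasurableSet freeSurface := isOpen_freeSurface.measurableSet

/-- Integration by parts by Fubini on the triangle `t ≤ x`, since `g` is only integrable and its
primitive need not be differentiable everywhere. -/
lemma intervalIntegral_primitive_mul_deriv {a b : ℝ} (hab : a ≤ b) {g ψ ψ' : ℝ → ℂ}
    (hg : IntervalIntegrable g volume a b) (hψ : ∀ x ∈ Icc a b, HasDerivAt ψ (ψ' x) x)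
    (hc : ContinuousOn ψ' (Icc a b)) :
    ∫ x in a..b, (∫ t in a..x, g t) * ψ' x =
      (∫ t in a..b, g t) * ψ b - ∫ t in a..b, g t * ψ t := by
  have hS : MeasurableSet {p : ℝ × ℝ | p.2 ≤ p.1} := measurableSet_le measurable_snd measurable_fst
  have hg' : IntegrableOn g (Ioc a b) := (intervalIntegrable_iff_integrableOn_Ioc_of_le hab).1 hg
  have hψ'i : IntegrableOn ψ' (Ioc a b) := (hc.integrableOn_Icc).mono_set Ioc_subset_Icc_self
  have hψc : ContinuousOn ψ (Icc a b) := fun x hx => (hψ x hx).continuousAt.continuousWithinAt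
  have hF : Integrable (fun p : ℝ × ℝ => {p : ℝ × ℝ | p.2 ≤ p.1}.indicator
      (fun p => g p.2 * ψ' p.1) p)
      ((volume.restrict (Ioc a b)).prod (volume.restrict (Ioc a b))) := by
    refine Integrable.indicator ?_ hS
    have := Integrable.mul_prod (μ := volume.restrict (Ioc a b)) (ν := volume.restrict (Ioc a b))
      hψ'i hg'
    exact this.congr (Eventually.of_forall fun p => mul_comm _ _)
  have hsw := integral_integral_swap (f := fun x t => {p : ℝ × ℝ | p.2 ≤ p.1}.indicator
      (fun p => g p.2 * ψ' p.1) (x, t)) hF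
  have hL : ∀ x ∈ Ioc a b, ∫ t in Ioc a b, {p : ℝ × ℝ | p.2 ≤ p.1}.indicator
      (fun p => g p.2 * ψ' p.1) (x, t) = (∫ t in a..x, g t) * ψ' x := by
    intro x hx
    have : ∀ t, {p : ℝ × ℝ | p.2 ≤ p.1}.indicator (fun p => g p.2 * ψ' p.1) (x, t) =
        (Iic x).indicator (fun t => g t * ψ' x) t := fun t => by
      simp [indicator]
    simp_rw [this]
    rw [integral_indicator measurableSet_Iic, Measure.restrict_restrict measurableSet_Iic,
      inter_comm, Ioc_inter_Iic, min_eq_right hx.2, integral_mul_const,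
      intervalIntegral.integral_of_le hx.1.le]
  have hR : ∀ t ∈ Ioc a b, ∫ x in Ioc a b, {p : ℝ × ℝ | p.2 ≤ p.1}.indicator
      (fun p => g p.2 * ψ' p.1) (x, t) = g t * (ψ b - ψ t) := by
    intro t ht
    have : ∀ x, {p : ℝ × ℝ | p.2 ≤ p.1}.indicator (fun p => g p.2 * ψ' p.1) (x, t) =
        (Ici t).indicator (fun x => g t * ψ' x) x := fun x => by
      simp [indicator]
    simp_rw [this]
    have hst : Ici t ∩ Ioc a b = Icc t b := by
      ext x
      simp only [mem_inter_iff, mem_Ici, mem_Ioc, mem_Icc]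
      exact ⟨fun h => ⟨h.1, h.2.2⟩, fun h => ⟨h.1, ht.1.trans_le h.1, h.2⟩⟩
    rw [integral_indicator measurableSet_Ici, Measure.restrict_restrict measurableSet_Ici, hst,
      integral_const_mul, integral_Icc_eq_integral_Ioc, ← intervalIntegral.integral_of_le ht.2,
      intervalIntegral.integral_eq_sub_of_hasDerivAt]
    · intro x hx
      rw [uIcc_of_le ht.2] at hx
      exact hψ x ⟨ht.1.le.trans hx.1, hx.2⟩
    · exact (hc.mono (by rw [uIcc_of_le ht.2]; exact Icc_subset_Icc_left ht.1.le)).intervalIntegrable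
  rw [intervalIntegral.integral_of_le hab, ← setIntegral_congr_fun measurableSet_Ioc hL, hsw,
    setIntegral_congr_fun measurableSet_Ioc hR, intervalIntegral.integral_of_le hab,
    intervalIntegral.integral_of_le hab, ← integral_mul_const]
  have hgψ : IntegrableOn (fun t => g t * ψ t) (Ioc a b) := by
    have h1 : IntegrableOn g (Icc a b) := (integrableOn_Icc_iff_integrableOn_Ioc (by simp)).2 hg'
    exact (h1.mul_continuousOn hψc isCompact_Icc).mono_set Ioc_subset_Icc_self
  rw [← integral_sub (hg'.mul_const _) hgψ]
  refine integral_congr_ae (Eventually.of_forall fun t => ?_)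
  simp only
  ring

lemma hasWeakDeriv_primitive {g : ℝ → ℂ} (hg : LocallyIntegrable g) (a₀ : ℝ) :
    HasWeakDeriv univ (fun x => ∫ t in a₀..x, g t) 1 g := by
  have hii : ∀ a b, IntervalIntegrable g volume a b := fun a b =>
    (hg.integrableOn_isCompact isCompact_uIcc).intervalIntegrable
  have hcont : Continuous fun x => ∫ t in a₀..x, g t := intervalIntegral.continuous_primitive hii a₀
  refine ⟨hcont.locallyIntegrable.locallyIntegrableOn _, hg.locallyIntegrableOn _,
    fun φ h1 h2 _ => ?_⟩
  obtain ⟨r, hr⟩ := h2.isCompact.isBounded.subset_closedBall 0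
  set b := |r| + 1
  have hr0 : r < b := (le_abs_self r).trans_lt (lt_add_one _)
  have hb0 : 0 < b := by positivity
  have hout : ∀ x, x ∉ Ioc (-b) b → x ∉ tsupport φ := by
    intro x hx hx'
    have := hr hx'
    rw [mem_closedBall_zero_iff, Real.norm_eq_abs] at this
    exact hx ⟨by linarith [neg_abs_le x], by linarith [le_abs_self x]⟩
  have hφb : φ b = 0 := image_eq_zero_of_notMem_tsupport fun h => by
    have := hr h
    rw [mem_closedBall_zero_iff, Real.norm_eq_abs] at this
    linarith [le_abs_self b]
  have hφa : φ (-b) = 0 := image_eq_zero_of_notMem_tsupport (hout _ fun h => lt_irrefl _ h.1)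
  have hd : ∀ x, HasDerivAt (fun x => (φ x : ℂ)) ((fderiv ℝ φ x 1 : ℝ) : ℂ) x := fun x => by
    have : HasDerivAt φ (fderiv ℝ φ x 1) x := by
      rw [fderiv_apply_one_eq_deriv]
      exact (h1.differentiable (by simp) x).hasDerivAt
    exact this.ofReal_comp
  have hdc : Continuous fun x => ((fderiv ℝ φ x 1 : ℝ) : ℂ) :=
    Complex.continuous_ofReal.comp (ContDiff.continuous_fderiv_apply_const h1 1)
  have e1 : ∫ x, fderiv ℝ φ x 1 • (∫ t in a₀..x, g t) =
      ∫ x in (-b)..b, (∫ t in a₀..x, g t) * ((fderiv ℝ φ x 1 : ℝ) : ℂ) := by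
    rw [intervalIntegral.integral_of_le (by linarith), ← setIntegral_eq_integral_of_forall_compl_eq_zero
      (s := Ioc (-b) b)]
    · simp only [Complex.real_smul, mul_comm]
    · intro x hx
      rw [image_eq_zero_of_notMem_tsupport (f := fun x => fderiv ℝ φ x 1)
        fun h => hout x hx (tsupport_fderiv_apply_subset' φ 1 h), zero_smul]
  have e2 : ∫ x, φ x • g x = ∫ x in (-b)..b, g x * φ x := by
    rw [intervalIntegral.integral_of_le (by linarith), ← setIntegral_eq_integral_of_forall_compl_eq_zero
      (s := Ioc (-b) b)]
    · simp only [Complex.real_smul, mul_comm]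
    · intro x hx
      rw [image_eq_zero_of_notMem_tsupport (hout x hx), zero_smul]
  -- Moving the base point to `-b`, left of the support, costs a constant, which is invisible to
  -- `φ'` because `φ` vanishes at both ends.
  have e3 : ∀ x, (∫ t in a₀..x, g t) = (∫ t in a₀..(-b), g t) + ∫ t in (-b)..x, g t := fun x =>
    (intervalIntegral.integral_add_adjacent_intervals (hii _ _) (hii _ _)).symm
  have hp : Continuous fun x => ∫ t in (-b)..x, g t := intervalIntegral.continuous_primitive hii _
  have e4 : ∫ x in (-b)..b, ((fderiv ℝ φ x 1 : ℝ) : ℂ) = 0 := by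
    rw [intervalIntegral.integral_eq_sub_of_hasDerivAt (fun x _ => hd x)
      (hdc.intervalIntegrable _ _), hφa, hφb, sub_self]
  have e5 : (fun x => (∫ t in a₀..x, g t) * ((fderiv ℝ φ x 1 : ℝ) : ℂ)) = fun x =>
      (∫ t in a₀..(-b), g t) * ((fderiv ℝ φ x 1 : ℝ) : ℂ) +
        (∫ t in (-b)..x, g t) * ((fderiv ℝ φ x 1 : ℝ) : ℂ) :=
    funext fun x => by rw [e3 x, add_mul]
  rw [setIntegral_univ, setIntegral_univ, e1, e2, e5]
  refine (intervalIntegral.integral_add ((continuous_const.mul hdc).intervalIntegrable _ _)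
    ((hp.mul hdc).intervalIntegrable _ _)).trans ?_
  simp only [Pi.mul_apply]
  rw [intervalIntegral.integral_const_mul, e4, mul_zero,
    zero_add, intervalIntegral_primitive_mul_deriv (by linarith) (hii _ _) (fun x _ => hd x)
    hdc.continuousOn, hφb, Complex.ofReal_zero, mul_zero, zero_sub]

/-- The du Bois-Reymond argument: subtracting from a test function `ψ` the multiple of a fixed bump
`η` with the same integral leaves a function of mean zero. Its primitive is again a test function,
supported in `I` because `I` is order-connected, so the integral of `ψ u` is determined by that of
`η u`. -/
lemma ae_eq_const_of_hasWeakDeriv_zero {I : Set ℝ} (hI : IsOpen I) (hI' : I.OrdConnected)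
    (hne : I.Nonempty) {u : ℝ → ℂ} (h : HasWeakDeriv I u 1 0) :
    ∃ C, u =ᵐ[volume.restrict I] fun _ => C := by
  obtain ⟨x₀, hx₀⟩ := hne
  obtain ⟨η, hηs, hηc, hηd, hηr, hη1⟩ := exists_contDiff_tsupport_subset (n := ⊤)
    (hI.mem_nhds hx₀)
  have hηpos : 0 < ∫ x, η x :=
    hηd.continuous.integral_pos_of_hasCompactSupport_nonneg_nonzero hηc
      (fun x => (hηr (mem_range_self x)).1) (x := x₀) (by rw [hη1]; exact one_ne_zero)
  set m := ∫ x, η x with hm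
  refine ⟨m⁻¹ • ∫ x, η x • u x, ?_⟩
  set C := m⁻¹ • ∫ x, η x • u x
  have hCl : LocallyIntegrableOn (fun _ : ℝ => C) I :=
    (continuous_const.locallyIntegrable).locallyIntegrableOn _
  have key := hI.ae_eq_zero_of_integral_contDiff_smul_eq_zero (μ := volume)
    (f := u - fun _ => C) (h.1.sub hCl) fun ψ h1 h2 h3 => ?_
  · rw [Filter.EventuallyEq, ae_restrict_iff' hI.measurableSet]
    filter_upwards [key] with x hx hxU
    exact sub_eq_zero.1 (hx hxU)
  set q := (∫ x, ψ x) / m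
  set θ : ℝ → ℝ := fun x => ψ x - q * η x with hθ
  have hθd : ContDiff ℝ (⊤ : ℕ∞) θ := h1.sub (contDiff_const.mul hηd)
  have hψi : Integrable ψ := h1.continuous.integrable_of_hasCompactSupport h2
  have hηi : Integrable η := hηd.continuous.integrable_of_hasCompactSupport hηc
  have hθi : ∫ x, θ x = 0 := by
    rw [integral_sub hψi (hηi.const_mul q), integral_const_mul, ← hm, div_mul_cancel₀ _ hηpos.ne',
      sub_self]
  set K := tsupport ψ ∪ tsupport η
  have hK : IsCompact K := h2.isCompact.union hηc.isCompact
  have hKne : K.Nonempty := ⟨x₀, Or.inr (subset_tsupport _ (by simp [hη1]))⟩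
  have hKI : K ⊆ I := union_subset h3 hηs
  set a := sInf K
  set b := sSup K
  have haK : a ∈ K := hK.sInf_mem hKne
  have hbK : b ∈ K := hK.sSup_mem hKne
  have hKab : K ⊆ Icc a b := fun x hx =>
    ⟨csInf_le hK.bddBelow hx, le_csSup hK.bddAbove hx⟩
  have hab : a ≤ b := (hKab haK).2
  have hθ0 : ∀ x, x ∉ Icc a b → θ x = 0 := by
    intro x hx
    have e1 : ψ x = 0 := image_eq_zero_of_notMem_tsupport fun h => hx (hKab (Or.inl h))
    have e2 : η x = 0 := image_eq_zero_of_notMem_tsupport fun h => hx (hKab (Or.inr h))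
    simp [hθ, e1, e2]
  set φ : ℝ → ℝ := fun x => ∫ t in a..x, θ t with hφ
  have hφ' : ∀ x, HasDerivAt φ (θ x) x := fun x =>
    intervalIntegral.integral_hasDerivAt_right (hθd.continuous.intervalIntegrable _ _)
      (hθd.continuous.stronglyMeasurableAtFilter _ _) hθd.continuous.continuousAt
  have hφd : ContDiff ℝ (⊤ : ℕ∞) φ := by
    rw [contDiff_infty_iff_deriv]
    refine ⟨fun x => (hφ' x).differentiableAt, ?_⟩
    have : deriv φ = θ := funext fun x => (hφ' x).deriv
    rw [this]
    exact hθd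
  have hφ0 : ∀ x, x ∉ Icc a b → φ x = 0 := by
    intro x hx
    rcases lt_or_ge x a with hxa | hxa
    · simp only [hφ]
      rw [intervalIntegral.integral_symm, intervalIntegral.integral_of_le hxa.le,
        ← integral_Ico_eq_integral_Ioc, setIntegral_eq_zero_of_forall_eq_zero, neg_zero]
      exact fun t ht => hθ0 t fun h => not_le.2 ht.2 h.1
    · have hxb : b < x := not_le.1 fun h => hx ⟨hxa, h⟩
      simp only [hφ]
      rw [intervalIntegral.integral_of_le hxa, ← integral_Icc_eq_integral_Ioc,
        setIntegral_eq_integral_of_forall_compl_eq_zero, hθi]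
      exact fun t ht => hθ0 t fun h => ht ⟨h.1, h.2.trans hxb.le⟩
  have hφs : tsupport φ ⊆ Icc a b :=
    closure_minimal (fun x hx => not_not.1 fun h => hx (hφ0 x h)) isClosed_Icc
  have hφc : HasCompactSupport φ :=
    HasCompactSupport.of_support_subset_isCompact isCompact_Icc ((subset_tsupport φ).trans hφs)
  have hφI : tsupport φ ⊆ I := hφs.trans (hI'.out (hKI haK) (hKI hbK))
  have e1 := h.2.2 φ hφd hφc hφI
  have e2 : ∀ x, fderiv ℝ φ x 1 = θ x := fun x => by
    rw [fderiv_apply_one_eq_deriv, (hφ' x).deriv]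
  simp only [e2, Pi.zero_apply, smul_zero, integral_zero, neg_zero] at e1
  have i1 := h.1.integrable_smul_of_tsupport_subset h1.continuous h2 h3
  have i2 := h.1.integrable_smul_of_tsupport_subset hηd.continuous hηc hηs
  have e3 : ∫ x in I, θ x • u x = (∫ x, ψ x • u x) - q • ∫ x, η x • u x := by
    rw [setIntegral_eq_integral_of_forall_compl_eq_zero]
    · rw [← integral_smul]
      refine Eq.trans ?_ (integral_sub i1 (i2.smul q))
      refine integral_congr_ae (Eventually.of_forall fun x => ?_)
      simp only [hθ, sub_smul, mul_smul]
    · intro x hx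
      rw [hθ0 x fun h => hx (hI'.out (hKI haK) (hKI hbK) h), zero_smul]
  simp only [Pi.sub_apply, smul_sub]
  rw [integral_sub i1 (hψi.smul_const C), integral_smul_const]
  rw [e3] at e1
  rw [← e1]
  congr 1
  rw [smul_smul, ← div_eq_mul_inv]

/-- A function `v` of `W^{1,2}` of the free surface, with the extension `g` by zero of its
derivative and its continuous representative `c`. -/
structure W12Data (v g c : ℝ → ℂ) : Prop where
  memLp_fst : MemLp v 2 (volume.restrict freeSurface)
  memLp_snd : MemLp g 2
  eq_zero : ∀ x ∉ freeSurface, g x = 0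
  ae_eq : v =ᵐ[volume.restrict freeSurface] c
  ftc_pos : ∀ a b, 0 < a → 0 < b → ∫ x in a..b, g x = c b - c a
  ftc_neg : ∀ a b, a < 0 → b < 0 → ∫ x in a..b, g x = c b - c a

lemma freeSurface_eq : freeSurface = Iio (-1) ∪ Ioi 1 := by
  ext x
  simp only [freeSurface, mem_ofPred_eq, lt_abs, mem_union, mem_Iio, mem_Ioi]
  rw [or_comm, lt_neg]

/-- Continuous representatives exist, for any choice of the weak derivative. -/
lemma exists_w12Data_of_hasWeakDeriv {v w : ℝ → ℂ}
    (hv : MemLp v 2 (volume.restrict freeSurface)) (hw : HasWeakDeriv freeSurface v 1 w)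
    (hw2 : MemLp w 2 (volume.restrict freeSurface)) :
    ∃ c, W12Data v (freeSurface.indicator w) c := by
  set g := freeSurface.indicator w with hg
  have hg2 : MemLp g 2 := (memLp_indicator_iff_restrict measurableSet_freeSurface).2 hw2
  have hgl : LocallyIntegrable g := hg2.locallyIntegrable (by norm_num)
  have hii : ∀ a b, IntervalIntegrable g volume a b := fun a b =>
    (hgl.integrableOn_isCompact isCompact_uIcc).intervalIntegrable
  set p : ℝ → ℂ := fun x => ∫ t in (0 : ℝ)..x, g t with hp
  have hgw : g =ᵐ[volume.restrict freeSurface] w := indicator_ae_eq_restrict measurableSet_freeSurface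
  have key : ∀ I ⊆ freeSurface, IsOpen I → I.OrdConnected → I.Nonempty →
      ∃ C, ∀ᵐ x ∂volume.restrict I, v x = C + p x := by
    intro I hIE hI hI' hne
    have h1 := (hw.mono hIE).add_const_smul ((hasWeakDeriv_primitive hgl 0).mono (subset_univ I)) (-1)
    have h2 : HasWeakDeriv I (v + (-1 : ℂ) • p) 1 0 := by
      refine h1.congr_ae hI EventuallyEq.rfl ?_
      filter_upwards [ae_restrict_of_ae_restrict_of_subset hIE hgw] with x hx
      simp [hx]
    obtain ⟨C, hC⟩ := ae_eq_const_of_hasWeakDeriv_zero hI hI' hne h2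
    refine ⟨C, ?_⟩
    filter_upwards [hC] with x hx
    rw [← hx]
    simp
  have hsub : Ioi (1 : ℝ) ⊆ freeSurface := by rw [freeSurface_eq]; exact subset_union_right
  have hsub' : Iio (-1 : ℝ) ⊆ freeSurface := by rw [freeSurface_eq]; exact subset_union_left
  obtain ⟨C₁, h₁⟩ := key (Ioi 1) hsub isOpen_Ioi ordConnected_Ioi ⟨2, by simp⟩
  obtain ⟨C₂, h₂⟩ := key (Iio (-1)) hsub' isOpen_Iio ordConnected_Iio ⟨-2, by simp⟩
  have hpf : ∀ a b, ∫ x in a..b, g x = p b - p a := fun a b =>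
    (intervalIntegral.integral_interval_sub_left (hii 0 b) (hii 0 a)).symm
  -- Each half-line has its own constant of integration. The two branches are glued at `0`, away
  -- from the closure of the free surface; as `g` vanishes on `[-1, 1]`, the representative is
  -- constant on each side of `0` there.
  refine ⟨fun x => if 0 < x then C₁ + p x else C₂ + p x, hv, hg2,
    fun x hx => indicator_of_notMem hx _, ?_, ?_, ?_⟩
  · rw [freeSurface_eq, Filter.EventuallyEq, ae_restrict_union_iff]
    constructor
    · filter_upwards [h₂, ae_restrict_mem measurableSet_Iio] with x hx hx'
      have : ¬ 0 < x := by
        have : x < -1 := hx'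
        linarith
      rw [if_neg this, hx]
    · filter_upwards [h₁, ae_restrict_mem measurableSet_Ioi] with x hx hx'
      have : 0 < x := by
        have : 1 < x := hx'
        linarith
      rw [if_pos this, hx]
  · intro a b ha hb
    rw [hpf]
    simp [ha, hb]
  · intro a b ha hb
    rw [hpf]
    simp [ha.not_gt, hb.not_gt]

lemma closure_freeSurface_subset : closure freeSurface ⊆ {0}ᶜ := by
  refine (closure_minimal (t := {x : ℝ | 1 ≤ |x|}) (fun x hx => ?_)
    (isClosed_le continuous_const continuous_abs)).trans ?_
  · exact (show (1 : ℝ) < |x| from hx).le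
  · intro x hx h
    rw [mem_singleton_iff] at h
    rw [mem_ofPred_eq, h, abs_zero] at hx
    linarith

lemma one_mem_closure_freeSurface : (1 : ℝ) ∈ closure freeSurface := by
  have : (1 : ℝ) ∈ closure (Ioi (1 : ℝ)) := by rw [closure_Ioi]; exact self_mem_Ici
  refine closure_mono ?_ this
  rw [freeSurface_eq]; exact subset_union_right

lemma neg_one_mem_closure_freeSurface : (-1 : ℝ) ∈ closure freeSurface := by
  have : (-1 : ℝ) ∈ closure (Iio (-1 : ℝ)) := by rw [closure_Iio]; exact self_mem_Iic
  refine closure_mono ?_ this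
  rw [freeSurface_eq]; exact subset_union_left

namespace W12Data

variable {v g c : ℝ → ℂ}

lemma intervalIntegrable (h : W12Data v g c) (a b : ℝ) : IntervalIntegrable g volume a b :=
  ((h.memLp_snd.locallyIntegrable (by norm_num)).integrableOn_isCompact
    isCompact_uIcc).intervalIntegrable

lemma continuousAt (h : W12Data v g c) {x : ℝ} (hx : x ≠ 0) : ContinuousAt c x := by
  have hp : ∀ a, Continuous fun y => c a + ∫ t in a..y, g t := fun a =>
    continuous_const.add (intervalIntegral.continuous_primitive h.intervalIntegrable a)
  rcases lt_or_gt_of_ne hx with hx | hx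
  · refine (hp (-1)).continuousAt.congr ?_
    filter_upwards [Iio_mem_nhds hx] with y hy
    rw [h.ftc_neg (-1) y (by norm_num) hy]
    ring
  · refine (hp 1).continuousAt.congr ?_
    filter_upwards [Ioi_mem_nhds hx] with y hy
    rw [h.ftc_pos 1 y (by norm_num) hy]
    ring

/-- Continuous functions that agree almost everywhere on an open set agree on it, hence on its
closure. This reaches the endpoints `1` and `-1`, so the choice made in `contRep` does not matter.
-/
lemma eqOn_contRep (h : W12Data v g c) : EqOn (contRep v) c (closure freeSurface) := by
  have hc : ContinuousOn c (closure freeSurface) := fun x hx =>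
    (h.continuousAt (closure_freeSurface_subset hx)).continuousWithinAt
  have hex : ∃ w : ℝ → ℂ, ContinuousOn w (closure freeSurface) ∧
      w =ᵐ[volume.restrict freeSurface] v := ⟨c, hc, h.ae_eq.symm⟩
  have hs := hex.choose_spec
  have he : contRep v = hex.choose := by rw [contRep, dif_pos hex]
  rw [← he] at hs
  have h1 : EqOn (contRep v) c freeSurface :=
    Measure.eqOn_open_of_ae_eq (hs.2.trans h.ae_eq) isOpen_freeSurface
      (hs.1.mono subset_closure) (hc.mono subset_closure)
  exact h1.of_subset_closure hs.1 hc subset_closure subset_rfl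

lemma integrableOn_of_bounded (h : W12Data v g c) {S : Set ℝ} (hS : Bornology.IsBounded S) :
    IntegrableOn g S := by
  obtain ⟨r, hr⟩ := hS.subset_closedBall 0
  exact ((h.memLp_snd.locallyIntegrable (by norm_num)).integrableOn_isCompact
    (isCompact_closedBall 0 r)).mono_set hr

/-- Differentiability of `ψ` is asked only away from `0`, so that the formula also applies to `t ↦ ψ
t⁻¹`. -/
lemma setIntegral_Ioc (h : W12Data v g c) {a b : ℝ} (hab : a ≤ b) (h0 : 0 < a ∨ b < 0)
    {ψ ψ' : ℝ → ℂ} (hψ : ∀ x ≠ 0, HasDerivAt ψ (ψ' x) x) (hc : ContinuousOn ψ' {0}ᶜ) :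
    IntegrableOn (fun x => g x * ψ x + c x * ψ' x) (Ioc a b) ∧
    ∫ x in Ioc a b, (g x * ψ x + c x * ψ' x) = c b * ψ b - c a * ψ a := by
  have hne : ∀ x ∈ Icc a b, x ≠ 0 := by
    intro x hx hx0
    rcases h0 with h0 | h0
    · linarith [hx.1]
    · linarith [hx.2]
  have hc' : ContinuousOn ψ' (Icc a b) := hc.mono fun x hx => hne x hx
  have hψc : ContinuousOn ψ (Icc a b) := fun x hx =>
    (hψ x (hne x hx)).continuousAt.continuousWithinAt
  have hcc : ContinuousOn c (Icc a b) := fun x hx => (h.continuousAt (hne x hx)).continuousWithinAt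
  have hftc : ∀ x ∈ Icc a b, c x = c a + ∫ t in a..x, g t := by
    intro x hx
    rcases h0 with h0 | h0
    · rw [h.ftc_pos a x h0 (h0.trans_le hx.1)]; ring
    · rw [h.ftc_neg a x (hab.trans_lt h0) (hx.2.trans_lt h0)]; ring
  have i1 : IntegrableOn (fun x => g x * ψ x) (Icc a b) :=
    (h.integrableOn_of_bounded (Metric.isBounded_Icc a b)).mul_continuousOn hψc isCompact_Icc
  have i2 : IntegrableOn (fun x => c x * ψ' x) (Icc a b) := (hcc.mul hc').integrableOn_Icc
  refine ⟨(i1.add i2).mono_set Ioc_subset_Icc_self, ?_⟩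
  have hp := intervalIntegral_primitive_mul_deriv hab (h.intervalIntegrable a b)
    (fun x hx => hψ x (hne x hx)) hc'
  have hpi : IntegrableOn (fun x => (∫ t in a..x, g t) * ψ' x) (Icc a b) :=
    (((intervalIntegral.continuous_primitive h.intervalIntegrable a).continuousOn).mul
      hc').integrableOn_Icc
  have e1 : ∫ x in Ioc a b, c x * ψ' x =
      (∫ x in Ioc a b, c a * ψ' x) + ∫ x in Ioc a b, (∫ t in a..x, g t) * ψ' x := by
    rw [← integral_add ((hc'.integrableOn_Icc.mono_set Ioc_subset_Icc_self).const_mul _)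
      (hpi.mono_set Ioc_subset_Icc_self)]
    refine setIntegral_congr_fun measurableSet_Ioc fun x hx => ?_
    rw [hftc x (Ioc_subset_Icc_self hx), add_mul]
  have e2 : ∫ x in a..b, ψ' x = ψ b - ψ a := by
    refine intervalIntegral.integral_eq_sub_of_hasDerivAt (fun x hx => ?_) ?_
    · rw [uIcc_of_le hab] at hx
      exact hψ x (hne x hx)
    · exact (hc'.mono (by rw [uIcc_of_le hab])).intervalIntegrable
  rw [integral_add (i1.mono_set Ioc_subset_Icc_self) (i2.mono_set Ioc_subset_Icc_self), e1,
    integral_const_mul, ← intervalIntegral.integral_of_le hab, ← intervalIntegral.integral_of_le hab,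
    ← intervalIntegral.integral_of_le hab, hp, e2, hftc b (right_mem_Icc.2 hab)]
  ring

/-- Integration by parts on the free surface, for compactly supported functions. -/
lemma setIntegral_freeSurface (h : W12Data v g c) {R : ℝ} (hR : 1 ≤ R)
    (hg : ∀ x, R ≤ |x| → g x = 0) (hcR : ∀ x, R ≤ |x| → c x = 0)
    {ψ ψ' : ℝ → ℂ} (hψ : ∀ x ≠ 0, HasDerivAt ψ (ψ' x) x) (hc : ContinuousOn ψ' {0}ᶜ) :
    IntegrableOn (fun x => g x * ψ x + c x * ψ' x) freeSurface ∧
    ∫ x in freeSurface, (g x * ψ x + c x * ψ' x) = c (-1) * ψ (-1) - c 1 * ψ 1 := by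
  obtain ⟨i1, e1⟩ := h.setIntegral_Ioc hR (Or.inl one_pos) hψ hc
  obtain ⟨i2, e2⟩ := h.setIntegral_Ioc (neg_le_neg hR) (Or.inr (by norm_num)) hψ hc
  have hz : ∀ x, R ≤ |x| → g x * ψ x + c x * ψ' x = 0 := fun x hx => by
    rw [hg x hx, hcR x hx]; ring
  have hRR : c R = 0 := hcR R (le_abs_self R)
  have hRR' : c (-R) = 0 := hcR (-R) (by rw [abs_neg]; exact le_abs_self R)
  set F := fun x => g x * ψ x + c x * ψ' x with hF
  set S := Ioc (-R) (-1) ∪ Ioc 1 R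
  have hd : Disjoint (Ioc (-R) (-1)) (Ioc 1 R) := disjoint_left.2 fun x hx hx' => by
    linarith [hx.2, hx'.1]
  have hS : IntegrableOn F S := i2.union i1
  have hSE : freeSurface.indicator F =ᵐ[volume] S.indicator F := by
    filter_upwards [Measure.ae_ne volume (-1 : ℝ)] with x hx
    by_cases hxS : x ∈ S
    · have : x ∈ freeSurface := by
        rw [freeSurface_eq]
        rcases hxS with h | h
        · exact Or.inl (lt_of_le_of_ne h.2 hx)
        · exact Or.inr h.1
      rw [indicator_of_mem hxS, indicator_of_mem this]
    · rw [indicator_of_notMem hxS]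
      by_cases hxE : x ∈ freeSurface
      · rw [indicator_of_mem hxE]
        refine hz x ?_
        by_contra hlt
        push Not at hlt
        rw [abs_lt] at hlt
        rw [freeSurface_eq] at hxE
        rcases hxE with h | h
        · exact hxS (Or.inl ⟨hlt.1, le_of_lt h⟩)
        · exact hxS (Or.inr ⟨h, hlt.2.le⟩)
      · rw [indicator_of_notMem hxE]
  have hSm : MeasurableSet S := measurableSet_Ioc.union measurableSet_Ioc
  constructor
  · rw [← integrable_indicator_iff measurableSet_freeSurface]
    exact ((integrable_indicator_iff hSm).2 hS).congr hSE.symm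
  · rw [← integral_indicator measurableSet_freeSurface, integral_congr_ae hSE,
      integral_indicator hSm, setIntegral_union hd measurableSet_Ioc i2 i1, e1, e2, hRR, hRR']
    ring

lemma eq_zero_of_le_abs (h : W12Data v g c) {R : ℝ} (hR : 1 ≤ R)
    (hv : ∀ x, R ≤ |x| → v x = 0) :
    ∀ x, R ≤ |x| → c x = 0 := by
  have hEq : EqOn c (fun _ => 0) (Ioi R ∪ Iio (-R)) := by
    have ho : IsOpen (Ioi R ∪ Iio (-R)) := isOpen_Ioi.union isOpen_Iio
    have habs : ∀ x ∈ Ioi R ∪ Iio (-R), R < |x| := by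
      rintro x (hx | hx)
      · exact lt_of_lt_of_le hx (le_abs_self x)
      · rw [lt_abs]; right
        have : x < -R := hx
        linarith
    have hsub : Ioi R ∪ Iio (-R) ⊆ freeSurface := fun x hx => lt_of_le_of_lt hR (habs x hx)
    refine Measure.eqOn_open_of_ae_eq (μ := volume) ?_ ho ?_ continuousOn_const
    · filter_upwards [ae_restrict_of_ae_restrict_of_subset hsub h.ae_eq,
        ae_restrict_mem ho.measurableSet] with x h1 h2
      rw [← h1, hv x (habs x h2).le]
    · exact fun x hx => (h.continuousAt
        (closure_freeSurface_subset (subset_closure (hsub hx)))).continuousWithinAt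
  have hcl : closure (Ioi R ∪ Iio (-R)) = {x : ℝ | R ≤ |x|} := by
    rw [closure_union, closure_Ioi, closure_Iio]
    ext x
    rw [mem_union, mem_Ici, mem_Iic, mem_ofPred_eq, le_abs, le_neg]
  have h0 : ∀ x : ℝ, R ≤ |x| → x ≠ 0 := by
    rintro x hx rfl
    rw [abs_zero] at hx
    linarith
  have h1 := hEq.of_subset_closure (t := {x : ℝ | R ≤ |x|})
    (fun x hx => (h.continuousAt (h0 x hx)).continuousWithinAt) continuousOn_const
    (hcl ▸ subset_closure) hcl.ge
  exact fun x hx => h1 hx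

end W12Data

/-! ### Extension to the line by inversion. -/

lemma lintegral_comp_inv (G : ℝ → ℝ≥0∞) :
    ∫⁻ t : ℝ, G t = ∫⁻ t : ℝ, ENNReal.ofReal (t ^ 2)⁻¹ * G t⁻¹ := by
  have himg : (fun t : ℝ => t⁻¹) '' {0}ᶜ = {0}ᶜ := by
    ext t
    simp only [mem_image, mem_compl_iff, mem_singleton_iff]
    exact ⟨fun ⟨s, hs, hst⟩ => hst ▸ inv_ne_zero hs, fun h => ⟨t⁻¹, inv_ne_zero h, inv_inv t⟩⟩
  have h := lintegral_image_eq_lintegral_abs_deriv_mul (s := {0}ᶜ) (f := fun t : ℝ => t⁻¹)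
    (f' := fun t => -(t ^ 2)⁻¹) (measurableSet_singleton 0).compl
    (fun t ht => (hasDerivAt_inv ht).hasDerivWithinAt) inv_injective.injOn G
  have hr : volume.restrict ({0}ᶜ : Set ℝ) = volume := by
    rw [restrict_compl_singleton]
  rw [himg, hr] at h
  rw [h]
  refine lintegral_congr fun t => ?_
  rw [abs_neg, abs_inv, abs_sq]

lemma quasiMeasurePreserving_real_inv :
    Measure.QuasiMeasurePreserving (fun t : ℝ => t⁻¹) volume volume := by
  refine ⟨measurable_inv, Measure.AbsolutelyContinuous.mk fun s hs h0 => ?_⟩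
  rw [Measure.map_apply measurable_inv hs, ← lintegral_indicator_one (measurable_inv hs),
    lintegral_comp_inv]
  have : ∀ t : ℝ, ENNReal.ofReal (t ^ 2)⁻¹ * ((fun t : ℝ => t⁻¹) ⁻¹' s).indicator 1 t⁻¹ =
      s.indicator (fun t : ℝ => ENNReal.ofReal (t ^ 2)⁻¹) t := fun t => by
    by_cases ht : t ∈ s <;> simp [indicator, ht]
  simp_rw [this]
  rw [lintegral_indicator hs, setLIntegral_measure_zero _ _ h0]

lemma ae_mem_freeSurface_inv : ∀ᵐ t : ℝ, (t⁻¹ ∈ freeSurfaceᶜ ↔ t ∈ freeSurface) := by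
  filter_upwards [Measure.ae_ne volume (0 : ℝ), Measure.ae_ne volume (1 : ℝ),
    Measure.ae_ne volume (-1 : ℝ)] with t h0 h1 h2
  have hpos : 0 < |t| := abs_pos.2 h0
  have hne : |t| ≠ 1 := fun h => by
    rcases (abs_eq zero_le_one).1 h with h | h
    · exact h1 h
    · exact h2 h
  simp only [freeSurface, mem_compl_iff, mem_ofPred_eq, not_lt, abs_inv]
  rw [inv_le_one₀ hpos]
  exact ⟨fun h => lt_of_le_of_ne h hne.symm, le_of_lt⟩

lemma setLIntegral_compl_freeSurface (G : ℝ → ℝ≥0∞) :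
    ∫⁻ t in freeSurfaceᶜ, G t = ∫⁻ t in freeSurface, ENNReal.ofReal (t ^ 2)⁻¹ * G t⁻¹ := by
  rw [← lintegral_indicator measurableSet_freeSurface.compl, lintegral_comp_inv,
    ← lintegral_indicator measurableSet_freeSurface]
  refine lintegral_congr_ae ?_
  filter_upwards [ae_mem_freeSurface_inv] with t ht
  by_cases h : t ∈ freeSurface
  · rw [indicator_of_mem h, indicator_of_mem (ht.2 h)]
  · rw [indicator_of_notMem h, indicator_of_notMem (fun h' => h (ht.1 h')), mul_zero]

lemma setIntegral_compl_freeSurface (G : ℝ → ℂ) :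
    ∫ t in freeSurfaceᶜ, G t = ∫ t in freeSurface, (t ^ 2)⁻¹ • G t⁻¹ := by
  rw [← integral_indicator measurableSet_freeSurface.compl, integral_comp_inv,
    ← integral_indicator measurableSet_freeSurface]
  refine integral_congr_ae ?_
  filter_upwards [ae_mem_freeSurface_inv] with t ht
  by_cases h : t ∈ freeSurface
  · rw [indicator_of_mem h, indicator_of_mem (ht.2 h)]
  · rw [indicator_of_notMem h, indicator_of_notMem (fun h' => h (ht.1 h')), smul_zero]

section

open scoped FourierTransform

/-- The extension of a function on the free surface to the line, with `v (1 / s) = κ * v s`. -/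
noncomputable def inversionExt (κ : ℂ) (v : ℝ → ℂ) (s : ℝ) : ℂ :=
  freeSurface.indicator v s + κ * freeSurface.indicator v s⁻¹

/-- The derivative of `inversionExt κ v`, where `g` is the derivative of `v`, extended by zero. -/
noncomputable def inversionExtDeriv (κ : ℂ) (g : ℝ → ℂ) (s : ℝ) : ℂ :=
  g s - κ * (((s : ℂ) ^ 2)⁻¹ * g s⁻¹)

lemma inversionExt_one_inv (v : ℝ → ℂ) (s : ℝ) : inversionExt 1 v s⁻¹ = inversionExt 1 v s := by
  simp only [inversionExt, inv_inv, one_mul, add_comm]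

lemma inversionExt_neg_one_inv (v : ℝ → ℂ) (s : ℝ) :
    inversionExt (-1) v s⁻¹ = -inversionExt (-1) v s := by
  simp only [inversionExt, inv_inv]
  ring

lemma inv_notMem_freeSurface {s : ℝ} (hs : s ∈ freeSurface) : s⁻¹ ∉ freeSurface := by
  have h : 1 < |s| := hs
  intro h'
  have h' : 1 < |s⁻¹| := h'
  rw [abs_inv] at h'
  exact absurd (inv_le_one_of_one_le₀ h.le) (not_le.2 h')

lemma ne_zero_of_mem_freeSurface {s : ℝ} (hs : s ∈ freeSurface) : s ≠ 0 :=
  closure_freeSurface_subset (subset_closure hs)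

lemma inversionExt_of_mem (κ : ℂ) (v : ℝ → ℂ) {s : ℝ} (hs : s ∈ freeSurface) :
    inversionExt κ v s = v s := by
  rw [inversionExt, indicator_of_mem hs, indicator_of_notMem (inv_notMem_freeSurface hs), mul_zero,
    add_zero]

lemma inversionExt_inv_of_mem (κ : ℂ) (v : ℝ → ℂ) {s : ℝ} (hs : s ∈ freeSurface) :
    inversionExt κ v s⁻¹ = κ * v s := by
  rw [inversionExt, inv_inv, indicator_of_mem hs, indicator_of_notMem (inv_notMem_freeSurface hs),
    zero_add]

lemma inversionExtDeriv_of_mem (κ : ℂ) {g : ℝ → ℂ} (hg : ∀ x ∉ freeSurface, g x = 0) {s : ℝ}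
    (hs : s ∈ freeSurface) : inversionExtDeriv κ g s = g s := by
  rw [inversionExtDeriv, hg _ (inv_notMem_freeSurface hs), mul_zero, mul_zero, sub_zero]

lemma inversionExtDeriv_inv_of_mem (κ : ℂ) {g : ℝ → ℂ} (hg : ∀ x ∉ freeSurface, g x = 0) {s : ℝ}
    (hs : s ∈ freeSurface) : inversionExtDeriv κ g s⁻¹ = -(κ * (s ^ 2 * g s : ℂ)) := by
  rw [inversionExtDeriv, hg _ (inv_notMem_freeSurface hs), inv_inv]
  push_cast
  rw [inv_pow, inv_inv]
  ring

lemma eLpNorm_comp_inv_sq (F : ℝ → ℂ) : eLpNorm (fun s => F s⁻¹) 2 volume ^ 2 =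
    ∫⁻ t : ℝ, ENNReal.ofReal (t ^ 2)⁻¹ * ‖F t‖ₑ ^ 2 := by
  rw [eLpNorm_two_sq_eq_lintegral, lintegral_comp_inv]
  simp only [inv_inv]

lemma eLpNorm_indicator_comp_inv_le (v : ℝ → ℂ) :
    eLpNorm (fun s => freeSurface.indicator v s⁻¹) 2 volume ≤
      eLpNorm v 2 (volume.restrict freeSurface) := by
  rw [← ENNReal.pow_le_pow_left_iff two_ne_zero, eLpNorm_comp_inv_sq,
    eLpNorm_two_sq_eq_lintegral, ← lintegral_indicator measurableSet_freeSurface]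
  refine lintegral_mono fun t => ?_
  by_cases ht : t ∈ freeSurface
  · rw [indicator_of_mem ht, indicator_of_mem ht]
    refine mul_le_of_le_one_left bot_le (ENNReal.ofReal_le_one.2 ?_)
    refine inv_le_one_of_one_le₀ ?_
    have h : 1 < |t| := ht
    rw [← sq_abs]
    nlinarith
  · rw [indicator_of_notMem ht, indicator_of_notMem ht]
    simp

lemma memLp_indicator_comp_inv {v : ℝ → ℂ} (hv : MemLp v 2 (volume.restrict freeSurface)) :
    MemLp (fun s => freeSurface.indicator v s⁻¹) 2 := by
  have h := (memLp_indicator_iff_restrict measurableSet_freeSurface).2 hv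
  exact ⟨h.1.comp_quasiMeasurePreserving quasiMeasurePreserving_real_inv,
    (eLpNorm_indicator_comp_inv_le v).trans_lt hv.2⟩

lemma memLp_inversionExt (κ : ℂ) {v : ℝ → ℂ} (hv : MemLp v 2 (volume.restrict freeSurface)) :
    MemLp (inversionExt κ v) 2 :=
  ((memLp_indicator_iff_restrict measurableSet_freeSurface).2 hv).add
    ((memLp_indicator_comp_inv hv).const_mul κ)

/-- The inverted part has squared `L²` norm equal to the integral of `t² |g|²`, a weight bounded by
`R²` on the support of `g`. This is where bounded support enters the argument. -/
lemma memLp_inversionExtDeriv (κ : ℂ) {g : ℝ → ℂ} (hg : MemLp g 2)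
    {R : ℝ} (hgR : ∀ x, R ≤ |x| → g x = 0) : MemLp (inversionExtDeriv κ g) 2 := by
  have h1 : AEStronglyMeasurable (fun s : ℝ => ((s : ℂ) ^ 2)⁻¹ * g s⁻¹) :=
    (by fun_prop : Measurable fun s : ℝ => ((s : ℂ) ^ 2)⁻¹).aestronglyMeasurable.mul
      (hg.1.comp_quasiMeasurePreserving quasiMeasurePreserving_real_inv)
  refine hg.sub (MemLp.const_mul ⟨h1, ?_⟩ κ)
  have h2 : eLpNorm (fun s : ℝ => ((s : ℂ) ^ 2)⁻¹ * g s⁻¹) 2 volume ^ 2 ≤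
      ENNReal.ofReal (R ^ 2) * ∫⁻ t, ‖g t‖ₑ ^ 2 := by
    have := eLpNorm_comp_inv_sq fun s : ℝ => (s : ℂ) ^ 2 * g s
    push_cast at this
    simp only [inv_pow] at this
    rw [this, ← lintegral_const_mul' _ _ ENNReal.ofReal_ne_top]
    refine lintegral_mono fun t => ?_
    rcases eq_or_ne t 0 with rfl | ht
    · simp
    by_cases hR : R ≤ |t|
    · simp [hgR t hR]
    · have e : ‖(t : ℂ) ^ 2 * g t‖ₑ ^ 2 = ENNReal.ofReal (t ^ 2) * (ENNReal.ofReal (t ^ 2) * ‖g t‖ₑ ^ 2) := by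
        rw [enorm_mul, mul_pow, ← mul_assoc, ← sq]
        congr 2
        rw [← Complex.ofReal_pow, ← ofReal_norm, Complex.norm_real, Real.norm_of_nonneg (sq_nonneg t)]
      rw [e, ← mul_assoc, ← ENNReal.ofReal_mul (by positivity), inv_mul_cancel₀ (by positivity),
        ENNReal.ofReal_one, one_mul]
      refine mul_le_mul_left (ENNReal.ofReal_le_ofReal ?_) _
      rw [← sq_abs t]
      push Not at hR
      exact pow_le_pow_left₀ (abs_nonneg t) hR.le 2
  have h3 : eLpNorm (fun s : ℝ => ((s : ℂ) ^ 2)⁻¹ * g s⁻¹) 2 volume ^ 2 < ∞ :=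
    h2.trans_lt (ENNReal.mul_lt_top ENNReal.ofReal_lt_top
      (lt_top_iff_ne_top.2 hg.lintegral_enorm_sq_ne_top))
  exact (ENNReal.pow_lt_top_iff.1 h3).resolve_right two_ne_zero

lemma MeasureTheory.MemLp.integrable_of_eq_zero {f : ℝ → ℂ} (hf : MemLp f 2) {R : ℝ}
    (h : ∀ x, R ≤ |x| → f x = 0) : Integrable f := by
  have h1 : IntegrableOn f (Metric.closedBall 0 R) :=
    (hf.locallyIntegrable (by norm_num)).integrableOn_isCompact (isCompact_closedBall 0 R)
  refine (integrableOn_iff_integrable_of_support_subset fun x hx => ?_).1 h1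
  rw [mem_closedBall_zero_iff, Real.norm_eq_abs]
  by_contra hlt
  exact hx (h x (not_le.1 hlt).le)

lemma setIntegral_add_compl_freeSurface {F : ℝ → ℂ} (hF : Integrable F) :
    ∫ t, F t = (∫ t in freeSurface, F t) + ∫ t in freeSurface, (t ^ 2)⁻¹ • F t⁻¹ := by
  rw [← setIntegral_compl_freeSurface, integral_add_compl measurableSet_freeSurface hF]

namespace W12Data

variable {v g c : ℝ → ℂ}

/-- Parts are integrated on the free surface against `ψ` and against `t ↦ ψ t⁻¹`, the second copy
with weight `-κ`. Since `1` and `-1` are fixed by the inversion, both copies produce the same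
boundary term, up to that weight. -/
lemma integral_inversionExt (h : W12Data v g c) {R : ℝ} (hR : 1 ≤ R)
    (hg : ∀ x, R ≤ |x| → g x = 0) (hcR : ∀ x, R ≤ |x| → c x = 0) (κ : ℂ)
    {ψ ψ' : ℝ → ℂ} (hψ : ∀ x, HasDerivAt ψ (ψ' x) x) (hc : Continuous ψ')
    (hi : Integrable fun x => inversionExtDeriv κ g x * ψ x + inversionExt κ v x * ψ' x) :
    ∫ x, (inversionExtDeriv κ g x * ψ x + inversionExt κ v x * ψ' x) =
      (1 - κ) * (c (-1) * ψ (-1) - c 1 * ψ 1) := by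
  have h1 := (h.setIntegral_freeSurface hR hg hcR (fun x _ => hψ x) hc.continuousOn).2
  have hd : ∀ x : ℝ, x ≠ 0 → HasDerivAt (fun t : ℝ => ψ t⁻¹) (-((x : ℂ) ^ 2)⁻¹ * ψ' x⁻¹) x := by
    intro x hx
    refine ((hψ x⁻¹).scomp x (hasDerivAt_inv hx)).congr_deriv ?_
    rw [Complex.real_smul]
    push_cast
    ring
  have hcont : ContinuousOn (fun x : ℝ => -((x : ℂ) ^ 2)⁻¹ * ψ' x⁻¹) {0}ᶜ := by
    refine ContinuousOn.mul (ContinuousOn.neg (ContinuousOn.inv₀ (by fun_prop) fun x hx => ?_))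
      (hc.comp_continuousOn (continuousOn_id.inv₀ fun x hx => hx))
    exact pow_ne_zero 2 (Complex.ofReal_ne_zero.2 hx)
  have h2 := (h.setIntegral_freeSurface hR hg hcR hd hcont).2
  simp only [inv_neg, inv_one] at h2
  rw [setIntegral_add_compl_freeSurface hi, sub_mul, one_mul, sub_eq_add_neg]
  congr 1
  · rw [← h1]
    refine setIntegral_congr_ae measurableSet_freeSurface ?_
    filter_upwards [(ae_restrict_iff' measurableSet_freeSurface).1 h.ae_eq] with x hx hxE
    rw [inversionExtDeriv_of_mem κ h.eq_zero hxE, inversionExt_of_mem κ v hxE, hx hxE]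
  · rw [← h2, ← neg_mul, ← integral_const_mul]
    refine setIntegral_congr_ae measurableSet_freeSurface ?_
    filter_upwards [(ae_restrict_iff' measurableSet_freeSurface).1 h.ae_eq] with x hx hxE
    rw [inversionExtDeriv_inv_of_mem κ h.eq_zero hxE, inversionExt_inv_of_mem κ v hxE, hx hxE,
      Complex.real_smul]
    have : (x : ℂ) ≠ 0 := Complex.ofReal_ne_zero.2 (ne_zero_of_mem_freeSurface hxE)
    push_cast
    field_simp
    ring

/-- Integration by parts against the Fourier exponential. The boundary terms at `1` and `-1` cancel
in the even extension `κ = 1`, which is continuous there; otherwise the function itself has to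
vanish at these points. -/
lemma derivPair (h : W12Data v g c) {R : ℝ} (hR : 1 ≤ R) (hg : ∀ x, R ≤ |x| → g x = 0)
    (hvR : ∀ x, R ≤ |x| → v x = 0) {κ : ℂ} (hκ : κ = 1 ∨ c 1 = 0 ∧ c (-1) = 0) :
    DerivPair (inversionExt κ v) (inversionExtDeriv κ g) := by
  have hinv : ∀ x : ℝ, R ≤ |x| → x⁻¹ ∉ freeSurface := fun x hx hx' => by
    have h' : 1 < |x⁻¹| := hx'
    rw [abs_inv] at h'
    exact absurd (inv_le_one_of_one_le₀ (hR.trans hx)) (not_le.2 h')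
  have m1 := memLp_inversionExt κ h.memLp_fst
  have m2 := memLp_inversionExtDeriv κ h.memLp_snd hg
  have i1 : Integrable (inversionExt κ v) := m1.integrable_of_eq_zero fun x hx => by
    rw [inversionExt, indicator_of_notMem (hinv x hx), mul_zero, add_zero]
    rw [indicator_apply_eq_zero]
    exact fun _ => hvR x hx
  have i2 : Integrable (inversionExtDeriv κ g) := m2.integrable_of_eq_zero fun x hx => by
    rw [inversionExtDeriv, hg x hx, h.eq_zero _ (hinv x hx)]
    ring
  refine ⟨i1, m1, i2, m2, fun ξ => ?_⟩
  set ψ : ℝ → ℂ := fun x => Complex.exp (-2 * Real.pi * Complex.I * ξ * x) with hψ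
  have hd : ∀ x : ℝ, HasDerivAt ψ (-2 * Real.pi * Complex.I * ξ * ψ x) x := by
    intro x
    have h1 : HasDerivAt (fun x : ℝ => (-2 * Real.pi * Complex.I * ξ) * (x : ℂ))
        (-2 * Real.pi * Complex.I * ξ * 1) x := (Complex.ofRealCLM.hasDerivAt).const_mul _
    have := h1.cexp
    convert this using 1
    rw [hψ]
    ring
  have hψc : Continuous ψ := by rw [hψ]; fun_prop
  have hn : ∀ x, ‖ψ x‖ ≤ 1 := fun x => by
    have : (-2 * Real.pi * Complex.I * ξ * x : ℂ) = ((-2 * Real.pi * ξ * x : ℝ) : ℂ) * Complex.I := by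
      push_cast; ring
    rw [hψ]
    simp only
    rw [this, Complex.norm_exp_ofReal_mul_I]
  have j1 : Integrable fun x => inversionExtDeriv κ g x * ψ x :=
    i2.mul_bdd (c := 1) hψc.aestronglyMeasurable (Eventually.of_forall hn)
  have j2 : Integrable fun x => inversionExt κ v x * ψ x :=
    i1.mul_bdd (c := 1) hψc.aestronglyMeasurable (Eventually.of_forall hn)
  have j3 : Integrable fun x => inversionExt κ v x * (-2 * Real.pi * Complex.I * ξ * ψ x) := by
    refine (j2.const_mul (-2 * Real.pi * Complex.I * ξ)).congr (Eventually.of_forall fun x => ?_)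
    simp only
    ring
  have hF : ∀ F : ℝ → ℂ, 𝓕 F ξ = ∫ x, F x * ψ x := fun F => by
    rw [Real.fourier_real_eq_integral_exp_smul]
    refine integral_congr_ae (Eventually.of_forall fun x => ?_)
    simp only [smul_eq_mul]
    rw [mul_comm]
    congr 2
    push_cast
    ring
  have e := h.integral_inversionExt hR hg (h.eq_zero_of_le_abs hR hvR) κ hd
    (continuous_const.mul hψc) (j1.add j3)
  rw [integral_add j1 j3] at e
  have e0 : (1 - κ) * (c (-1) * ψ (-1) - c 1 * ψ 1) = 0 := by
    rcases hκ with rfl | ⟨a, b⟩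
    · ring
    · rw [a, b]; ring
  have e3 : ∫ x, inversionExt κ v x * (-2 * Real.pi * Complex.I * ξ * ψ x) =
      -2 * Real.pi * Complex.I * ξ * ∫ x, inversionExt κ v x * ψ x := by
    rw [← integral_const_mul]
    refine integral_congr_ae (Eventually.of_forall fun x => ?_)
    simp only
    ring
  rw [e0, e3] at e
  rw [hF, hF]
  linear_combination e

end W12Data

end

/-! ### The Dirichlet-to-Neumann formula as a Hilbert transform on the line. -/

lemma one_lt_sq_of_mem_freeSurface {s : ℝ} (hs : s ∈ freeSurface) : 1 < s ^ 2 := by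
  have h : 1 < |s| := hs
  rw [← sq_abs]
  nlinarith

lemma eLpNorm_inv_sq_mul_comp_inv_le (F : ℝ → ℂ) :
    eLpNorm (fun s : ℝ => ((s : ℂ) ^ 2)⁻¹ * F s⁻¹) 2 (volume.restrict freeSurface) ≤
      eLpNorm F 2 volume := by
  rw [← ENNReal.pow_le_pow_left_iff two_ne_zero, eLpNorm_two_sq_eq_lintegral,
    eLpNorm_two_sq_eq_lintegral]
  refine le_trans ?_ (setLIntegral_le_lintegral freeSurfaceᶜ _)
  rw [setLIntegral_compl_freeSurface]
  refine setLIntegral_mono' measurableSet_freeSurface fun t ht => ?_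
  have h1 := one_lt_sq_of_mem_freeSurface ht
  have e : ‖((t : ℂ) ^ 2)⁻¹‖ₑ = ENNReal.ofReal (t ^ 2)⁻¹ := by
    rw [← Complex.ofReal_pow, ← Complex.ofReal_inv, ← ofReal_norm, Complex.norm_real,
      Real.norm_of_nonneg (by positivity)]
  rw [enorm_mul, mul_pow, e]
  refine mul_le_mul_left ?_ _
  rw [sq]
  refine mul_le_of_le_one_left bot_le (ENNReal.ofReal_le_one.2 ?_)
  exact inv_le_one_of_one_le₀ h1.le

lemma memLp_inv_sq_mul_comp_inv {F : ℝ → ℂ} (hF : MemLp F 2) :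
    MemLp (fun s : ℝ => ((s : ℂ) ^ 2)⁻¹ * F s⁻¹) 2 (volume.restrict freeSurface) := by
  refine ⟨AEStronglyMeasurable.restrict ?_, (eLpNorm_inv_sq_mul_comp_inv_le F).trans_lt hF.2⟩
  exact (by fun_prop : Measurable fun s : ℝ => ((s : ℂ) ^ 2)⁻¹).aestronglyMeasurable.mul
      (hF.1.comp_quasiMeasurePreserving quasiMeasurePreserving_real_inv)

/-- Away from the support the truncation is eventually inactive. This covers the points `1 / x` with
`x` in the free surface, near which the extended derivative vanishes. -/
lemma tendsto_truncHilbert_of_eq_zero {f : ℝ → ℂ} {x ρ : ℝ} (hρ : 0 < ρ)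
    (hf : ∀ t, |x - t| < ρ → f t = 0) :
    Tendsto (truncHilbert f x) (𝓝[>] 0)
      (𝓝 ((1 / Real.pi : ℝ) * ∫ t, f t / ((x - t : ℝ) : ℂ))) := by
  refine tendsto_const_nhds.congr' ?_
  filter_upwards [Ioo_mem_nhdsGT hρ] with ε hε
  rw [truncHilbert, setIntegral_eq_integral_of_forall_compl_eq_zero fun t ht => ?_]
  rw [hf t ((not_le.1 ht).trans hε.2), zero_div]

lemma hilbertTransform_of_eq_zero {f : ℝ → ℂ} {x ρ : ℝ} (hρ : 0 < ρ)
    (hf : ∀ t, |x - t| < ρ → f t = 0) :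
    hilbertTransform f x = (1 / Real.pi : ℝ) * ∫ t, f t / ((x - t : ℝ) : ℂ) :=
  (tendsto_truncHilbert_of_eq_zero hρ hf).limUnder_eq

lemma one_sub_inv_le_abs_inv_sub {x t : ℝ} (ht : t ∈ freeSurface) :
    1 - |x|⁻¹ ≤ |x⁻¹ - t| := by
  have h1 : 1 < |t| := ht
  have := abs_sub_abs_le_abs_sub t x⁻¹
  rw [abs_inv, abs_sub_comm] at this
  linarith

lemma one_sub_inv_pos {x : ℝ} (hx : x ∈ freeSurface) : 0 < 1 - |x|⁻¹ := by
  have h1 : 1 < |x| := hx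
  rw [sub_pos]
  exact inv_lt_one_of_one_lt₀ h1

lemma eq_zero_of_abs_inv_sub_lt {g : ℝ → ℂ} (hg : ∀ x ∉ freeSurface, g x = 0) {x : ℝ} :
    ∀ t, |x⁻¹ - t| < 1 - |x|⁻¹ → g t = 0 := fun t ht =>
  hg t fun h => absurd (one_sub_inv_le_abs_inv_sub h) (not_le.2 ht)

/-- The Dirichlet-to-Neumann operator in terms of the derivative and the continuous
representative. -/
noncomputable def neumannData (g c : ℝ → ℂ) (x : ℝ) : ℂ :=
  hilbertTransform g x + (1 / (x : ℂ) ^ 2) * hilbertTransform g (1 / x) +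
    (c 1 - c (-1)) / (Real.pi * x)

namespace W12Data

variable {v g c : ℝ → ℂ}

lemma integral_snd (h : W12Data v g c) {R : ℝ} (hR : 1 ≤ R)
    (hg : ∀ x, R ≤ |x| → g x = 0) (hcR : ∀ x, R ≤ |x| → c x = 0) :
    ∫ x, g x = c (-1) - c 1 := by
  have := (h.setIntegral_freeSurface hR hg hcR (ψ := fun _ => 1) (ψ' := fun _ => 0)
    (fun x _ => hasDerivAt_const x 1) continuousOn_const).2
  simp only [mul_one, mul_zero, add_zero] at this
  rw [← this, setIntegral_eq_integral_of_forall_compl_eq_zero h.eq_zero]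

/-- For the inverted part `k`, the substitution `t ↦ 1 / t` produces `-t / (x * t - 1)`, which
splits into `-1 / x` and `x⁻² / (x⁻¹ - t)`. The second term is the Hilbert transform at `1 / x`; the
first leaves `-x⁻¹` times the integral of `g`, that is, `(c 1 - c (-1)) / x`. -/
lemma hilbertTransform_inversionExtDeriv (h : W12Data v g c) {R : ℝ} (hR : 1 ≤ R)
    (hg : ∀ x, R ≤ |x| → g x = 0) (hvR : ∀ x, R ≤ |x| → v x = 0) :
    ∀ᵐ x, x ∈ freeSurface → hilbertTransform (inversionExtDeriv 1 g) x = neumannData g c x := by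
  set k : ℝ → ℂ := fun s => -(((s : ℂ) ^ 2)⁻¹ * g s⁻¹) with hk
  have hfk : inversionExtDeriv 1 g = g + k := by
    funext s
    rw [inversionExtDeriv, Pi.add_apply, hk, one_mul, sub_eq_add_neg]
  have hkL : MemLp k 2 := by
    have := (memLp_inversionExtDeriv 1 h.memLp_snd hg).sub h.memLp_snd
    rwa [hfk, add_sub_cancel_left] at this
  have hgi : Integrable g := h.memLp_snd.integrable_of_eq_zero hg
  rw [hfk]
  filter_upwards [hilbertTransform_add h.memLp_snd hkL] with x hx hxE
  rw [hx, Pi.add_apply, neumannData, add_assoc]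
  congr 1
  have hx0 : x ≠ 0 := ne_zero_of_mem_freeSurface hxE
  have hxc : (x : ℂ) ≠ 0 := Complex.ofReal_ne_zero.2 hx0
  have h1x : 1 < |x| := hxE
  have hpos := one_sub_inv_pos hxE
  have e1 : hilbertTransform g (1 / x) = (1 / Real.pi : ℝ) * ∫ t, g t / ((x⁻¹ - t : ℝ) : ℂ) := by
    rw [one_div x]
    exact hilbertTransform_of_eq_zero hpos (eq_zero_of_abs_inv_sub_lt h.eq_zero)
  have e2 : hilbertTransform k x = (1 / Real.pi : ℝ) * ∫ t, k t / ((x - t : ℝ) : ℂ) := by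
    refine hilbertTransform_of_eq_zero (ρ := |x| - 1) (by linarith) fun t ht => ?_
    have : t ∈ freeSurface := by
      change 1 < |t|
      have := abs_sub_abs_le_abs_sub x t
      linarith
    rw [hk]
    simp only
    rw [h.eq_zero _ (inv_notMem_freeSurface this), mul_zero, neg_zero]
  have i2 : Integrable fun t => g t / ((x⁻¹ - t : ℝ) : ℂ) := by
    refine (hgi.norm.const_mul (1 - |x|⁻¹)⁻¹).mono' ?_ (Eventually.of_forall fun t => ?_)
    · simp only [div_eq_mul_inv]
      exact hgi.1.mul
        (by fun_prop : Measurable fun t : ℝ => (((x⁻¹ - t : ℝ) : ℂ))⁻¹).aestronglyMeasurable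
    · by_cases ht : t ∈ freeSurface
      · rw [norm_div, Complex.norm_real, Real.norm_eq_abs, div_eq_inv_mul]
        exact mul_le_mul_of_nonneg_right
          (inv_anti₀ hpos (one_sub_inv_le_abs_inv_sub ht)) (norm_nonneg _)
      · rw [h.eq_zero t ht, zero_div, norm_zero, mul_zero]
  have i1 : Integrable fun t => -((x : ℂ)⁻¹ * g t) := (hgi.const_mul _).neg
  have e3 : ∫ t, k t / ((x - t : ℝ) : ℂ) =
      -((x : ℂ)⁻¹ * ∫ t, g t) + ((x : ℂ) ^ 2)⁻¹ * ∫ t, g t / ((x⁻¹ - t : ℝ) : ℂ) := by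
    rw [integral_comp_inv, ← integral_const_mul, ← integral_const_mul, ← integral_neg,
      ← integral_add i1 (i2.const_mul _)]
    refine integral_congr_ae (Eventually.of_forall fun t => ?_)
    simp only [hk, inv_inv]
    by_cases ht : t ∈ freeSurface
    · have ht0 : (t : ℂ) ≠ 0 := Complex.ofReal_ne_zero.2 (ne_zero_of_mem_freeSurface ht)
      have hne : x * t - 1 ≠ 0 := by
        intro h0
        have : t = x⁻¹ := by field_simp; linarith
        exact inv_notMem_freeSurface hxE (this ▸ ht)
      have hnc : (x : ℂ) * t - 1 ≠ 0 := by exact_mod_cast hne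
      have hnc' : (t : ℂ) * x - 1 ≠ 0 := by rwa [mul_comm]
      have d1 : (((x - t⁻¹ : ℝ) : ℂ)) = (x * t - 1) / t := by
        push_cast; field_simp
      have d2 : (((x⁻¹ - t : ℝ) : ℂ)) = -((x * t - 1) / x) := by
        push_cast; field_simp; ring
      rw [d1, d2, Complex.real_smul]
      push_cast
      field_simp
      ring
    · rw [h.eq_zero t ht]
      simp
  have e4 : ∫ t, g t = c (-1) - c 1 := h.integral_snd hR hg (h.eq_zero_of_le_abs hR hvR)
  have hpi : (Real.pi : ℂ) ≠ 0 := Complex.ofReal_ne_zero.2 Real.pi_ne_zero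
  rw [e1, e2, e3, e4]
  push_cast
  field_simp
  ring

end W12Data

lemma w12Data_of_contDiff {φ : ℝ → ℝ} (h1 : ContDiff ℝ (⊤ : ℕ∞) φ) (h2 : HasCompactSupport φ)
    (h3 : tsupport φ ⊆ freeSurface) :
    W12Data (fun x => (φ x : ℂ)) (fun x => ((deriv φ x : ℝ) : ℂ)) (fun x => (φ x : ℂ)) := by
  have hc : Continuous fun x => (φ x : ℂ) := Complex.continuous_ofReal.comp h1.continuous
  have hd : Continuous (deriv φ) := h1.continuous_deriv (by simp)
  have hdc : Continuous fun x => ((deriv φ x : ℝ) : ℂ) := Complex.continuous_ofReal.comp hd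
  have hftc : ∀ a b, ∫ x in a..b, ((deriv φ x : ℝ) : ℂ) = (φ b : ℂ) - (φ a : ℂ) := fun a b => by
    rw [intervalIntegral.integral_ofReal, intervalIntegral.integral_deriv_eq_sub
      (fun x _ => (h1.differentiable (by simp)).differentiableAt) (hd.intervalIntegrable a b)]
    push_cast
    rfl
  refine ⟨(hc.memLp_of_hasCompactSupport (h2.comp_left Complex.ofReal_zero)).restrict _,
    hdc.memLp_of_hasCompactSupport (h2.deriv.comp_left Complex.ofReal_zero), fun x hx => ?_,
    EventuallyEq.rfl, fun a b _ _ => hftc a b, fun a b _ _ => hftc a b⟩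
  rw [Complex.ofReal_eq_zero]
  exact image_eq_zero_of_notMem_tsupport fun h => hx (h3 (tsupport_deriv_subset h))

namespace W12Data

variable {v g c : ℝ → ℂ}

/-- Proved by duality: the Hilbert transform is paired with the odd extension of a test function `φ`
on the free surface. Even and odd functions are orthogonal for the energy, so this pairing vanishes,
and folding it onto the free surface gives the claim tested against `φ`. -/
lemma hilbertTransform_inversionExtDeriv_inv (h : W12Data v g c) {R : ℝ} (hR : 1 ≤ R)
    (hg : ∀ x, R ≤ |x| → g x = 0) (hvR : ∀ x, R ≤ |x| → v x = 0) :
    ∀ᵐ x : ℝ, x ∈ freeSurface → hilbertTransform (inversionExtDeriv 1 g) x =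
      ((x : ℂ) ^ 2)⁻¹ * hilbertTransform (inversionExtDeriv 1 g) x⁻¹ := by
  set H := hilbertTransform (inversionExtDeriv 1 g) with hH
  have hHL : MemLp H 2 := memLp_hilbertTransform (memLp_inversionExtDeriv 1 h.memLp_snd hg)
  have hL1 : LocallyIntegrableOn H freeSurface :=
    (hHL.locallyIntegrable (by norm_num)).locallyIntegrableOn _
  have hL2 : LocallyIntegrableOn (fun x : ℝ => ((x : ℂ) ^ 2)⁻¹ * H x⁻¹) freeSurface := by
    refine (locallyIntegrableOn_of_locallyIntegrable_restrict ?_)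
    exact (memLp_inv_sq_mul_comp_inv hHL).locallyIntegrable (by norm_num)
  have key := isOpen_freeSurface.ae_eq_zero_of_integral_contDiff_smul_eq_zero (μ := volume)
    (f := H - fun x : ℝ => ((x : ℂ) ^ 2)⁻¹ * H x⁻¹) (hL1.sub hL2) fun φ h1 h2 h3 => ?_
  · filter_upwards [key] with x hx hxE
    exact sub_eq_zero.1 (hx hxE)
  · have hφ := w12Data_of_contDiff h1 h2 h3
    obtain ⟨r, hr⟩ := h2.isCompact.isBounded.subset_closedBall 0
    have hz : ∀ x, max R (r + 1) ≤ |x| → x ∉ tsupport φ := fun x hx hx' => by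
      have := hr hx'
      rw [mem_closedBall_zero_iff, Real.norm_eq_abs] at this
      linarith [le_max_right R (r + 1)]
    have hns : ∀ a : ℝ, |a| = 1 → φ a = 0 := fun a ha =>
      image_eq_zero_of_notMem_tsupport fun h' => by
        have : 1 < |a| := h3 h'
        linarith
    -- The odd extension is admissible because a test function supported in the open free surface
    -- vanishes at `1` and `-1`.
    have p := hφ.derivPair (κ := -1) (hR.trans (le_max_left R (r + 1)))
      (fun x hx => by
        rw [Complex.ofReal_eq_zero]
        exact image_eq_zero_of_notMem_tsupport fun h => hz x hx (tsupport_deriv_subset h))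
      (fun x hx => by
        rw [Complex.ofReal_eq_zero]
        exact image_eq_zero_of_notMem_tsupport (hz x hx))
      (Or.inr ⟨by rw [hns 1 (by simp), Complex.ofReal_zero],
        by rw [hns (-1) (by simp), Complex.ofReal_zero]⟩)
    have q := h.derivPair (κ := 1) hR hg hvR (Or.inl rfl)
    have e := q.integral_hilbertTransform_mul_conj_eq_zero p
      (Eventually.of_forall fun t => inversionExt_one_inv v t)
      (Eventually.of_forall fun t => inversionExt_neg_one_inv _ t)
    have hint : Integrable fun t => H t * conj (inversionExt (-1) (fun x => (φ x : ℂ)) t) :=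
      hHL.integrable_mul p.memLp_fst.star
    rw [← hH, setIntegral_add_compl_freeSurface hint] at e
    have e1 : ∫ t in freeSurface, H t * conj (inversionExt (-1) (fun x => (φ x : ℂ)) t) =
        ∫ t in freeSurface, φ t • H t := by
      refine setIntegral_congr_fun measurableSet_freeSurface fun t ht => ?_
      rw [inversionExt_of_mem _ _ ht, Complex.conj_ofReal, Complex.real_smul, mul_comm]
    have e2 : ∫ t in freeSurface, (t ^ 2)⁻¹ • (H t⁻¹ *
        conj (inversionExt (-1) (fun x => (φ x : ℂ)) t⁻¹)) =
        -∫ t in freeSurface, φ t • (((t : ℂ) ^ 2)⁻¹ * H t⁻¹) := by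
      rw [← integral_neg]
      refine setIntegral_congr_fun measurableSet_freeSurface fun t ht => ?_
      rw [inversionExt_inv_of_mem _ _ ht, map_mul, Complex.conj_ofReal, Complex.real_smul,
        Complex.real_smul]
      push_cast
      simp only [map_neg, map_one]
      ring
    rw [e1, e2, setIntegral_smul_of_tsupport_subset h3, setIntegral_smul_of_tsupport_subset h3] at e
    simp only [Pi.sub_apply, smul_sub]
    rw [integral_sub (hL1.integrable_smul_of_tsupport_subset h1.continuous h2 h3)
      (hL2.integrable_smul_of_tsupport_subset h1.continuous h2 h3)]
    rw [sub_eq_add_neg]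
    exact e

/-- The energy identity for compactly supported functions. -/
lemma integral_neumannData_mul_conj (h : W12Data v g c) {R : ℝ} (hR : 1 ≤ R)
    (hg : ∀ x, R ≤ |x| → g x = 0) (hvR : ∀ x, R ≤ |x| → v x = 0) :
    (∫⁻ z in {z : ℂ | 1 < ‖z‖ ∧ 0 < z.im}, energyDensity (inversionExt 1 v) z) ≠ ∞ ∧
    ∫ x in freeSurface, neumannData g c x * conj (v x) =
      ((∫⁻ z in {z : ℂ | 1 < ‖z‖ ∧ 0 < z.im}, energyDensity (inversionExt 1 v) z).toReal : ℂ) := by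
  have q := h.derivPair (κ := 1) hR hg hvR (Or.inl rfl)
  obtain ⟨hne, hE⟩ := q.energy
  rw [lintegral_energyDensity_upper_of_inv_invariant
    (Eventually.of_forall fun t => inversionExt_one_inv v t)] at hne hE
  set J := ∫⁻ z in {z : ℂ | 1 < ‖z‖ ∧ 0 < z.im}, energyDensity (inversionExt 1 v) z
  refine ⟨fun hJ => hne (by rw [hJ]; exact ENNReal.mul_top two_ne_zero), ?_⟩
  set H := hilbertTransform (inversionExtDeriv 1 g) with hH
  have hHL : MemLp H 2 := memLp_hilbertTransform q.memLp_snd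
  have hint : Integrable fun t => H t * conj (inversionExt 1 v t) :=
    hHL.integrable_mul q.memLp_fst.star
  rw [setIntegral_add_compl_freeSurface hint, ENNReal.toReal_mul] at hE
  have e1 : ∫ t in freeSurface, H t * conj (inversionExt 1 v t) =
      ∫ x in freeSurface, neumannData g c x * conj (v x) := by
    refine setIntegral_congr_ae measurableSet_freeSurface ?_
    filter_upwards [h.hilbertTransform_inversionExtDeriv hR hg hvR] with t h1 ht
    rw [inversionExt_of_mem _ _ ht, hH, h1 ht]
  -- The inversion symmetry of `H` absorbs the Jacobian, so `[-1, 1]` contributes as much to the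
  -- pairing as the free surface. The resulting factor `2` cancels the one relating the half-plane
  -- energy to the exterior energy.
  have e2 : ∫ t in freeSurface, (t ^ 2)⁻¹ • (H t⁻¹ * conj (inversionExt 1 v t⁻¹)) =
      ∫ x in freeSurface, neumannData g c x * conj (v x) := by
    rw [← e1]
    refine setIntegral_congr_ae measurableSet_freeSurface ?_
    filter_upwards [h.hilbertTransform_inversionExtDeriv_inv hR hg hvR] with t h1 ht
    rw [inversionExt_one_inv, hH, h1 ht, Complex.real_smul]
    push_cast
    ring
  rw [e1, e2] at hE
  simp only [ENNReal.toReal_ofNat] at hE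
  push_cast at hE
  linear_combination (1 / 2 : ℂ) * hE

end W12Data

/-! ### `L²` bounds and linearity of the Neumann data. -/

lemma eLpNorm_ofReal_inv_freeSurface :
    eLpNorm (fun x : ℝ => (x : ℂ)⁻¹) 2 (volume.restrict freeSurface) ≠ ∞ := by
  have h : eLpNorm (fun x : ℝ => (x : ℂ)⁻¹) 2 (volume.restrict freeSurface) ^ 2 =
      volume freeSurfaceᶜ := by
    have := setLIntegral_compl_freeSurface fun _ => 1
    rw [setLIntegral_one] at this
    rw [this, eLpNorm_two_sq_eq_lintegral]
    refine lintegral_congr fun t => ?_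
    rw [mul_one, ← Complex.ofReal_inv, ← ofReal_norm, Complex.norm_real, ← ENNReal.ofReal_pow
      (norm_nonneg _), Real.norm_eq_abs, sq_abs, inv_pow]
  have h2 : freeSurfaceᶜ ⊆ Metric.closedBall (0 : ℝ) 1 := fun x hx => by
    rw [mem_closedBall_zero_iff, Real.norm_eq_abs]
    exact not_lt.1 hx
  intro h'
  rw [h'] at h
  have := (measure_mono (μ := volume) h2).trans_lt (isCompact_closedBall (0 : ℝ) 1).measure_lt_top
  rw [← h] at this
  simp at this

namespace W12Data

variable {v g c v' g' c' : ℝ → ℂ}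

/-- A trace estimate: `|c a| ≤ |c x| + ∫ |g|` is averaged over `x` in an interval of length one, on
which `L¹` norms are at most `L²` norms. -/
lemma enorm_le_of_interval (h : W12Data v g c) {a : ℝ} {S : Set ℝ} (hS : MeasurableSet S)
    (hSE : S ⊆ freeSurface) (hS1 : volume S = 1)
    (hc : ∀ x ∈ S, ‖c a - c x‖ₑ ≤ ∫⁻ t in S, ‖g t‖ₑ) :
    ‖c a‖ₑ ≤ eLpNorm v 2 (volume.restrict freeSurface) + eLpNorm g 2 volume := by
  have : IsProbabilityMeasure (volume.restrict S) :=
    ⟨by rw [Measure.restrict_apply_univ, hS1]⟩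
  have hg1 : ∫⁻ t in S, ‖g t‖ₑ ≤ eLpNorm g 2 volume := by
    rw [← eLpNorm_one_eq_lintegral_enorm]
    exact (eLpNorm_le_eLpNorm_of_exponent_le one_le_two h.memLp_snd.1.restrict).trans
      (eLpNorm_mono_measure _ Measure.restrict_le_self)
  have hv1 : ∫⁻ t in S, ‖v t‖ₑ ≤ eLpNorm v 2 (volume.restrict freeSurface) := by
    rw [← eLpNorm_one_eq_lintegral_enorm]
    exact (eLpNorm_le_eLpNorm_of_exponent_le one_le_two (h.memLp_fst.1.mono_measure
      (Measure.restrict_mono_set _ hSE))).trans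
      (eLpNorm_mono_measure _ (Measure.restrict_mono_set _ hSE))
  have e : ‖c a‖ₑ = ∫⁻ _ in S, ‖c a‖ₑ := by rw [setLIntegral_const, hS1, mul_one]
  rw [e]
  calc ∫⁻ _ in S, ‖c a‖ₑ ≤ ∫⁻ x in S, (‖v x‖ₑ + ∫⁻ t in S, ‖g t‖ₑ) := by
        refine lintegral_mono_ae ?_
        filter_upwards [ae_restrict_of_ae_restrict_of_subset hSE h.ae_eq, ae_restrict_mem hS]
          with x h1 h2
        rw [h1]
        calc ‖c a‖ₑ = ‖c x + (c a - c x)‖ₑ := by rw [add_sub_cancel]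
          _ ≤ ‖c x‖ₑ + ‖c a - c x‖ₑ := enorm_add_le _ _
          _ ≤ _ := by gcongr; exact hc x h2
    _ = (∫⁻ x in S, ‖v x‖ₑ) + ∫⁻ t in S, ‖g t‖ₑ := by
        rw [lintegral_add_right _ measurable_const, setLIntegral_const, hS1, mul_one]
    _ ≤ _ := add_le_add hv1 hg1

lemma enorm_one_le (h : W12Data v g c) :
    ‖c 1‖ₑ ≤ eLpNorm v 2 (volume.restrict freeSurface) + eLpNorm g 2 volume := by
  refine h.enorm_le_of_interval (S := Ioc 1 2) measurableSet_Ioc (fun x hx => ?_) ?_ fun x hx => ?_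
  · rw [freeSurface_eq]; exact Or.inr hx.1
  · rw [Real.volume_Ioc]; norm_num
  · rw [← h.ftc_pos x 1 (by linarith [hx.1]) one_pos, intervalIntegral.integral_of_ge hx.1.le,
      enorm_neg]
    exact (enorm_integral_le_lintegral_enorm _).trans
      (lintegral_mono_set (Ioc_subset_Ioc le_rfl hx.2))

lemma enorm_neg_one_le (h : W12Data v g c) :
    ‖c (-1)‖ₑ ≤ eLpNorm v 2 (volume.restrict freeSurface) + eLpNorm g 2 volume := by
  refine h.enorm_le_of_interval (S := Ioo (-2) (-1)) measurableSet_Ioo (fun x hx => ?_) ?_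
    fun x hx => ?_
  · rw [freeSurface_eq]; exact Or.inl hx.2
  · rw [Real.volume_Ioo]; norm_num
  · rw [← h.ftc_neg x (-1) (by linarith [hx.2]) (by norm_num), intervalIntegral.integral_of_le hx.2.le,
      integral_Ioc_eq_integral_Ioo]
    exact (enorm_integral_le_lintegral_enorm _).trans
      (lintegral_mono_set (Ioo_subset_Ioo hx.1.le le_rfl))

end W12Data

/-- A bound for the `L²` norm of `neumannData`. -/
noncomputable def neumannConst : ℝ≥0∞ :=
  2 + 2 * eLpNorm (fun x : ℝ => (x : ℂ)⁻¹) 2 (volume.restrict freeSurface)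

lemma neumannConst_ne_top : neumannConst ≠ ∞ :=
  ENNReal.add_ne_top.2 ⟨by simp, ENNReal.mul_ne_top (by simp) eLpNorm_ofReal_inv_freeSurface⟩

namespace W12Data

variable {v g c v' g' c' : ℝ → ℂ}

lemma neumannData_eq (g c : ℝ → ℂ) : neumannData g c =
    (hilbertTransform g + fun x : ℝ => ((x : ℂ) ^ 2)⁻¹ * hilbertTransform g x⁻¹) +
      ((c 1 - c (-1)) / Real.pi) • fun x : ℝ => (x : ℂ)⁻¹ := by
  funext x
  simp only [neumannData, one_div, Pi.add_apply, Pi.smul_apply, smul_eq_mul]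
  rw [div_mul_eq_div_div, div_eq_mul_inv (_ / _)]

lemma memLp_neumannData (h : W12Data v g c) :
    MemLp (neumannData g c) 2 (volume.restrict freeSurface) := by
  rw [neumannData_eq]
  refine (((memLp_hilbertTransform h.memLp_snd).restrict _).add
    (memLp_inv_sq_mul_comp_inv (memLp_hilbertTransform h.memLp_snd))).add (MemLp.const_smul ?_ _)
  exact ⟨(by fun_prop : Measurable fun x : ℝ => (x : ℂ)⁻¹).aestronglyMeasurable,
    lt_top_iff_ne_top.2 eLpNorm_ofReal_inv_freeSurface⟩

/-- Each of the two Hilbert transform terms costs one `N`, because the transform is a contraction on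
`L²` and the inversion with weight `x⁻²` does not increase the norm on the free surface. The
boundary term costs `2 * N` by the trace estimates at `1` and `-1`, times the `L²` norm of `1 / x`.
-/
lemma eLpNorm_neumannData_le (h : W12Data v g c) :
    eLpNorm (neumannData g c) 2 (volume.restrict freeSurface) ≤
      neumannConst * (eLpNorm v 2 (volume.restrict freeSurface) + eLpNorm g 2 volume) := by
  have m1 := memLp_hilbertTransform h.memLp_snd
  have m2 := memLp_inv_sq_mul_comp_inv m1
  have b1 := (exists_hilbertTransform_ae_eq h.memLp_snd).2.1
  have m3 : AEStronglyMeasurable (fun x : ℝ => (x : ℂ)⁻¹) (volume.restrict freeSurface) :=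
    (by fun_prop : Measurable fun x : ℝ => (x : ℂ)⁻¹).aestronglyMeasurable
  set N := eLpNorm v 2 (volume.restrict freeSurface) + eLpNorm g 2 volume with hN
  have hgN : eLpNorm g 2 volume ≤ N := le_add_left le_rfl
  have hcN : ‖(c 1 - c (-1)) / Real.pi‖ₑ ≤ 2 * N := by
    have : ‖(c 1 - c (-1)) / (Real.pi : ℂ)‖ₑ ≤ ‖c 1 - c (-1)‖ₑ := by
      rw [enorm_le_iff_norm_le, norm_div, Complex.norm_real, Real.norm_of_nonneg Real.pi_pos.le]
      exact div_le_self (norm_nonneg _) (by linarith [Real.pi_gt_three])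
    refine this.trans (enorm_sub_le.trans ?_)
    rw [two_mul]
    exact add_le_add h.enorm_one_le h.enorm_neg_one_le
  rw [neumannData_eq]
  refine (eLpNorm_add_le (m1.restrict _ |>.add m2).1 (m3.const_smul _) one_le_two).trans ?_
  refine (add_le_add_left (eLpNorm_add_le m1.1.restrict m2.1 one_le_two) _).trans ?_
  rw [eLpNorm_const_smul]
  calc _ ≤ (N + N) + (2 * N) * eLpNorm (fun x : ℝ => (x : ℂ)⁻¹) 2 (volume.restrict freeSurface) := by
        gcongr
        · exact (eLpNorm_mono_measure _ Measure.restrict_le_self).trans (b1.trans hgN)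
        · exact (eLpNorm_inv_sq_mul_comp_inv_le _).trans (b1.trans hgN)
    _ = _ := by rw [neumannConst]; ring

lemma add_smul (h : W12Data v g c) (h' : W12Data v' g' c') (a : ℂ) :
    W12Data (v + a • v') (g + a • g') (c + a • c') := by
  have hf : ∀ x y : ℝ, ∫ t in x..y, (g + a • g') t =
      (∫ t in x..y, g t) + a * ∫ t in x..y, g' t := fun x y => by
    have := intervalIntegral.integral_add (h.intervalIntegrable x y)
      ((h'.intervalIntegrable x y).const_mul a)
    rw [intervalIntegral.integral_const_mul] at this
    rw [← this]
    rfl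
  refine ⟨h.memLp_fst.add (h'.memLp_fst.const_smul a), h.memLp_snd.add (h'.memLp_snd.const_smul a),
    fun x hx => ?_, h.ae_eq.add (h'.ae_eq.const_smul a), fun x y hx hy => ?_, fun x y hx hy => ?_⟩
  · simp [h.eq_zero x hx, h'.eq_zero x hx]
  · rw [hf, h.ftc_pos x y hx hy, h'.ftc_pos x y hx hy]
    simp only [Pi.add_apply, Pi.smul_apply, smul_eq_mul]
    ring
  · rw [hf, h.ftc_neg x y hx hy, h'.ftc_neg x y hx hy]
    simp only [Pi.add_apply, Pi.smul_apply, smul_eq_mul]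
    ring

lemma neumannData_add_smul (h : W12Data v g c) (h' : W12Data v' g' c') (a : ℂ) :
    neumannData (g + a • g') (c + a • c') =ᵐ[volume.restrict freeSurface]
      neumannData g c + a • neumannData g' c' := by
  refine ae_restrict_of_ae ?_
  have e : hilbertTransform (g + a • g') =ᵐ[volume] hilbertTransform g + a • hilbertTransform g' := by
    filter_upwards [hilbertTransform_add h.memLp_snd (h'.memLp_snd.const_smul a),
      hilbertTransform_const_smul a h'.memLp_snd] with x e1 e2
    rw [e1, Pi.add_apply, e2, Pi.add_apply]
  filter_upwards [e, quasiMeasurePreserving_real_inv.ae e] with x e1 e2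
  simp only [neumannData, Pi.add_apply, Pi.smul_apply, smul_eq_mul, one_div] at e1 e2 ⊢
  rw [e1, e2]
  ring

lemma dirichletNeumann_eq (h : W12Data v g c) (hg : zeroExtDeriv v =ᵐ[volume] g) :
    dirichletNeumann v = neumannData g c := by
  funext x
  rw [dirichletNeumann, neumannData, hilbertTransform_congr_ae hg,
    h.eqOn_contRep one_mem_closure_freeSurface, h.eqOn_contRep neg_one_mem_closure_freeSurface]

end W12Data

namespace HalfPlaneDisk.MemW12

variable {v : ℝ → ℂ}

lemma exists_w12Data (h : MemW12 v) : ∃ c, W12Data v (zeroExtDeriv v) c := by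
  obtain ⟨hv, w, hw, hw2⟩ := h
  exact exists_w12Data_of_hasWeakDeriv hv hw.hasWeakDeriv_weakDeriv
    (hw2.ae_eq (hw.weakDeriv_ae_eq isOpen_freeSurface).symm)

lemma ae_hilbertExistsAt (h : MemW12 v) : ∀ᵐ x ∂(volume.restrict freeSurface),
    HilbertExistsAt (zeroExtDeriv v) x ∧ HilbertExistsAt (zeroExtDeriv v) (1 / x) := by
  obtain ⟨c, hc⟩ := h.exists_w12Data
  filter_upwards [ae_restrict_of_ae (ae_tendsto_hilbertTransform hc.memLp_snd),
    ae_restrict_mem measurableSet_freeSurface] with x h1 hx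
  refine ⟨⟨_, h1⟩, ?_⟩
  rw [one_div]
  exact ⟨_, tendsto_truncHilbert_of_eq_zero (one_sub_inv_pos hx)
    (eq_zero_of_abs_inv_sub_lt hc.eq_zero)⟩

lemma eLpNorm_add_le (h : MemW12 v) :
    eLpNorm v 2 (volume.restrict freeSurface) + eLpNorm (zeroExtDeriv v) 2 volume ≤
      ENNReal.ofReal (2 * normW12 v) := by
  obtain ⟨hv, w, hw, hw2⟩ := h
  have hw' := hw2.ae_eq (hw.weakDeriv_ae_eq isOpen_freeSurface).symm
  have key : ∀ {f : ℝ → ℂ}, MemLp f 2 (volume.restrict freeSurface) →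
      eLpNorm f 2 (volume.restrict freeSurface) =
        ENNReal.ofReal (Real.sqrt (∫ x in freeSurface, ‖f x‖ ^ 2)) := by
    intro f hf
    refine (ENNReal.pow_right_strictMono two_ne_zero).injective ?_
    rw [eLpNorm_two_sq_eq_lintegral,
      ← ENNReal.ofReal_pow (Real.sqrt_nonneg _),
      Real.sq_sqrt (integral_nonneg fun x => sq_nonneg _),
      ofReal_integral_eq_lintegral_ofReal ((memLp_two_iff_integrable_sq_norm hf.1).1 hf)
        (Eventually.of_forall fun x => sq_nonneg _)]
    refine lintegral_congr fun x => ?_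
    rw [← ofReal_norm, ENNReal.ofReal_pow (norm_nonneg _)]
  have h1 : 0 ≤ ∫ x in freeSurface, ‖v x‖ ^ 2 := integral_nonneg fun x => sq_nonneg _
  have h2 : 0 ≤ ∫ x in freeSurface, ‖weakDeriv freeSurface v 1 x‖ ^ 2 :=
    integral_nonneg fun x => sq_nonneg _
  rw [zeroExtDeriv, eLpNorm_indicator_eq_eLpNorm_restrict measurableSet_freeSurface, key hv, key hw',
    ← ENNReal.ofReal_add (Real.sqrt_nonneg _) (Real.sqrt_nonneg _), two_mul]
  exact ENNReal.ofReal_le_ofReal (add_le_add (Real.sqrt_le_sqrt (by linarith))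
    (Real.sqrt_le_sqrt (by linarith)))

end HalfPlaneDisk.MemW12

/-! ### Density of functions of bounded support. -/

lemma ENNReal.tendsto_zero_of_sq {α : Type*} {l : Filter α} {u : α → ℝ≥0∞}
    (h : Tendsto (fun n => u n ^ 2) l (𝓝 0)) : Tendsto u l (𝓝 0) := by
  rw [ENNReal.tendsto_nhds_zero] at h ⊢
  intro ε hε
  filter_upwards [h (ε ^ 2) (pos_iff_ne_zero.2 (pow_ne_zero 2 hε.ne'))] with n hn
  exact (ENNReal.pow_le_pow_left_iff two_ne_zero).1 hn

lemma tendsto_eLpNorm_sub_mul_cutoff {f : ℝ → ℂ} {μ : Measure ℝ} (hf : MemLp f 2 μ)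
    {χ : ℕ → ℝ → ℂ} (hm : ∀ n, Continuous (χ n)) (hb : ∀ n x, ‖1 - χ n x‖ ≤ 1)
    (h1 : ∀ (n : ℕ) (x : ℝ), |x| ≤ n → χ n x = 1) :
    Tendsto (fun n => eLpNorm (fun x => f x - f x * χ n x) 2 μ) atTop (𝓝 0) := by
  refine ENNReal.tendsto_zero_of_sq ?_
  simp only [eLpNorm_two_sq_eq_lintegral]
  rw [← lintegral_zero (μ := μ)]
  refine tendsto_lintegral_of_dominated_convergence' (fun x => ‖f x‖ₑ ^ 2) (fun n => ?_) (fun n => ?_)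
    hf.lintegral_enorm_sq_ne_top (Eventually.of_forall fun x => ?_)
  · exact ((hf.1.sub (hf.1.mul (hm n).aestronglyMeasurable)).enorm).pow_const 2
  · refine Eventually.of_forall fun x => ?_
    beta_reduce
    gcongr
    rw [← mul_one_sub, enorm_mul, ← ofReal_norm (1 - χ n x)]
    exact mul_le_of_le_one_right bot_le (ENNReal.ofReal_le_one.2 (hb n x))
  · refine tendsto_const_nhds.congr' ?_
    obtain ⟨N, hN⟩ := exists_nat_ge |x|
    filter_upwards [eventually_ge_atTop N] with n hn
    rw [h1 n x (hN.trans (Nat.cast_le.2 hn)), mul_one, sub_self]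
    simp

/-- Smooth cutoff functions on the line, with derivatives tending to zero uniformly. -/
lemma exists_cutoff : ∃ (χ χ' : ℕ → ℝ → ℂ) (M : ℝ), (∀ n x, HasDerivAt (χ n) (χ' n x) x) ∧
    (∀ n, Continuous (χ' n)) ∧ (∀ n x, ‖χ n x‖ ≤ 1) ∧ (∀ n x, ‖1 - χ n x‖ ≤ 1) ∧
    (∀ (n : ℕ) (x : ℝ), |x| ≤ n → χ n x = 1) ∧ (∀ n (x : ℝ), |x| ≤ 1 → χ' n x = 0) ∧
    (∀ (n : ℕ) x, ‖χ' n x‖ ≤ M / (n + 2)) ∧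
    (∀ (n : ℕ) (x : ℝ), 2 * (n + 2) ≤ |x| → χ n x = 0 ∧ χ' n x = 0) := by
  let f : ContDiffBump (0 : ℝ) := ⟨1, 2, one_pos, one_lt_two⟩
  have hfd : ContDiff ℝ 1 (f : ℝ → ℝ) := f.contDiff
  have hdc : Continuous (deriv f) := hfd.continuous_deriv le_rfl
  have hcs : HasCompactSupport (deriv f) := f.hasCompactSupport.deriv
  obtain ⟨M, hM⟩ := hcs.exists_bound_of_continuous hdc
  have hpos : ∀ n : ℕ, (0 : ℝ) < n + 2 := fun n => by positivity
  have hd0 : ∀ y : ℝ, |y| < 1 → deriv f y = 0 := by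
    intro y hy
    have : (f : ℝ → ℝ) =ᶠ[𝓝 y] fun _ => 1 := by
      filter_upwards [Metric.isOpen_ball.mem_nhds (show y ∈ Metric.ball (0 : ℝ) 1 by
        rwa [mem_ball_zero_iff])] with z hz
      exact f.one_of_mem_closedBall (Metric.ball_subset_closedBall hz)
    rw [this.deriv_eq, deriv_const]
  have hz : ∀ y : ℝ, 2 ≤ |y| → f y = 0 := fun y hy => f.zero_of_le_dist (by
    rw [Real.dist_eq, sub_zero]; exact hy)
  have hz' : ∀ y : ℝ, 2 ≤ |y| → deriv f y = 0 := by
    have hcl : closure (Ioi 2 ∪ Iio (-2)) = {x : ℝ | 2 ≤ |x|} := by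
      rw [closure_union, closure_Ioi, closure_Iio]
      ext x
      rw [mem_union, mem_Ici, mem_Iic, mem_ofPred_eq, le_abs, le_neg]
    have hE : EqOn (deriv f) (fun _ => 0) (Ioi 2 ∪ Iio (-2)) := by
      intro y hy
      have : (f : ℝ → ℝ) =ᶠ[𝓝 y] fun _ => 0 := by
        filter_upwards [(isOpen_Ioi.union isOpen_Iio).mem_nhds hy] with z hz1
        have hz2 : z ∈ {x : ℝ | 2 ≤ |x|} := hcl ▸ subset_closure hz1
        exact hz z hz2
      rw [this.deriv_eq, deriv_const]
    have h1 := hE.of_subset_closure (t := {x : ℝ | 2 ≤ |x|}) hdc.continuousOn continuousOn_const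
      (hcl ▸ subset_closure) hcl.ge
    exact fun y hy => h1 hy
  have habs : ∀ (n : ℕ) (x : ℝ), |x / (n + 2)| = |x| / (n + 2) := fun n x => by
    rw [abs_div, abs_of_pos (hpos n)]
  -- The dilation factor is `n + 2` rather than `n`, so that it is never zero and every cutoff is
  -- already constant on `[-1, 1]`.
  refine ⟨fun n x => (f (x / (n + 2)) : ℂ), fun n x => ((deriv f (x / (n + 2)) / (n + 2) : ℝ) : ℂ), M,
    fun n x => ?_, fun n => ?_, fun n x => ?_, fun n x => ?_, fun n x hx => ?_, fun n x hx => ?_,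
    fun n x => ?_, fun n x hx => ?_⟩
  · have h1 : HasDerivAt (fun x : ℝ => x / ((n : ℝ) + 2)) (1 / (n + 2)) x :=
      (hasDerivAt_id x).div_const _
    have h2 : HasDerivAt f (deriv f (x / (n + 2))) (x / (n + 2)) :=
      (hfd.differentiable one_ne_zero).differentiableAt.hasDerivAt
    have := (h2.comp x h1).ofReal_comp
    refine this.congr_deriv ?_
    push_cast
    ring
  · exact Complex.continuous_ofReal.comp
      ((hdc.comp (continuous_id.div_const _)).div_const _)
  · rw [Complex.norm_real, Real.norm_of_nonneg f.nonneg]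
    exact f.le_one
  · rw [← Complex.ofReal_one, ← Complex.ofReal_sub, Complex.norm_real,
      Real.norm_of_nonneg (sub_nonneg.2 f.le_one)]
    linarith [f.nonneg (x := x / (n + 2))]
  · beta_reduce
    rw [f.one_of_mem_closedBall, Complex.ofReal_one]
    rw [mem_closedBall_zero_iff, Real.norm_eq_abs, habs, div_le_one (hpos n)]
    exact hx.trans (by linarith)
  · beta_reduce
    rw [hd0, zero_div, Complex.ofReal_zero]
    rw [habs, div_lt_one (hpos n)]
    have : (0 : ℝ) ≤ n := n.cast_nonneg
    linarith
  · rw [Complex.norm_real, norm_div, Real.norm_of_nonneg (hpos n).le]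
    gcongr
    exact hM _
  · have : 2 ≤ |x / (n + 2)| := by rwa [habs, le_div_iff₀ (hpos n)]
    beta_reduce
    rw [hz _ this, hz' _ this]
    simp

namespace W12Data

variable {v g c v' g' c' : ℝ → ℂ}

/-- The product rule. As `χ'` vanishes on `[-1, 1]`, the new derivative still vanishes off the free
surface, and `c * χ'` agrees almost everywhere with `v * χ'` there, so the `L²` norm of `v` controls
it although `c` itself need not be square integrable. -/
lemma mul_cutoff (h : W12Data v g c) {χ χ' : ℝ → ℂ} (hχ : ∀ x, HasDerivAt χ (χ' x) x)
    (hc : Continuous χ') (hb : ∀ x, ‖χ x‖ ≤ 1) (h0 : ∀ x, |x| ≤ 1 → χ' x = 0) {M : ℝ}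
    (hM : ∀ x, ‖χ' x‖ ≤ M) :
    W12Data (fun x => v x * χ x) (fun x => g x * χ x + c x * χ' x) (fun x => c x * χ x) ∧
    eLpNorm (fun x => c x * χ' x) 2 volume ≤
      ENNReal.ofReal M * eLpNorm v 2 (volume.restrict freeSurface) := by
  have hχc : Continuous χ := continuous_iff_continuousAt.2 fun x => (hχ x).continuousAt
  have e1 : (fun x => c x * χ' x) =ᵐ[volume] freeSurface.indicator fun x => χ' x * v x := by
    filter_upwards [(ae_restrict_iff' measurableSet_freeSurface).1 h.ae_eq] with x hx
    by_cases hxE : x ∈ freeSurface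
    · rw [indicator_of_mem hxE, hx hxE, mul_comm]
    · rw [indicator_of_notMem hxE, h0 x (not_lt.1 hxE), mul_zero]
  have m1 : MemLp (fun x => χ' x * v x) 2 (volume.restrict freeSurface) :=
    h.memLp_fst.of_le_mul (c := M) (hc.aestronglyMeasurable.mul h.memLp_fst.1)
      (Eventually.of_forall fun x => by
        rw [norm_mul]; exact mul_le_mul_of_nonneg_right (hM x) (norm_nonneg _))
  have m2 : MemLp (fun x => c x * χ' x) 2 :=
    ((memLp_indicator_iff_restrict measurableSet_freeSurface).2 m1).ae_eq e1.symm
  have m3 : ∀ {μ : Measure ℝ} {f : ℝ → ℂ}, MemLp f 2 μ → MemLp (fun x => f x * χ x) 2 μ :=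
    fun hf => hf.of_le (hf.1.mul hχc.aestronglyMeasurable) (Eventually.of_forall fun x => by
      rw [norm_mul]; exact mul_le_of_le_one_right (norm_nonneg _) (hb x))
  have key : ∀ a b : ℝ, a ≤ b → (0 < a ∨ b < 0) →
      ∫ x in a..b, (g x * χ x + c x * χ' x) = c b * χ b - c a * χ a := fun a b hab hab' => by
    rw [intervalIntegral.integral_of_le hab]
    exact (h.setIntegral_Ioc hab hab' (fun x _ => hχ x) hc.continuousOn).2
  refine ⟨⟨m3 h.memLp_fst, (m3 h.memLp_snd).add m2, fun x hx => ?_, ?_, fun a b ha hb => ?_,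
    fun a b ha hb => ?_⟩, ?_⟩
  · rw [h.eq_zero x hx, h0 x (not_lt.1 hx)]
    ring
  · filter_upwards [h.ae_eq] with x hx
    rw [hx]
  · rcases le_total a b with hab | hab
    · exact key a b hab (Or.inl ha)
    · rw [intervalIntegral.integral_symm, key b a hab (Or.inl hb), neg_sub]
  · rcases le_total a b with hab | hab
    · exact key a b hab (Or.inr hb)
    · rw [intervalIntegral.integral_symm, key b a hab (Or.inr ha), neg_sub]
  · rw [eLpNorm_congr_ae e1, eLpNorm_indicator_eq_eLpNorm_restrict measurableSet_freeSurface]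
    exact eLpNorm_le_mul_eLpNorm_of_ae_le_mul (Eventually.of_forall fun x => by
        rw [norm_mul]; exact mul_le_mul_of_nonneg_right (hM x) (norm_nonneg _)) 2

/-- Compactly supported functions are dense. -/
lemma exists_approx (h : W12Data v g c) : ∃ (vn gn cn : ℕ → ℝ → ℂ),
    (∀ n, W12Data (vn n) (gn n) (cn n)) ∧
    (∀ n, ∃ R, 1 ≤ R ∧ (∀ x, R ≤ |x| → gn n x = 0) ∧ ∀ x, R ≤ |x| → vn n x = 0) ∧
    Tendsto (fun n => eLpNorm (vn n + (-1 : ℂ) • v) 2 (volume.restrict freeSurface) +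
      eLpNorm (gn n + (-1 : ℂ) • g) 2 volume) atTop (𝓝 0) := by
  obtain ⟨χ, χ', M, h1, h2, h3, h4, h5, h6, h7, h8⟩ := exists_cutoff
  have hd := fun n => h.mul_cutoff (h1 n) (h2 n) (h3 n) (h6 n) (h7 n)
  have hχc : ∀ n, Continuous (χ n) := fun n =>
    continuous_iff_continuousAt.2 fun x => (h1 n x).continuousAt
  refine ⟨fun n x => v x * χ n x, fun n x => g x * χ n x + c x * χ' n x, fun n x => c x * χ n x,
    fun n => (hd n).1, fun n => ⟨2 * (n + 2), ?_, fun x hx => ?_, fun x hx => ?_⟩, ?_⟩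
  · have : (0 : ℝ) ≤ n := n.cast_nonneg
    linarith
  · beta_reduce
    rw [(h8 n x hx).1, (h8 n x hx).2]
    ring
  · beta_reduce
    rw [(h8 n x hx).1, mul_zero]
  · have t1 := tendsto_eLpNorm_sub_mul_cutoff h.memLp_fst hχc h4 h5
    have t2 := tendsto_eLpNorm_sub_mul_cutoff h.memLp_snd hχc h4 h5
    have t3 : Tendsto (fun n : ℕ => ENNReal.ofReal (M / (n + 2)) *
        eLpNorm v 2 (volume.restrict freeSurface)) atTop (𝓝 0) := by
      have : Tendsto (fun n : ℕ => M / ((n : ℝ) + 2)) atTop (𝓝 0) :=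
        tendsto_const_nhds.div_atTop
          (tendsto_atTop_add_const_right _ _ tendsto_natCast_atTop_atTop)
      have := ENNReal.Tendsto.mul_const (ENNReal.tendsto_ofReal this)
        (Or.inr h.memLp_fst.2.ne)
      rwa [ENNReal.ofReal_zero, zero_mul] at this
    have t := t1.add (t2.add t3)
    simp only [add_zero] at t
    refine tendsto_of_tendsto_of_tendsto_of_le_of_le tendsto_const_nhds t (fun n => bot_le)
      fun n => add_le_add (le_of_eq ?_) ?_
    · rw [← eLpNorm_neg]
      congr 1
      funext x
      simp only [Pi.neg_apply, Pi.add_apply, Pi.smul_apply, smul_eq_mul]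
      ring
    · have m1 : AEStronglyMeasurable (fun x => g x - g x * χ n x) :=
        h.memLp_snd.1.sub (h.memLp_snd.1.mul (hχc n).aestronglyMeasurable)
      have m2 : AEStronglyMeasurable fun x => c x * χ' n x := by
        have := (hd n).1.memLp_snd.1.sub (h.memLp_snd.1.mul (hχc n).aestronglyMeasurable)
        refine this.congr (Eventually.of_forall fun x => ?_)
        simp only [Pi.sub_apply, Pi.mul_apply]
        ring
      refine le_trans (le_of_eq ?_) ((eLpNorm_sub_le m1 m2 one_le_two).trans
        (add_le_add le_rfl (hd n).2))
      rw [← eLpNorm_neg]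
      congr 1
      funext x
      simp only [Pi.neg_apply, Pi.add_apply, Pi.smul_apply, smul_eq_mul, Pi.sub_apply]
      ring

end W12Data

/-! ### The Dirichlet operator as a Poisson extension, and its weak gradient. -/

lemma norm_inv_sub_ofReal_le {z : ℂ} (hz : z.im ≠ 0) (t : ℝ) : ‖(z - t)⁻¹‖ ≤ |z.im|⁻¹ := by
  rw [norm_inv]
  refine inv_anti₀ (abs_pos.2 hz) ?_
  have := Complex.abs_im_le_norm (z - t)
  rwa [Complex.sub_im, Complex.ofReal_im, sub_zero] at this

lemma memLp_resolvent_sq {z : ℂ} (hz : z.im ≠ 0) :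
    MemLp (fun t : ℝ => ((z - t) ^ 2)⁻¹) 2 := by
  refine (memLp_resolvent hz).of_le_mul (c := |z.im|⁻¹)
    (by fun_prop : Measurable fun t : ℝ => ((z - t) ^ 2)⁻¹).aestronglyMeasurable
    (Eventually.of_forall fun t => ?_)
  rw [sq, mul_inv, norm_mul]
  exact mul_le_mul_of_nonneg_right (norm_inv_sub_ofReal_le hz t) (norm_nonneg _)

lemma hasDerivAt_cauchyInt {V : ℝ → ℂ} (hV : MemLp V 2) {z : ℂ} (hz : z.im ≠ 0) :
    HasDerivAt (cauchyInt V 1) (-cauchyInt V 2 z) z := by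
  have hpos : 0 < |z.im| / 2 := by positivity
  -- Within half the distance to the real line `|w - t|` is at least half of `|z - t|`, uniformly in
  -- `t`; this yields the factor `4` in the dominating function for the derivative.
  have hb : ∀ w ∈ Metric.ball z (|z.im| / 2), ∀ t : ℝ, ‖z - t‖ / 2 ≤ ‖w - t‖ := by
    intro w hw t
    have h1 : |z.im| ≤ ‖z - t‖ := by
      have := Complex.abs_im_le_norm (z - t)
      rwa [Complex.sub_im, Complex.ofReal_im, sub_zero] at this
    have h2 : ‖z - w‖ < |z.im| / 2 := by rwa [mem_ball_iff_norm'] at hw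
    have h3 : ‖z - t‖ ≤ ‖z - w‖ + ‖w - t‖ := norm_sub_le_norm_sub_add_norm_sub z w t
    linarith
  have hzt : ∀ t : ℝ, 0 < ‖z - t‖ := fun t => norm_pos_iff.2 (sub_ofReal_ne_zero hz t)
  have h := (hasDerivAt_integral_of_dominated_loc_of_deriv_le (μ := volume)
    (F := fun (w : ℂ) (t : ℝ) => V t * ((w - t) ^ 1)⁻¹)
    (F' := fun (w : ℂ) (t : ℝ) => -(V t * ((w - t) ^ 2)⁻¹)) (x₀ := z)
    (bound := fun t => 4 * ‖V t * ((z - t) ^ 2)⁻¹‖) (Metric.ball_mem_nhds z hpos)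
    (Eventually.of_forall fun w => ?_) (integrable_mul_resolvent hV hz) ?_
    (Eventually.of_forall fun t w hw => ?_) ?_ (Eventually.of_forall fun t w hw => ?_)).2
  · rw [integral_neg] at h
    exact h
  · exact hV.1.mul (by fun_prop : Measurable fun t : ℝ => ((w - t) ^ 1)⁻¹).aestronglyMeasurable
  · exact (hV.1.mul
      (by fun_prop : Measurable fun t : ℝ => ((z - t) ^ 2)⁻¹).aestronglyMeasurable).neg
  · have h1 := hb w hw t
    have h2 := hzt t
    rw [norm_neg, norm_mul, norm_mul, norm_inv, norm_inv, norm_pow, norm_pow, mul_left_comm]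
    refine mul_le_mul_of_nonneg_left ?_ (norm_nonneg _)
    have h3 : ‖z - t‖ ^ 2 / 4 ≤ ‖w - t‖ ^ 2 := by nlinarith
    calc (‖w - t‖ ^ 2)⁻¹ ≤ (‖z - t‖ ^ 2 / 4)⁻¹ := inv_anti₀ (by positivity) h3
      _ = 4 * (‖z - t‖ ^ 2)⁻¹ := by rw [inv_div, div_eq_mul_inv]
  · exact ((hV.integrable_mul (memLp_resolvent_sq hz)).norm.const_mul 4)
  · have hne : w - (t : ℂ) ≠ 0 := by
      rw [← norm_pos_iff]
      linarith [hb w hw t, hzt t]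
    have h1 : HasDerivAt (fun w : ℂ => (w - t) ^ 1) 1 w := by
      simpa using (hasDerivAt_id w).sub_const (t : ℂ)
    have h2 := (h1.inv (pow_ne_zero 1 hne)).const_mul (V t)
    refine h2.congr_deriv ?_
    rw [← pow_mul, one_mul]
    ring

lemma isOpen_im_ne_zero : IsOpen {z : ℂ | z.im ≠ 0} :=
  isOpen_ne_fun Complex.continuous_im continuous_const

/-- Up to sign it is the complex derivative of a holomorphic function, hence continuous. -/
lemma continuousAt_cauchyInt_two {V : ℝ → ℂ} (hV : MemLp V 2) {z : ℂ} (hz : z.im ≠ 0) :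
    ContinuousAt (cauchyInt V 2) z := by
  have hd : DifferentiableOn ℂ (cauchyInt V 1) {z : ℂ | z.im ≠ 0} := fun w hw =>
    (hasDerivAt_cauchyInt hV hw).differentiableAt.differentiableWithinAt
  have h1 := ((hd.deriv isOpen_im_ne_zero).continuousOn.neg).continuousAt
    (isOpen_im_ne_zero.mem_nhds hz)
  refine h1.congr ?_
  filter_upwards [isOpen_im_ne_zero.mem_nhds hz] with w hw
  rw [Pi.neg_apply, (hasDerivAt_cauchyInt hV hw).deriv, neg_neg]

/-- The Poisson extension of `V` to the upper half-plane. -/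
noncomputable def poissonExt (V : ℝ → ℂ) (p : ℝ × ℝ) : ℂ :=
  Complex.I / (2 * Real.pi) * (cauchyInt V 1 (p.1 + p.2 * Complex.I) -
    cauchyInt V 1 (p.1 - p.2 * Complex.I))

/-- The gradient of the Poisson extension. -/
noncomputable def poissonGrad (V : ℝ → ℂ) (p : ℝ × ℝ) : EuclideanSpace ℂ (Fin 2) :=
  !₂[-Complex.I / (2 * Real.pi) * (cauchyInt V 2 (p.1 + p.2 * Complex.I) -
      cauchyInt V 2 (p.1 - p.2 * Complex.I)),
    1 / (2 * Real.pi) * (cauchyInt V 2 (p.1 + p.2 * Complex.I) +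
      cauchyInt V 2 (p.1 - p.2 * Complex.I))]

/-- The second kernel of the Dirichlet operator is the first one after inversion: `t⁻² * y / ((x -
t⁻¹)² + y²)` equals `y / ((x * t - 1)² + y² * t²)`. The Poisson integral of the even extension over
`[-1, 1]` is thus the second summand. -/
lemma dirichletOp_eq_poissonExt {v : ℝ → ℂ} (hv : MemLp v 2 (volume.restrict freeSurface))
    {p : ℝ × ℝ} (hp : 0 < p.2) : dirichletOp v p = poissonExt (inversionExt 1 v) p := by
  obtain ⟨x, y⟩ := p
  simp only at hp
  have hV := memLp_inversionExt 1 hv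
  have hz : ((x : ℂ) + y * Complex.I).im ≠ 0 := by simpa using hp.ne'
  have hP := integral_poisson_smul hV x hp
  have hPm : MemLp (fun t : ℝ => ((y / ((x - t) ^ 2 + y ^ 2) : ℝ) : ℂ)) 2 := by
    have h1 : (fun t : ℝ => ((y / ((x - t) ^ 2 + y ^ 2) : ℝ) : ℂ)) = fun t : ℝ =>
        (((-(((x : ℂ) + y * Complex.I) - t)⁻¹.im : ℝ)) : ℂ) := by
      funext t
      rw [Complex.inv_im, Complex.normSq_apply]
      simp only [Complex.sub_re, Complex.add_re, Complex.ofReal_re, Complex.mul_re, Complex.I_re,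
        Complex.sub_im, Complex.add_im, Complex.ofReal_im, Complex.mul_im, Complex.I_im]
      congr 1
      simp only [mul_zero, mul_one, zero_add, add_zero, sub_zero, sub_self, neg_div, neg_neg, sq]
    rw [h1]
    exact ((memLp_resolvent hz).im.neg).ofReal
  have hi : Integrable fun t : ℝ => ((y / ((x - t) ^ 2 + y ^ 2) : ℝ) : ℂ) * inversionExt 1 v t :=
    hPm.integrable_mul hV
  have e1 := setIntegral_add_compl_freeSurface hi
  have i1 : Integrable (fun t : ℝ => ((y / ((x - t) ^ 2 + y ^ 2) : ℝ) : ℂ) * v t)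
      (volume.restrict freeSurface) := (hPm.restrict _).integrable_mul hv
  have hk2 : ∀ t ∈ freeSurface, (((t : ℂ) ^ 2)⁻¹ * ((y / ((x - t⁻¹) ^ 2 + y ^ 2) : ℝ) : ℂ)) =
      ((y / ((x * t - 1) ^ 2 + y ^ 2 * t ^ 2) : ℝ) : ℂ) := by
    intro t ht
    have ht0 := ne_zero_of_mem_freeSurface ht
    rw [← Complex.ofReal_pow, ← Complex.ofReal_inv, ← Complex.ofReal_mul]
    congr 1
    rw [inv_mul_eq_div, div_div]
    congr 1
    field_simp
  have i2 : Integrable (fun t : ℝ => ((y / ((x * t - 1) ^ 2 + y ^ 2 * t ^ 2) : ℝ) : ℂ) * v t)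
      (volume.restrict freeSurface) := by
    refine ((memLp_inv_sq_mul_comp_inv hPm).integrable_mul hv).congr ?_
    filter_upwards [ae_restrict_mem measurableSet_freeSurface] with t ht
    rw [Pi.mul_apply, hk2 t ht]
  have e2 : ∫ t in freeSurface, ((y / ((x - t) ^ 2 + y ^ 2) : ℝ) : ℂ) * inversionExt 1 v t =
      ∫ t in freeSurface, ((y / ((x - t) ^ 2 + y ^ 2) : ℝ) : ℂ) * v t :=
    setIntegral_congr_fun measurableSet_freeSurface fun t ht => by
      rw [inversionExt_of_mem _ _ ht]
  have e3 : ∫ t in freeSurface, (t ^ 2)⁻¹ • (((y / ((x - t⁻¹) ^ 2 + y ^ 2) : ℝ) : ℂ) *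
      inversionExt 1 v t⁻¹) =
      ∫ t in freeSurface, ((y / ((x * t - 1) ^ 2 + y ^ 2 * t ^ 2) : ℝ) : ℂ) * v t :=
    setIntegral_congr_fun measurableSet_freeSurface fun t ht => by
      rw [inversionExt_inv_of_mem _ _ ht, ← hk2 t ht, Complex.real_smul]
      push_cast
      ring
  have e4 : ∫ t in freeSurface, ((y / ((x - t) ^ 2 + y ^ 2) +
      y / ((x * t - 1) ^ 2 + y ^ 2 * t ^ 2) : ℝ) : ℂ) * v t =
      (∫ t in freeSurface, ((y / ((x - t) ^ 2 + y ^ 2) : ℝ) : ℂ) * v t) +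
      ∫ t in freeSurface, ((y / ((x * t - 1) ^ 2 + y ^ 2 * t ^ 2) : ℝ) : ℂ) * v t := by
    rw [← integral_add i1 i2]
    refine integral_congr_ae (Eventually.of_forall fun t => ?_)
    simp only [Complex.ofReal_add, add_mul]
  simp only [Complex.real_smul] at hP
  rw [dirichletOp, if_pos hp, e4, ← e2, ← e3, ← e1, hP, poissonExt]
  simp only [mul_comm Complex.I]
  push_cast
  ring

/-- The identification of the plane with the complex numbers. -/
noncomputable def planeToComplex : ℝ × ℝ →L[ℝ] ℂ :=
  (ContinuousLinearMap.fst ℝ ℝ ℝ).smulRight (1 : ℂ) +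
    (ContinuousLinearMap.snd ℝ ℝ ℝ).smulRight Complex.I

lemma planeToComplex_apply (p : ℝ × ℝ) : planeToComplex p = p.1 + p.2 * Complex.I := by
  simp [planeToComplex]

lemma conj_planeToComplex (p : ℝ × ℝ) :
    (Complex.conjCLE : ℂ →L[ℝ] ℂ) (planeToComplex p) = p.1 - p.2 * Complex.I := by
  rw [planeToComplex_apply]
  simp [sub_eq_add_neg]

lemma hasFDerivAt_poissonExt {V : ℝ → ℂ} (hV : MemLp V 2) {p : ℝ × ℝ} (hp : p.2 ≠ 0) :
    ∃ L : ℝ × ℝ →L[ℝ] ℂ, HasFDerivAt (poissonExt V) L p ∧ L (1, 0) = poissonGrad V p 0 ∧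
      L (0, 1) = poissonGrad V p 1 := by
  set L1 := planeToComplex
  set L2 := (Complex.conjCLE : ℂ →L[ℝ] ℂ).comp planeToComplex
  have h1 : (L1 p).im ≠ 0 := by rw [planeToComplex_apply]; simpa using hp
  have h2 : (L2 p).im ≠ 0 := by
    change ((Complex.conjCLE : ℂ →L[ℝ] ℂ) (planeToComplex p)).im ≠ 0
    rw [conj_planeToComplex]
    simpa using hp
  have d1 := (hasDerivAt_cauchyInt hV h1).comp_hasFDerivAt p L1.hasFDerivAt
  have d2 := (hasDerivAt_cauchyInt hV h2).comp_hasFDerivAt p L2.hasFDerivAt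
  have d := (d1.sub d2).const_mul (Complex.I / (2 * Real.pi))
  have e1 : ∀ q, L1 q = q.1 + q.2 * Complex.I := planeToComplex_apply
  have e2 : ∀ q, L2 q = q.1 - q.2 * Complex.I := conj_planeToComplex
  refine ⟨_, d.congr_of_eventuallyEq (Eventually.of_forall fun q => ?_), ?_, ?_⟩
  · simp only [Pi.sub_apply, Function.comp_apply, e1, e2, poissonExt]
  · simp [poissonGrad, e1, e2]
    ring
  · simp [poissonGrad, e1, e2]
    linear_combination (-(2 * Real.pi : ℂ)⁻¹ * (cauchyInt V 2 (p.1 + p.2 * Complex.I) +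
      cauchyInt V 2 (p.1 - p.2 * Complex.I))) * Complex.I_sq

/-- The two components are multiples of equal modulus of the difference and the sum of the values at
`z` and its conjugate, so the parallelogram law removes the mixed terms. -/
lemma enorm_poissonGrad_sq (V : ℝ → ℂ) (p : ℝ × ℝ) :
    ‖poissonGrad V p‖ₑ ^ 2 = energyDensity V (p.1 + Complex.I * p.2) := by
  set a := cauchyInt V 2 (p.1 + p.2 * Complex.I) with ha
  set b := cauchyInt V 2 (p.1 - p.2 * Complex.I) with hb
  have hc : conj ((p.1 : ℂ) + Complex.I * p.2) = p.1 - p.2 * Complex.I := by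
    simp [sub_eq_add_neg, mul_comm]
  have e : ‖poissonGrad V p‖ ^ 2 = 1 / (2 * Real.pi ^ 2) * (‖a‖ ^ 2 + ‖b‖ ^ 2) := by
    rw [EuclideanSpace.norm_sq_eq, Fin.sum_univ_two]
    simp only [poissonGrad, ← ha, ← hb]
    simp only [Matrix.cons_val_zero, Matrix.cons_val_one, norm_mul, norm_div,
      norm_neg, Complex.norm_I, norm_one, Complex.norm_ofNat, Complex.norm_real,
      Real.norm_of_nonneg Real.pi_pos.le, mul_pow]
    have := parallelogram_law_with_norm ℝ a b
    rw [← mul_add]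
    have h2 : ‖a - b‖ ^ 2 + ‖a + b‖ ^ 2 = 2 * (‖a‖ ^ 2 + ‖b‖ ^ 2) := by
      simp only [sq]; linarith
    rw [h2]
    field_simp
  have key : ∀ {F : Type} [NormedAddCommGroup F] (f : F), ‖f‖ₑ ^ 2 = ENNReal.ofReal (‖f‖ ^ 2) := fun f => by
    rw [← ofReal_norm, ENNReal.ofReal_pow (norm_nonneg _)]
  rw [key, e, ENNReal.ofReal_mul (by positivity), ENNReal.ofReal_add (sq_nonneg _) (sq_nonneg _),
    ← key, ← key, energyDensity, hc, mul_comm Complex.I]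

lemma isOpen_fluidDomain : IsOpen fluidDomain := by
  have h1 : IsOpen {p : ℝ × ℝ | 1 < p.1 ^ 2 + p.2 ^ 2} := isOpen_lt continuous_const (by fun_prop)
  have h2 : IsOpen {p : ℝ × ℝ | 0 < p.2} := isOpen_lt continuous_const continuous_snd
  exact h1.inter h2

lemma measurableSet_fluidDomain : MeasurableSet fluidDomain := isOpen_fluidDomain.measurableSet

lemma lintegral_enorm_poissonGrad_sq {V : ℝ → ℂ} (hV : MemLp V 2) :
    ∫⁻ p in fluidDomain, ‖poissonGrad V p‖ₑ ^ 2 =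
      ∫⁻ z in {z : ℂ | 1 < ‖z‖ ∧ 0 < z.im}, energyDensity V z := by
  have hmk : ∀ p : ℝ × ℝ, Complex.measurableEquivRealProd.symm p = p.1 + Complex.I * p.2 := by
    intro p
    apply Complex.ext <;> simp [Complex.measurableEquivRealProd_symm_apply]
  have hS : MeasurableSet {z : ℂ | 1 < ‖z‖ ∧ 0 < z.im} :=
    (measurableSet_lt measurable_const measurable_norm).inter measurableSet_upper
  have hpre : Complex.measurableEquivRealProd.symm ⁻¹' {z : ℂ | 1 < ‖z‖ ∧ 0 < z.im} =
      fluidDomain := by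
    ext p
    rw [mem_preimage, hmk]
    simp only [fluidDomain, mem_ofPred_eq]
    refine and_congr ?_ (by simp)
    rw [← one_lt_sq_iff₀ (norm_nonneg _), ← Complex.normSq_eq_norm_sq, Complex.normSq_apply]
    simp [sq]
  have h := Complex.volume_preserving_equiv_real_prod.symm.setLIntegral_comp_preimage hS
    (measurable_energyDensity hV.1)
  rw [← h, hpre]
  refine lintegral_congr fun p => ?_
  rw [enorm_poissonGrad_sq, hmk]

lemma continuousOn_poissonGrad {V : ℝ → ℂ} (hV : MemLp V 2) :
    ContinuousOn (poissonGrad V) {p | 0 < p.2} := by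
  have h1 : ContinuousOn (fun p : ℝ × ℝ => cauchyInt V 2 (p.1 + p.2 * Complex.I)) {p | 0 < p.2} :=
    fun p hp => ((continuousAt_cauchyInt_two hV (by simpa using (ne_of_gt hp))).comp
      (f := fun p : ℝ × ℝ => (p.1 : ℂ) + p.2 * Complex.I)
      (by fun_prop : Continuous fun p : ℝ × ℝ => (p.1 : ℂ) + p.2 * Complex.I).continuousAt).continuousWithinAt
  have h2 : ContinuousOn (fun p : ℝ × ℝ => cauchyInt V 2 (p.1 - p.2 * Complex.I)) {p | 0 < p.2} :=
    fun p hp => ((continuousAt_cauchyInt_two hV (by simpa using (ne_of_gt hp))).comp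
      (f := fun p : ℝ × ℝ => (p.1 : ℂ) - p.2 * Complex.I)
      (by fun_prop : Continuous fun p : ℝ × ℝ => (p.1 : ℂ) - p.2 * Complex.I).continuousAt).continuousWithinAt
  refine (PiLp.continuous_toLp 2 _).comp_continuousOn (continuousOn_pi.2 fun i => ?_)
  fin_cases i
  · exact continuousOn_const.mul (h1.sub h2)
  · exact continuousOn_const.mul (h1.add h2)

lemma fluidDomain_subset : fluidDomain ⊆ {p | 0 < p.2} := fun _ hp => hp.2

lemma hasWeakDeriv_of_hasFDerivAt {X : Type*} [NormedAddCommGroup X] [NormedSpace ℝ X]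
    [FiniteDimensional ℝ X] [MeasureSpace X] [BorelSpace X] [(volume : Measure X).IsAddHaarMeasure]
    {U : Set X} (hU : IsOpen U) {u w : X → ℂ} {e : X}
    (h : ∀ x ∈ U, ∃ L : X →L[ℝ] ℂ, HasFDerivAt u L x ∧ L e = w x) (hw : ContinuousOn w U) :
    HasWeakDeriv U u e w := by
  have hu : ContinuousOn u U := fun x hx => by
    obtain ⟨L, hL, _⟩ := h x hx
    exact hL.continuousAt.continuousWithinAt
  have lu : LocallyIntegrableOn u U := hu.locallyIntegrableOn hU.measurableSet
  have lw : LocallyIntegrableOn w U := hw.locallyIntegrableOn hU.measurableSet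
  refine ⟨lu, lw, fun φ h1 h2 h3 => ?_⟩
  have he : ∀ x, φ x • fderiv ℝ u x e = φ x • w x := fun x => by
    by_cases hx : x ∈ tsupport φ
    · obtain ⟨L, hL, hLe⟩ := h x (h3 hx)
      rw [hL.fderiv, hLe]
    · rw [image_eq_zero_of_notMem_tsupport hx, zero_smul, zero_smul]
  have hds := (tsupport_fderiv_apply_subset' φ e).trans h3
  have i1 := lu.integrable_smul_of_tsupport_subset
    (ContDiff.continuous_fderiv_apply_const h1 e) (h2.fderiv_apply ℝ e) hds
  have i2 := lw.integrable_smul_of_tsupport_subset h1.continuous h2 h3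
  have i3 := lu.integrable_smul_of_tsupport_subset h1.continuous h2 h3
  rw [setIntegral_smul_of_tsupport_subset hds, setIntegral_smul_of_tsupport_subset h3]
  have := integral_smul_fderiv_eq_neg_fderiv_smul_of_integrable (𝕜 := ℝ) (μ := volume) (v := e) i1
    (i2.congr (Eventually.of_forall fun x => (he x).symm)) i3
    (fun x _ => (h1.differentiable (by simp)).differentiableAt)
    (fun x hx => by
      obtain ⟨L, hL, _⟩ := h x (h3 hx)
      exact hL.differentiableAt)
  rw [← neg_eq_iff_eq_neg, ← this]
  exact integral_congr_ae (Eventually.of_forall he)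

lemma hasWeakDeriv_dirichletOp {v : ℝ → ℂ} (hv : MemLp v 2 (volume.restrict freeSurface)) :
    HasWeakDeriv fluidDomain (dirichletOp v) (1, 0)
      (fun p => poissonGrad (inversionExt 1 v) p 0) ∧
    HasWeakDeriv fluidDomain (dirichletOp v) (0, 1)
      (fun p => poissonGrad (inversionExt 1 v) p 1) := by
  have hV := memLp_inversionExt 1 hv
  have he : poissonExt (inversionExt 1 v) =ᵐ[volume.restrict fluidDomain] dirichletOp v := by
    filter_upwards [ae_restrict_mem measurableSet_fluidDomain] with p hp
    rw [dirichletOp_eq_poissonExt hv hp.2]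
  have hc := (continuousOn_poissonGrad hV).mono fluidDomain_subset
  have hci : ∀ i, ContinuousOn (fun p => poissonGrad (inversionExt 1 v) p i) fluidDomain := fun i =>
    (PiLp.continuous_apply 2 _ i).comp_continuousOn hc
  constructor
  · refine (hasWeakDeriv_of_hasFDerivAt isOpen_fluidDomain (fun p hp => ?_) (hci 0)).congr_ae
      isOpen_fluidDomain he EventuallyEq.rfl
    obtain ⟨L, h1, h2, _⟩ := hasFDerivAt_poissonExt hV (ne_of_gt hp.2)
    exact ⟨L, h1, h2⟩
  · refine (hasWeakDeriv_of_hasFDerivAt isOpen_fluidDomain (fun p hp => ?_) (hci 1)).congr_ae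
      isOpen_fluidDomain he EventuallyEq.rfl
    obtain ⟨L, h1, _, h2⟩ := hasFDerivAt_poissonExt hV (ne_of_gt hp.2)
    exact ⟨L, h1, h2⟩

lemma weakGrad_dirichletOp_ae_eq {v : ℝ → ℂ} (hv : MemLp v 2 (volume.restrict freeSurface)) :
    weakGrad fluidDomain (dirichletOp v) =ᵐ[volume.restrict fluidDomain]
      poissonGrad (inversionExt 1 v) := by
  obtain ⟨h1, h2⟩ := hasWeakDeriv_dirichletOp hv
  filter_upwards [h1.weakDeriv_ae_eq isOpen_fluidDomain, h2.weakDeriv_ae_eq isOpen_fluidDomain]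
    with p e1 e2
  rw [weakGrad, e1, e2]
  ext i
  fin_cases i <;> rfl

lemma memBeppoLevi_dirichletOp {v : ℝ → ℂ} (hv : MemLp v 2 (volume.restrict freeSurface))
    (h : MemLp (poissonGrad (inversionExt 1 v)) 2 (volume.restrict fluidDomain)) :
    MemBeppoLevi fluidDomain (dirichletOp v) := by
  obtain ⟨h1, h2⟩ := hasWeakDeriv_dirichletOp hv
  exact ⟨h1.1, _, _, h1, h2, h.eval_piLp 0, h.eval_piLp 1⟩

/-! ### Linearity and convergence of the extensions. -/

lemma inversionExt_add_smul (κ : ℂ) (v v' : ℝ → ℂ) (a : ℂ) :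
    inversionExt κ (v + a • v') = inversionExt κ v + a • inversionExt κ v' := by
  have e : ∀ t, freeSurface.indicator (v + a • v') t =
      freeSurface.indicator v t + a * freeSurface.indicator v' t := fun t => by
    by_cases ht : t ∈ freeSurface <;> simp [ht]
  funext s
  simp only [inversionExt, e, Pi.add_apply, Pi.smul_apply, smul_eq_mul]
  ring

lemma eLpNorm_inversionExt_one_le {v : ℝ → ℂ} (hv : MemLp v 2 (volume.restrict freeSurface)) :
    eLpNorm (inversionExt 1 v) 2 volume ≤ 2 * eLpNorm v 2 (volume.restrict freeSurface) := by
  have e : inversionExt 1 v = freeSurface.indicator v + fun s => freeSurface.indicator v s⁻¹ := by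
    funext s
    simp only [inversionExt, one_mul, Pi.add_apply]
  rw [e, two_mul]
  refine (eLpNorm_add_le ((memLp_indicator_iff_restrict measurableSet_freeSurface).2 hv).1
    (memLp_indicator_comp_inv hv).1 one_le_two).trans (add_le_add ?_
      (eLpNorm_indicator_comp_inv_le v))
  rw [eLpNorm_indicator_eq_eLpNorm_restrict measurableSet_freeSurface]

lemma cauchyInt_two_add_smul {V W : ℝ → ℂ} (hV : MemLp V 2) (hW : MemLp W 2) (a : ℂ) {z : ℂ}
    (hz : z.im ≠ 0) :
    cauchyInt (V + a • W) 2 z = cauchyInt V 2 z + a * cauchyInt W 2 z := by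
  have i1 : Integrable fun t : ℝ => V t * ((z - t) ^ 2)⁻¹ := hV.integrable_mul (memLp_resolvent_sq hz)
  have i2 : Integrable fun t : ℝ => W t * ((z - t) ^ 2)⁻¹ := hW.integrable_mul (memLp_resolvent_sq hz)
  unfold cauchyInt
  rw [← integral_const_mul, ← integral_add i1 (i2.const_mul a)]
  refine integral_congr_ae (Eventually.of_forall fun t => ?_)
  simp only [Pi.add_apply, Pi.smul_apply, smul_eq_mul]
  ring

lemma enorm_integral_mul_le {α : Type*} [MeasurableSpace α] {μ : Measure α} {f g : α → ℂ}
    (hf : AEStronglyMeasurable f μ) (hg : AEStronglyMeasurable g μ) :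
    ‖∫ x, f x * g x ∂μ‖ₑ ≤ eLpNorm f 2 μ * eLpNorm g 2 μ := by
  refine (enorm_integral_le_lintegral_enorm _).trans ?_
  rw [← eLpNorm_one_eq_lintegral_enorm]
  have h := eLpNorm_smul_le_mul_eLpNorm (p := 2) (q := 2) (r := 1) (μ := μ) (f := g) hg (φ := f) hf
  have e : (fun x => f x * g x) = f • g := rfl
  rw [e]
  exact h

lemma enorm_cauchyInt_two_le {V : ℝ → ℂ} (hV : MemLp V 2) {z : ℂ} (hz : z.im ≠ 0) :
    ‖cauchyInt V 2 z‖ₑ ≤ eLpNorm V 2 volume *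
      eLpNorm (fun t : ℝ => ((z - t) ^ 2)⁻¹) 2 volume :=
  enorm_integral_mul_le hV.1 (memLp_resolvent_sq hz).1

lemma poissonGrad_add_smul {V W : ℝ → ℂ} (hV : MemLp V 2) (hW : MemLp W 2) (a : ℂ) {p : ℝ × ℝ}
    (hp : p.2 ≠ 0) : poissonGrad (V + a • W) p = poissonGrad V p + a • poissonGrad W p := by
  have h1 : ((p.1 : ℂ) + p.2 * Complex.I).im ≠ 0 := by simpa using hp
  have h2 : ((p.1 : ℂ) - p.2 * Complex.I).im ≠ 0 := by simpa using hp
  simp only [poissonGrad, cauchyInt_two_add_smul hV hW a h1, cauchyInt_two_add_smul hV hW a h2]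
  ext i
  fin_cases i <;> simp <;> ring

/-- At a point off the real line the kernel is square integrable, so Cauchy-Schwarz turns `L²`
convergence of boundary values into pointwise convergence. This prepares the use of Fatou's lemma.
-/
lemma tendsto_energyDensity {V : ℝ → ℂ} {Vn : ℕ → ℝ → ℂ} (hV : MemLp V 2) (hn : ∀ n, MemLp (Vn n) 2)
    (h : Tendsto (fun n => eLpNorm (Vn n + (-1 : ℂ) • V) 2 volume) atTop (𝓝 0)) {z : ℂ}
    (hz : z.im ≠ 0) : Tendsto (fun n => energyDensity (Vn n) z) atTop (𝓝 (energyDensity V z)) := by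
  have key : ∀ w : ℂ, w.im ≠ 0 → Tendsto (fun n => cauchyInt (Vn n) 2 w) atTop
      (𝓝 (cauchyInt V 2 w)) := by
    intro w hw
    rw [tendsto_iff_edist_tendsto_0]
    have h1 : Tendsto (fun n => eLpNorm (Vn n + (-1 : ℂ) • V) 2 volume *
        eLpNorm (fun t : ℝ => ((w - t) ^ 2)⁻¹) 2 volume) atTop (𝓝 0) := by
      have := ENNReal.Tendsto.mul_const h (Or.inr (memLp_resolvent_sq hw).2.ne)
      rwa [zero_mul] at this
    refine tendsto_of_tendsto_of_tendsto_of_le_of_le tendsto_const_nhds h1 (fun n => bot_le)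
      fun n => ?_
    have h2 := enorm_cauchyInt_two_le ((hn n).add (hV.const_smul (-1 : ℂ))) hw
    rw [cauchyInt_two_add_smul (hn n) hV _ hw, neg_one_mul, ← sub_eq_add_neg] at h2
    rw [edist_eq_enorm_sub]
    exact h2
  have k1 := key z hz
  have k2 := key (conj z) (by simpa using hz)
  refine ENNReal.Tendsto.const_mul ?_ (Or.inr ENNReal.ofReal_ne_top)
  exact ((ENNReal.continuous_pow 2).tendsto _ |>.comp k1.enorm).add
    ((ENNReal.continuous_pow 2).tendsto _ |>.comp k2.enorm)

/-! ### Energy bound and energy identity for general data. -/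

namespace W12Data

variable {v g c v' g' c' : ℝ → ℂ}

lemma eLpNorm_poissonGrad_sq (h : W12Data v g c) :
    eLpNorm (poissonGrad (inversionExt 1 v)) 2 (volume.restrict fluidDomain) ^ 2 =
      ∫⁻ z in {z : ℂ | 1 < ‖z‖ ∧ 0 < z.im}, energyDensity (inversionExt 1 v) z := by
  rw [eLpNorm_two_sq_eq_lintegral, lintegral_enorm_poissonGrad_sq (memLp_inversionExt 1 h.memLp_fst)]

lemma eLpNorm_poissonGrad_le_of_eq_zero (h : W12Data v g c) {R : ℝ} (hR : 1 ≤ R)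
    (hg : ∀ x, R ≤ |x| → g x = 0) (hvR : ∀ x, R ≤ |x| → v x = 0) :
    eLpNorm (poissonGrad (inversionExt 1 v)) 2 (volume.restrict fluidDomain) ≤
      neumannConst * (eLpNorm v 2 (volume.restrict freeSurface) + eLpNorm g 2 volume) := by
  obtain ⟨hne, he⟩ := h.integral_neumannData_mul_conj hR hg hvR
  rw [← h.eLpNorm_poissonGrad_sq] at hne he
  set T := eLpNorm (poissonGrad (inversionExt 1 v)) 2 (volume.restrict fluidDomain)
  set N := eLpNorm v 2 (volume.restrict freeSurface) + eLpNorm g 2 volume with hN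
  rw [← ENNReal.pow_le_pow_left_iff two_ne_zero]
  have h1 : T ^ 2 = ‖∫ x in freeSurface, neumannData g c x * conj (v x)‖ₑ := by
    rw [he, ← ofReal_norm, Complex.norm_real, Real.norm_of_nonneg ENNReal.toReal_nonneg,
      ENNReal.ofReal_toReal hne]
  have h2 : eLpNorm (fun x => conj (v x)) 2 (volume.restrict freeSurface) =
      eLpNorm v 2 (volume.restrict freeSurface) :=
    eLpNorm_congr_norm_ae (Eventually.of_forall fun x => RCLike.norm_conj (v x))
  -- Cauchy-Schwarz gives the bound `neumannConst * N ^ 2` for the squared norm; a constant at least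
  -- `1` may be replaced by its square, which yields a clean bound for the norm.
  have hC : 1 ≤ neumannConst := by
    rw [neumannConst]
    exact one_le_two.trans (le_add_right le_rfl)
  rw [h1]
  refine (enorm_integral_mul_le h.memLp_neumannData.1 h.memLp_fst.star.1).trans ?_
  calc _ ≤ (neumannConst * N) * N := by
        refine mul_le_mul' h.eLpNorm_neumannData_le ?_
        exact h2.le.trans (le_add_right le_rfl)
    _ ≤ (neumannConst * N) * (neumannConst * N) := by
        gcongr
        exact le_mul_of_one_le_left bot_le hC
    _ = _ := (sq _).symm

/-- Approximation by cutoffs and Fatou's lemma: pointwise convergence of the densities is available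
beforehand, whereas `L²` convergence of the gradients is a consequence of this bound. -/
lemma eLpNorm_poissonGrad_le (h : W12Data v g c) :
    eLpNorm (poissonGrad (inversionExt 1 v)) 2 (volume.restrict fluidDomain) ≤
      neumannConst * (eLpNorm v 2 (volume.restrict freeSurface) + eLpNorm g 2 volume) := by
  obtain ⟨vn, gn, cn, hd, hR, ht⟩ := h.exists_approx
  set N := eLpNorm v 2 (volume.restrict freeSurface) + eLpNorm g 2 volume with hN
  set δ := fun n => eLpNorm (vn n + (-1 : ℂ) • v) 2 (volume.restrict freeSurface) +
      eLpNorm (gn n + (-1 : ℂ) • g) 2 volume with hδ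
  have hV := memLp_inversionExt 1 h.memLp_fst
  have hVn := fun n => memLp_inversionExt 1 (hd n).memLp_fst
  have htri : ∀ {μ : Measure ℝ} {a b : ℝ → ℂ}, MemLp a 2 μ → MemLp b 2 μ →
      eLpNorm a 2 μ ≤ eLpNorm b 2 μ + eLpNorm (a + (-1 : ℂ) • b) 2 μ := fun {μ a b} ha hb => by
    have e : a = b + (a + (-1 : ℂ) • b) := by
      funext x
      simp only [Pi.add_apply, Pi.smul_apply, smul_eq_mul]
      ring
    conv_lhs => rw [e]
    exact eLpNorm_add_le hb.1 (ha.add (hb.const_smul _)).1 one_le_two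
  have hNn : ∀ n, eLpNorm (vn n) 2 (volume.restrict freeSurface) + eLpNorm (gn n) 2 volume ≤
      N + δ n := fun n => by
    refine (add_le_add (htri (hd n).memLp_fst h.memLp_fst)
      (htri (hd n).memLp_snd h.memLp_snd)).trans (le_of_eq ?_)
    simp only [hN, hδ]
    ring
  have hVt : Tendsto (fun n => eLpNorm (inversionExt 1 (vn n) + (-1 : ℂ) • inversionExt 1 v) 2 volume)
      atTop (𝓝 0) := by
    have h2 : Tendsto (fun n => 2 * δ n) atTop (𝓝 0) := by
      have := ENNReal.Tendsto.const_mul (a := 2) ht (Or.inr (by simp))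
      rwa [mul_zero] at this
    refine tendsto_of_tendsto_of_tendsto_of_le_of_le tendsto_const_nhds h2 (fun n => bot_le)
      fun n => ?_
    beta_reduce
    rw [← inversionExt_add_smul]
    refine (eLpNorm_inversionExt_one_le ((hd n).memLp_fst.add (h.memLp_fst.const_smul _))).trans ?_
    exact mul_le_mul_right (le_add_right le_rfl) _
  have hS : MeasurableSet {z : ℂ | 1 < ‖z‖ ∧ 0 < z.im} :=
    (measurableSet_lt measurable_const measurable_norm).inter measurableSet_upper
  rw [← ENNReal.pow_le_pow_left_iff two_ne_zero, h.eLpNorm_poissonGrad_sq]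
  -- The density is replaced by the lower limit of its approximations, the form in which Fatou's
  -- lemma applies.
  have h3 : ∫⁻ z in {z : ℂ | 1 < ‖z‖ ∧ 0 < z.im}, energyDensity (inversionExt 1 v) z =
      ∫⁻ z in {z : ℂ | 1 < ‖z‖ ∧ 0 < z.im},
        liminf (fun n => energyDensity (inversionExt 1 (vn n)) z) atTop :=
    setLIntegral_congr_fun hS fun z hz =>
      (tendsto_energyDensity hV hVn hVt (ne_of_gt hz.2)).liminf_eq.symm
  rw [h3]
  refine (lintegral_liminf_le fun n => measurable_energyDensity (hVn n).1).trans ?_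
  have h4 : Tendsto (fun n => (neumannConst * (N + δ n)) ^ 2) atTop (𝓝 ((neumannConst * N) ^ 2)) := by
    have t1 := (tendsto_const_nhds (x := N)).add ht
    rw [add_zero] at t1
    exact ((ENNReal.continuous_pow 2).tendsto _).comp
      (ENNReal.Tendsto.const_mul t1 (Or.inr neumannConst_ne_top))
  rw [← h4.liminf_eq]
  refine liminf_le_liminf (Eventually.of_forall fun n => ?_)
  obtain ⟨R, hR1, hR2, hR3⟩ := hR n
  rw [← (hd n).eLpNorm_poissonGrad_sq]
  refine ENNReal.pow_le_pow_left (((hd n).eLpNorm_poissonGrad_le_of_eq_zero hR1 hR2 hR3).trans ?_)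
  exact mul_le_mul_right (hNn n) _

lemma memLp_poissonGrad (h : W12Data v g c) :
    MemLp (poissonGrad (inversionExt 1 v)) 2 (volume.restrict fluidDomain) := by
  refine ⟨((continuousOn_poissonGrad (memLp_inversionExt 1 h.memLp_fst)).mono
    fluidDomain_subset).aestronglyMeasurable measurableSet_fluidDomain,
    h.eLpNorm_poissonGrad_le.trans_lt ?_⟩
  exact ENNReal.mul_lt_top (lt_top_iff_ne_top.2 neumannConst_ne_top)
    (ENNReal.add_lt_top.2 ⟨h.memLp_fst.2, h.memLp_snd.2⟩)

lemma poissonGrad_add_smul_ae_eq (h : W12Data v g c) (h' : W12Data v' g' c') (a : ℂ) :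
    poissonGrad (inversionExt 1 (v + a • v')) =ᵐ[volume.restrict fluidDomain]
      poissonGrad (inversionExt 1 v) + a • poissonGrad (inversionExt 1 v') := by
  filter_upwards [ae_restrict_mem measurableSet_fluidDomain] with p hp
  rw [inversionExt_add_smul, poissonGrad_add_smul (memLp_inversionExt 1 h.memLp_fst)
    (memLp_inversionExt 1 h'.memLp_fst) a (ne_of_gt hp.2)]
  rfl

/-- The gradient of the Dirichlet extension, as an element of `L²`. -/
noncomputable def gradLp (h : W12Data v g c) :
    Lp (EuclideanSpace ℂ (Fin 2)) 2 (volume.restrict fluidDomain) := h.memLp_poissonGrad.toLp _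

/-- The Neumann data as an element of `L²`. -/
noncomputable def neumannLp (h : W12Data v g c) : Lp ℂ 2 (volume.restrict freeSurface) :=
  h.memLp_neumannData.toLp _

/-- The Dirichlet data as an element of `L²`. -/
noncomputable def funLp (h : W12Data v g c) : Lp ℂ 2 (volume.restrict freeSurface) :=
  h.memLp_fst.toLp _

lemma gradLp_add_smul (h : W12Data v g c) (h' : W12Data v' g' c') (a : ℂ) :
    (h.add_smul h' a).gradLp = h.gradLp + a • h'.gradLp := by
  rw [gradLp, gradLp, gradLp, ← MemLp.toLp_const_smul, ← MemLp.toLp_add, MemLp.toLp_eq_toLp_iff]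
  exact h.poissonGrad_add_smul_ae_eq h' a

lemma neumannLp_add_smul (h : W12Data v g c) (h' : W12Data v' g' c') (a : ℂ) :
    (h.add_smul h' a).neumannLp = h.neumannLp + a • h'.neumannLp := by
  rw [neumannLp, neumannLp, neumannLp, ← MemLp.toLp_const_smul, ← MemLp.toLp_add,
    MemLp.toLp_eq_toLp_iff]
  exact h.neumannData_add_smul h' a

lemma funLp_add_smul (h : W12Data v g c) (h' : W12Data v' g' c') (a : ℂ) :
    (h.add_smul h' a).funLp = h.funLp + a • h'.funLp := rfl

lemma inner_gradLp (h : W12Data v g c) (h' : W12Data v' g' c') :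
    inner ℂ h'.gradLp h.gradLp = ∫ p in fluidDomain,
      inner ℂ (poissonGrad (inversionExt 1 v') p) (poissonGrad (inversionExt 1 v) p) := by
  rw [L2.inner_def]
  refine integral_congr_ae ?_
  filter_upwards [h.memLp_poissonGrad.coeFn_toLp, h'.memLp_poissonGrad.coeFn_toLp] with p e1 e2
  rw [gradLp, gradLp, e1, e2]

lemma inner_funLp_neumannLp (h : W12Data v g c) (h' : W12Data v' g' c') :
    inner ℂ h'.funLp h.neumannLp = ∫ x in freeSurface, neumannData g c x * conj (v' x) := by
  rw [L2.inner_def]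
  refine integral_congr_ae ?_
  filter_upwards [h.memLp_neumannData.coeFn_toLp, h'.memLp_fst.coeFn_toLp] with x e1 e2
  rw [neumannLp, funLp, e1, e2, RCLike.inner_apply]

lemma inner_gradLp_self_of_eq_zero (h : W12Data v g c) {R : ℝ} (hR : 1 ≤ R)
    (hg : ∀ x, R ≤ |x| → g x = 0) (hvR : ∀ x, R ≤ |x| → v x = 0) :
    inner ℂ h.gradLp h.gradLp = inner ℂ h.funLp h.neumannLp := by
  rw [inner_funLp_neumannLp, (h.integral_neumannData_mul_conj hR hg hvR).2,
    ← h.eLpNorm_poissonGrad_sq, inner_self_eq_norm_sq_to_K, gradLp, Lp.norm_toLp, ENNReal.toReal_pow]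
  push_cast
  rfl

lemma tendsto_toLp {α F : Type*} [MeasurableSpace α] [NormedAddCommGroup F] [NormedSpace ℂ F]
    {μ : Measure α} {f : α → F} {fn : ℕ → α → F} (hf : MemLp f 2 μ) (hn : ∀ n, MemLp (fn n) 2 μ)
    {ε : ℕ → ℝ≥0∞} (hε : Tendsto ε atTop (𝓝 0))
    (hle : ∀ n, eLpNorm (fn n + (-1 : ℂ) • f) 2 μ ≤ ε n) :
    Tendsto (fun n => (hn n).toLp (fn n)) atTop (𝓝 (hf.toLp f)) := by
  rw [Lp.tendsto_Lp_iff_tendsto_eLpNorm'']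
  refine tendsto_of_tendsto_of_tendsto_of_le_of_le tendsto_const_nhds hε (fun n => bot_le)
    fun n => ?_
  have := hle n
  rwa [neg_one_smul, ← sub_eq_add_neg] at this

/-- Both sides are continuous for the `W^{1,2}` norm, so the identity passes from functions of
bounded support to their limits. -/
lemma inner_gradLp_self (h : W12Data v g c) :
    inner ℂ h.gradLp h.gradLp = inner ℂ h.funLp h.neumannLp := by
  obtain ⟨vn, gn, cn, hd, hR, ht⟩ := h.exists_approx
  have hC : Tendsto (fun n => neumannConst * (eLpNorm (vn n + (-1 : ℂ) • v) 2
      (volume.restrict freeSurface) + eLpNorm (gn n + (-1 : ℂ) • g) 2 volume)) atTop (𝓝 0) := by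
    have := ENNReal.Tendsto.const_mul (a := neumannConst) ht (Or.inr neumannConst_ne_top)
    rwa [mul_zero] at this
  -- The a priori bounds are applied to the differences of the approximations and the limit, which
  -- are again `W12Data` by linearity.
  have t1 : Tendsto (fun n => (hd n).gradLp) atTop (𝓝 h.gradLp) := by
    refine tendsto_toLp h.memLp_poissonGrad (fun n => (hd n).memLp_poissonGrad) hC fun n => ?_
    rw [← eLpNorm_congr_ae ((hd n).poissonGrad_add_smul_ae_eq h (-1))]
    exact ((hd n).add_smul h (-1)).eLpNorm_poissonGrad_le
  have t2 : Tendsto (fun n => (hd n).neumannLp) atTop (𝓝 h.neumannLp) := by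
    refine tendsto_toLp h.memLp_neumannData (fun n => (hd n).memLp_neumannData) hC fun n => ?_
    rw [← eLpNorm_congr_ae ((hd n).neumannData_add_smul h (-1))]
    exact ((hd n).add_smul h (-1)).eLpNorm_neumannData_le
  have t3 : Tendsto (fun n => (hd n).funLp) atTop (𝓝 h.funLp) :=
    tendsto_toLp h.memLp_fst (fun n => (hd n).memLp_fst) ht fun n => le_add_right le_rfl
  refine tendsto_nhds_unique (t1.inner t1) ((t3.inner t2).congr fun n => ?_)
  obtain ⟨R, hR1, hR2, hR3⟩ := hR n
  exact ((hd n).inner_gradLp_self_of_eq_zero hR1 hR2 hR3).symm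

/-- The energy identity. -/
theorem inner_gradLp_eq (h : W12Data v g c) (h' : W12Data v' g' c') :
    inner ℂ h'.gradLp h.gradLp = inner ℂ h'.funLp h.neumannLp := by
  -- The difference of the two sides is sesquilinear and vanishes on the diagonal; testing it on `v
  -- + v'` and `v + i v'` shows that it vanishes. Symmetry of the Neumann operator is not used here,
  -- so it can be deduced afterwards.
  have k1 := (h.add_smul h' 1).inner_gradLp_self
  have k2 := (h.add_smul h' Complex.I).inner_gradLp_self
  have k3 := h.inner_gradLp_self
  have k4 := h'.inner_gradLp_self
  rw [h.gradLp_add_smul h', h.neumannLp_add_smul h', h.funLp_add_smul h'] at k1 k2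
  simp only [inner_add_left, inner_add_right,
    inner_smul_left, inner_smul_right, map_one, one_mul, Complex.conj_I, k3, k4] at k1 k2
  linear_combination (1 / 2 : ℂ) * k1 + (1 / 2 : ℂ) * Complex.I * k2 + (1 / 2 : ℂ) *
    (inner ℂ h'.gradLp h.gradLp - inner ℂ h'.funLp h.neumannLp -
      (inner ℂ h.gradLp h'.gradLp - inner ℂ h.funLp h'.neumannLp)) * Complex.I_sq

end W12Data

/-! ### The main theorem. -/

theorem mainTheorem5 :
    -- the gradient bound, with a constant that does not depend on `v`
    (∃ C : ℝ, 0 < C ∧ ∀ v : ℝ → ℂ, MemW12 v →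
      MemBeppoLevi fluidDomain (dirichletOp v) ∧
      eLpNorm (weakGrad fluidDomain (dirichletOp v)) 2 (volume.restrict fluidDomain) ≤
        ENNReal.ofReal (C * normW12 v)) ∧
    -- the Dirichlet-to-Neumann operator maps into `L²` of the free surface
    (∀ v : ℝ → ℂ, MemW12 v →
      (∀ᵐ x ∂(volume.restrict freeSurface),
        HilbertExistsAt (zeroExtDeriv v) x ∧ HilbertExistsAt (zeroExtDeriv v) (1 / x)) ∧
      MemLp (dirichletNeumann v) 2 (volume.restrict freeSurface)) ∧
    -- the energy identity; `inner ℂ a b` is conjugate linear in `a`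
    (∀ v u : ℝ → ℂ, MemW12 v → MemW12 u →
      ∫ p in fluidDomain, inner ℂ (weakGrad fluidDomain (dirichletOp u) p)
          (weakGrad fluidDomain (dirichletOp v) p) =
        ∫ x in freeSurface, dirichletNeumann v x * conj (u x)) ∧
    -- symmetry
    (∀ v u : ℝ → ℂ, MemW12 v → MemW12 u →
      ∫ x in freeSurface, dirichletNeumann v x * conj (u x) =
        ∫ x in freeSurface, v x * conj (dirichletNeumann u x)) := by
  -- The factor `2` compares the sum of the two `L²` norms with `normW12`; the summand `1` only
  -- makes the positivity of the constant immediate.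
  refine ⟨⟨2 * neumannConst.toReal + 1, by positivity, fun v hv => ?_⟩, fun v hv => ?_,
    fun v u hv hu => ?_, fun v u hv hu => ?_⟩
  · obtain ⟨c, h⟩ := hv.exists_w12Data
    refine ⟨memBeppoLevi_dirichletOp h.memLp_fst h.memLp_poissonGrad, ?_⟩
    rw [eLpNorm_congr_ae (weakGrad_dirichletOp_ae_eq h.memLp_fst)]
    have h0 : 0 ≤ normW12 v := Real.sqrt_nonneg _
    calc _ ≤ neumannConst * ENNReal.ofReal (2 * normW12 v) :=
          h.eLpNorm_poissonGrad_le.trans (mul_le_mul_right hv.eLpNorm_add_le _)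
      _ = ENNReal.ofReal (neumannConst.toReal * (2 * normW12 v)) := by
          rw [ENNReal.ofReal_mul ENNReal.toReal_nonneg, ENNReal.ofReal_toReal neumannConst_ne_top]
      _ ≤ _ := ENNReal.ofReal_le_ofReal (by linarith)
  · obtain ⟨c, h⟩ := hv.exists_w12Data
    refine ⟨hv.ae_hilbertExistsAt, ?_⟩
    rw [h.dirichletNeumann_eq EventuallyEq.rfl]
    exact h.memLp_neumannData
  · obtain ⟨c, h⟩ := hv.exists_w12Data
    obtain ⟨c', h'⟩ := hu.exists_w12Data
    rw [h.dirichletNeumann_eq EventuallyEq.rfl, ← h.inner_funLp_neumannLp h', ← h.inner_gradLp_eq h',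
      h.inner_gradLp h']
    refine integral_congr_ae ?_
    filter_upwards [weakGrad_dirichletOp_ae_eq h.memLp_fst, weakGrad_dirichletOp_ae_eq h'.memLp_fst]
      with p e1 e2
    rw [e1, e2]
  · obtain ⟨c, h⟩ := hv.exists_w12Data
    obtain ⟨c', h'⟩ := hu.exists_w12Data
    -- The right side is the conjugate of the same pairing with `v` and `u` exchanged; by the energy
    -- identity both pairings are Dirichlet forms, and the Dirichlet form is Hermitian.
    have e : ∫ x in freeSurface, v x * conj (dirichletNeumann u x) =
        conj (∫ x in freeSurface, dirichletNeumann u x * conj (v x)) := by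
      rw [← integral_conj]
      refine integral_congr_ae (Eventually.of_forall fun x => ?_)
      simp only [map_mul, Complex.conj_conj]
      ring
    rw [e, h.dirichletNeumann_eq EventuallyEq.rfl, h'.dirichletNeumann_eq EventuallyEq.rfl,
      ← h.inner_funLp_neumannLp h', ← h'.inner_funLp_neumannLp h, ← h.inner_gradLp_eq h',
      ← h'.inner_gradLp_eq h, inner_conj_symm]
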